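/- Let $\gamma>0$. For a finite set $J\subset\mathbb N$ let $\mathfrak{gl}(J)$ be the Lie algebra of complex matrices with rows and columns indexed by $J$, and $\mathcal U(\mathfrak{gl}(J))$ its universal enveloping algebra; for $I\subseteq J$ regard $\mathcal U(\mathfrak{gl}(I))$ as mapped to $\mathcal U(\mathfrak{gl}(J))$ by extending matrices by zeros. For $L\in\mathbb N$ let $\langle\,\cdot\,\rangle$ (depending on $L$) be the state of the one-sided Plancherel character of $U(\infty)$ with parameter $\gamma L$, i.e. $$\langle X\rangle = D_J(X)\,\exp\Bigl(\gamma L\sum_{i\in J}(x_{ii}-1)\Bigr)\Big|_{x_{ij}=\delta_{ij}},\qquad X\in\mathcal U(\mathfrak{gl}(J)),$$ where $D_J$ is the homomorphism to left-invariant differential operators in the matrix coordinates $x_{ij}$ with $D_J(E_{ij})=\sum_{a\in J}x_{ai}\partial_{aj}$. For $k\ge1$ and a finite set $I\subset\mathbb N$ let $p_{k,I}$ be the central element of $\mathcal U(\mathfrak{gl}(I))$ that acts in the finite-dimensional irreducible representation of highest weight $\lambda_1\ge\dots\ge\lambda_{|I|}$, $\lambda_i\in\mathbb Z$, as the scalar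 $$\sum_{i=1}^{|I|}\Bigl(\bigl(\lambda_i-i+\tfrac12\bigr)^k-\bigl(-i+\tfrac12\bigr)^k\Bigr);$$ such an element exists. Let $k,l\ge1$ and let $I_1=I_1(L)$, $I_2=I_2(L)$ be finite subsets of $\mathbb N$ such that the limits $$\eta_1=\lim_{L\to\infty}\frac{|I_1|}{L},\qquad \eta_2=\lim_{L\to\infty}\frac{|I_2|}{L},\qquad c=\lim_{L\to\infty}\frac{|I_1\cap I_2|}{L}$$ exist and are finite. Then, the product and the states being taken in $\mathcal U(\mathfrak{gl}(J))$ for any finite sets $J=J(L)\supseteq I_1(L)\cup I_2(L)$, $$\lim_{L\to\infty}\left\langle\frac{p_{k,I_1}-\langle p_{k,I_1}\rangle}{L^k}\cdot\frac{p_{l,I_2}-\langle p_{l,I_2}\rangle}{L^l}\right\rangle =\frac{kl}{\pi}\int_{\substack{|z|^2=\eta_1/\gamma\\ \Im z>0}}\int_{\substack{|w|^2=\eta_2/\gamma\\ \Im w>0}}x(z)^{k-1}x(w)^{l-1}\,\frac1{2\pi}\ln\left|\frac{c/\gamma-zw}{c/\gamma-z\bar w}\right|\,dx(w)\,dx(z),$$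 where $x(z)=\gamma(1-2\,\Re z)$ and the half-circles are parametrized counterclockwise, $z=\sqrt{\eta_1/\gamma}\,e^{i\theta}$, $w=\sqrt{\eta_2/\gamma}\,e^{i\varphi}$, $0<\theta,\varphi<\pi$ (if $\eta_1=0$ or $\eta_2=0$, the corresponding arc degenerates to the point $0$ and the integral is $0$). The integrand, as a function of $(\theta,\varphi)\in(0,\pi)^2$, is absolutely integrable. -/

import Mathlib

open Filter Topology
open scoped ContDiff

namespace UnitaryPlancherel

-- Associative rings (matrices, enveloping algebras, endomorphisms) carry the commutator bracket.
attribute [local instance 100] LieRing.ofAssociativeRing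

/-! ### The Lie algebras `gl(I)` and their universal enveloping algebras -/

/-- The complex Lie algebra `gl(I)` of all matrices with rows and columns indexed by the finite set
`I`; the bracket is the commutator. -/
abbrev gl (I : Finset ℕ) : Type := Matrix I I ℂ

/-- The universal enveloping algebra of `gl(I)`. -/
abbrev Ugl (I : Finset ℕ) : Type := UniversalEnvelopingAlgebra ℂ (gl I)

/-- The `J × I` matrix of the inclusion `ℂ^I → ℂ^J`. -/
def inclMatrix (I J : Finset ℕ) : Matrix J I ℂ :=
  Matrix.of fun j i => if (j : ℕ) = i then 1 else 0

theorem inclMatrix_transpose_mul {I J : Finset ℕ} (h : I ⊆ J) :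
    (inclMatrix I J).transpose * inclMatrix I J = 1 := by
  ext a b
  rw [Matrix.mul_apply, Finset.sum_eq_single (⟨a, h a.2⟩ : J)]
  · by_cases hab : a = b
    · subst hab
      simp [inclMatrix]
    · have hab' : (a : ℕ) ≠ b := fun e => hab (Subtype.ext e)
      rw [Matrix.one_apply_ne hab]
      simp [inclMatrix, hab']
  · intro j _ hj
    have hj' : (j : ℕ) ≠ a := fun e => hj (Subtype.ext e)
    simp [inclMatrix, hj']
  · intro hn
    exact absurd (Finset.mem_univ _) hn

/-- The embedding `gl(I) → gl(J)`, `I ⊆ J`, extending a matrix by zeros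
(`E_ij ↦ E_ij` for `i, j ∈ I`). -/
noncomputable def glIncl {I J : Finset ℕ} (h : I ⊆ J) : gl I →ₗ⁅ℂ⁆ gl J where
  toFun X := inclMatrix I J * X * (inclMatrix I J).transpose
  map_add' X Y := by simp [Matrix.mul_add, Matrix.add_mul]
  map_smul' c X := by simp
  map_lie' {X Y} := by
    have key : ∀ X Y : gl I, (inclMatrix I J * X * (inclMatrix I J).transpose) *
        (inclMatrix I J * Y * (inclMatrix I J).transpose) =
        inclMatrix I J * (X * Y) * (inclMatrix I J).transpose := by
      intro X Y
      calc _ = inclMatrix I J * X * ((inclMatrix I J).transpose * inclMatrix I J) * Y *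
            (inclMatrix I J).transpose := by simp only [Matrix.mul_assoc]
        _ = _ := by rw [inclMatrix_transpose_mul h]; simp only [Matrix.mul_assoc, Matrix.one_mul]
    simp only [Ring.lie_def, key, Matrix.mul_sub, Matrix.sub_mul]

/-- The induced embedding `U(gl(I)) → U(gl(J))`, `I ⊆ J`. -/
noncomputable def UglIncl {I J : Finset ℕ} (h : I ⊆ J) : Ugl I →ₐ[ℂ] Ugl J :=
  UniversalEnvelopingAlgebra.lift ℂ ((UniversalEnvelopingAlgebra.ι ℂ).comp (glIncl h))

/-! ### Left-invariant differential operators and the state of the one-sided Plancherel character -/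

/-- The matrix coordinates `x = (x_ij)`, `i, j ∈ J`. -/
abbrev Coord (J : Finset ℕ) : Type := J → J → ℂ

/-- Holomorphic functions of the matrix coordinates. -/
noncomputable def holFun (J : Finset ℕ) : Submodule ℂ (Coord J → ℂ) where
  carrier := {f | ContDiff ℂ ∞ f}
  add_mem' {f g} hf hg := by
    have hf' : ContDiff ℂ ∞ f := hf
    have hg' : ContDiff ℂ ∞ g := hg
    exact hf'.add hg'
  zero_mem' := by
    have h : ContDiff ℂ ∞ (fun _ : Coord J => (0 : ℂ)) := contDiff_const
    exact h
  smul_mem' c f hf := by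
    have hf' : ContDiff ℂ ∞ f := hf
    exact contDiff_const.smul hf'

/-- Right multiplication `x ↦ x X` by a matrix, in coordinates. -/
noncomputable def mulRightCLM {J : Finset ℕ} (X : gl J) : Coord J →L[ℂ] Coord J :=
  LinearMap.toContinuousLinearMap
    { toFun := fun x a b => ∑ i, x a i * X i b
      map_add' := by
        intro x y
        ext a b
        simp [add_mul, Finset.sum_add_distrib]
      map_smul' := by
        intro c x
        ext a b
        simp [Finset.mul_sum, mul_assoc] }

theorem mulRightCLM_apply {J : Finset ℕ} (X : gl J) (x : Coord J) (a b : J) :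
    mulRightCLM X x a b = ∑ i, x a i * X i b := rfl

theorem mulRightCLM_add {J : Finset ℕ} (X Y : gl J) (x : Coord J) :
    mulRightCLM (X + Y) x = mulRightCLM X x + mulRightCLM Y x := by
  ext a b
  simp [mulRightCLM_apply, mul_add, Finset.sum_add_distrib]

theorem mulRightCLM_smul {J : Finset ℕ} (c : ℂ) (X : gl J) (x : Coord J) :
    mulRightCLM (c • X) x = c • mulRightCLM X x := by
  ext a b
  simp only [mulRightCLM_apply, Matrix.smul_apply, Pi.smul_apply, smul_eq_mul, Finset.mul_sum]
  exact Finset.sum_congr rfl fun i _ => by ring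

theorem mulRightCLM_sub {J : Finset ℕ} (X Y : gl J) (x : Coord J) :
    mulRightCLM (X - Y) x = mulRightCLM X x - mulRightCLM Y x := by
  ext a b
  simp [mulRightCLM_apply, mul_sub, Finset.sum_sub_distrib]

theorem mulRightCLM_mul {J : Finset ℕ} (X Y : gl J) (x : Coord J) :
    mulRightCLM (X * Y) x = mulRightCLM Y (mulRightCLM X x) := by
  ext a b
  simp only [mulRightCLM_apply, Matrix.mul_apply, Finset.mul_sum, Finset.sum_mul]
  rw [Finset.sum_comm]
  exact Finset.sum_congr rfl fun i _ => Finset.sum_congr rfl fun j _ => by ring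

theorem contDiff_fderiv_mulRight {J : Finset ℕ} (X : gl J) {f : Coord J → ℂ}
    (hf : ContDiff ℂ ∞ f) : ContDiff ℂ ∞ fun x => fderiv ℂ f x (mulRightCLM X x) := by
  have h1 : ContDiff ℂ ∞ (fderiv ℂ f) := (contDiff_infty_iff_fderiv.1 hf).2
  exact h1.clm_apply (mulRightCLM X).contDiff

theorem fderiv_fderiv_mulRight {J : Finset ℕ} (X Y : gl J) {f : Coord J → ℂ}
    (hf : ContDiff ℂ ∞ f) (x : Coord J) :
    fderiv ℂ (fun x => fderiv ℂ f x (mulRightCLM Y x)) x (mulRightCLM X x) =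
      fderiv ℂ (fderiv ℂ f) x (mulRightCLM X x) (mulRightCLM Y x) +
        fderiv ℂ f x (mulRightCLM Y (mulRightCLM X x)) := by
  have h1 : Differentiable ℂ (fderiv ℂ f) :=
    (contDiff_infty_iff_fderiv.1 (contDiff_infty_iff_fderiv.1 hf).2).1
  have h3 := (h1 x).hasFDerivAt.clm_apply (mulRightCLM Y).hasFDerivAt
  rw [h3.fderiv]
  simp [add_comm]

/-- The action of `gl(J)` by left-invariant vector fields,
`(D_X f)(x) = d/dt f(x exp(tX))` at `t = 0`; thus `E_ij` acts as `∑_a x_ai ∂_aj`. -/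
noncomputable def leftInvField (J : Finset ℕ) : gl J →ₗ⁅ℂ⁆ Module.End ℂ (holFun J) where
  toFun X :=
    { toFun := fun f =>
        ⟨fun x => fderiv ℂ f.1 x (mulRightCLM X x), contDiff_fderiv_mulRight X f.2⟩
      map_add' := by
        intro f₁ f₂
        ext x
        have h₁ : DifferentiableAt ℂ f₁.1 x := (contDiff_infty_iff_fderiv.1 f₁.2).1 x
        have h₂ : DifferentiableAt ℂ f₂.1 x := (contDiff_infty_iff_fderiv.1 f₂.2).1 x
        simp [fderiv_add h₁ h₂]
      map_smul' := by
        intro c f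
        ext x
        have h : DifferentiableAt ℂ f.1 x := (contDiff_infty_iff_fderiv.1 f.2).1 x
        simp [fderiv_const_smul h c] }
  map_add' X Y := by
    ext f x
    simp [mulRightCLM_add]
  map_smul' c X := by
    ext f x
    simp [mulRightCLM_smul]
  map_lie' {X Y} := by
    ext f x
    have hf : ContDiff ℂ ∞ f.1 := f.2
    have hs : IsSymmSndFDerivAt ℂ f.1 x :=
      (contDiff_infty.1 hf 2).contDiffAt.isSymmSndFDerivAt (by simp)
    simp only [Ring.lie_def]
    change fderiv ℂ f.1 x (mulRightCLM (X * Y - Y * X) x) =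
      fderiv ℂ (fun x => fderiv ℂ f.1 x (mulRightCLM Y x)) x (mulRightCLM X x) -
        fderiv ℂ (fun x => fderiv ℂ f.1 x (mulRightCLM X x)) x (mulRightCLM Y x)
    rw [fderiv_fderiv_mulRight X Y f.2, fderiv_fderiv_mulRight Y X f.2,
      hs.eq (mulRightCLM X x) (mulRightCLM Y x), mulRightCLM_sub, map_sub, mulRightCLM_mul,
      mulRightCLM_mul]
    ring

/-- The isomorphism `D_J` from `U(gl(J))` to left-invariant differential operators. -/
noncomputable def diffOp (J : Finset ℕ) : Ugl J →ₐ[ℂ] Module.End ℂ (holFun J) :=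
  UniversalEnvelopingAlgebra.lift ℂ (leftInvField J)

/-- The one-sided Plancherel character with parameter `s`, restricted to `U(J)` and written in the
matrix coordinates: `exp (s ∑_{i ∈ J} (x_ii - 1))`. -/
noncomputable def plancherelChar (J : Finset ℕ) (s : ℝ) : holFun J :=
  ⟨fun x => Complex.exp (s * ∑ i, (x i i - 1)), by
    have h : ∀ i : J, ContDiff ℂ ∞ fun x : Coord J => x i i := fun i =>
      contDiff_apply_apply ℂ ℂ i i
    have h' : ContDiff ℂ ∞ fun x : Coord J => Complex.exp (s * ∑ i, (x i i - 1)) :=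
      (contDiff_const.mul (ContDiff.sum fun i _ => (h i).sub contDiff_const)).cexp
    exact h'⟩

/-- The state `⟨X⟩ = D_J(X) χ |_{x_ij = δ_ij}` on `U(gl(J))`, where `χ` is the one-sided Plancherel
character with parameter `s`. -/
noncomputable def state (J : Finset ℕ) (s : ℝ) (X : Ugl J) : ℂ :=
  (diffOp J X (plancherelChar J s)).1 fun i j => if i = j then 1 else 0

/-! ### Shifted power sums as central elements -/

/-- `v` is a nonzero highest weight vector of weight `lam` in the `gl(I)`-module `V`: with
`a_1 < a_2 < ...` the elements of `I`, it satisfies `E_{a_i a_i} v = lam_i v`, and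
`E_{a_i a_j} v = 0` for `i < j`. -/
def IsHighestWeightVector (I : Finset ℕ) {V : Type} [AddCommGroup V] [Module ℂ V]
    [LieRingModule (gl I) V] (lam : Fin I.card → ℤ) (v : V) : Prop :=
  v ≠ 0 ∧
  (∀ i : Fin I.card,
    ⁅(Matrix.single (I.orderIsoOfFin rfl i) (I.orderIsoOfFin rfl i) 1 : gl I), v⁆ =
      (lam i : ℂ) • v) ∧
  ∀ i j : Fin I.card, i < j →
    ⁅(Matrix.single (I.orderIsoOfFin rfl i) (I.orderIsoOfFin rfl j) 1 : gl I), v⁆ = 0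

/-- The canonical correspondence between the center of `U(gl(I))` and functions on signatures:
`z` is central, and in every finite-dimensional irreducible `gl(I)`-module whose highest weight is
a signature `lam` (a weakly decreasing integer sequence of length `|I|`) it acts as the scalar
`f lam`. -/
def CorrespondsTo (I : Finset ℕ) (z : Ugl I) (f : (Fin I.card → ℤ) → ℂ) : Prop :=
  z ∈ Subalgebra.center ℂ (Ugl I) ∧
  ∀ (V : Type) [AddCommGroup V] [Module ℂ V] [LieRingModule (gl I) V] [LieModule ℂ (gl I) V]
    [FiniteDimensional ℂ V] [LieModule.IsIrreducible ℂ (gl I) V] (lam : Fin I.card → ℤ),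
    Antitone lam → (∃ v : V, IsHighestWeightVector I lam v) →
      ∀ v : V, UniversalEnvelopingAlgebra.lift ℂ (LieModule.toEnd ℂ (gl I) V) z v = f lam • v

/-- The shifted power sum
`∑_{i=1}^{N} ((lam_i - i + 1/2)^k - (-i + 1/2)^k)` (the index `i : Fin N` starts at zero). -/
noncomputable def shiftedPowerSum (N k : ℕ) (lam : Fin N → ℤ) : ℂ :=
  ∑ i : Fin N, (((lam i : ℂ) - ((i : ℕ) + 1) + 1 / 2) ^ k - (-(((i : ℕ) : ℂ) + 1) + 1 / 2) ^ k)

open Classical in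
/-- `p_{k,I}` as an element of `U(gl(I))`: the central element that corresponds to the shifted
power sum under the canonical correspondence. There is exactly one such element, because a central
element is determined by the scalars through which it acts; the value `0` is never used. -/
noncomputable def pElt (k : ℕ) (I : Finset ℕ) : Ugl I :=
  if h : ∃ z : Ugl I, CorrespondsTo I z (shiftedPowerSum I.card k) then h.choose else 0

/-- `L^{-k} (p_{k,I} - ⟨p_{k,I}⟩)` as an element of `U(gl(J))`, `I ⊆ J`, where the state is that of
the one-sided Plancherel character with parameter `gam * L`. -/
noncomputable def fluctuation (gam : ℝ) (L k : ℕ) {I J : Finset ℕ} (h : I ⊆ J) : Ugl J :=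
  ((L : ℂ) ^ k)⁻¹ •
    (UglIncl h (pElt k I) - algebraMap ℂ (Ugl J) (state J (gam * L) (UglIncl h (pElt k I))))

/-! ### The limiting covariance -/

/-- The function `x(z) = γ (1 - 2 Re z)`. -/
noncomputable def xCoord (gam : ℝ) (z : ℂ) : ℝ := gam * (1 - 2 * z.re)

/-- The parametrization `z(θ) = √(η/γ) e^{iθ}`, `0 < θ < π`, of the half-circle `|z|² = η/γ`,
`Im z > 0`. -/
noncomputable def arc (gam eta θ : ℝ) : ℂ :=
  (Real.sqrt (eta / gam) : ℂ) * Complex.exp (θ * Complex.I)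

/-- The covariance kernel `(1/2π) ln |(c/γ - z w) / (c/γ - z w̄)|`. -/
noncomputable def covKernel (gam c : ℝ) (z w : ℂ) : ℝ :=
  1 / (2 * Real.pi) *
    Real.log ‖((c / gam : ℝ) - z * w) / ((c / gam : ℝ) - z * (starRingEnd ℂ) w)‖

/-- The integrand `x(z)^{k-1} x(w)^{l-1} K(z,w) dx(z) dx(w)` pulled back to the angles `(θ, φ)` by
the parametrizations `z = z(θ)` and `w = w(φ)` of the two half-circles. -/
noncomputable def covIntegrand (gam eta₁ eta₂ c : ℝ) (k l : ℕ) (θ φ : ℝ) : ℝ :=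
  xCoord gam (arc gam eta₁ θ) ^ (k - 1) * xCoord gam (arc gam eta₂ φ) ^ (l - 1) *
    covKernel gam c (arc gam eta₁ θ) (arc gam eta₂ φ) *
    deriv (fun t => xCoord gam (arc gam eta₁ t)) θ *
    deriv (fun t => xCoord gam (arc gam eta₂ t)) φ

end UnitaryPlancherel

open UnitaryPlancherel

namespace UnitaryPlancherel

attribute [local instance] LieRing.ofAssociativeRing

/-! Write u = x - 1 and s = γL. Conjugating by the character exp(s tr u) turns the left-invariant
field of X into f ↦ D_X f + s tr(xX) f on polynomials in u, and the state becomes the constant term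
of the result (`state_eq`).

The elements p_k exist because the Gelfand invariants tr (E - N)^k act on highest weight vectors
through a product formula (`gelfandSeries_mul_prod`), whose logarithmic derivative expresses all
power sums of a_i = λ_i - i.

The algebraic heart is a coproduct formula (`stdTensor_act`). Tensoring with the standard
representation adds a box to λ. A box of content t changes p_k by g_k(t) = (t + 1/2)^k - (t -
1/2)^k, and the contents are the eigenvalues of F = Σ E_cb ⊗ E_bc. For fixed a, the entries x_ab
with b ∈ I transform in the standard representation, so moving D(p_k) past x_ab costs exactly one
factor g_k(F) (`inclAct_xMat_mul`). Commutation with left translations then gives the gradient of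
D(p_l)1 (`pderiv_inclAct_one`), and Euler's formula reduces the constant term of D(p_k)f to the
gradient of f (`constantCoeff_inclAct`). Together they give the exact covariance s · tr_{I₁} g_k(F₁)
∫ g_l(F₂) P_{I₂}, evaluated at u = 0, where P_I is the projection onto I and ∫ divides the part of
degree n by n + 1 (`state_mul_sub`).

For the limit, F/L acts on words in u and projections. Up to terms of size O(1/L) times bounded
words, it keeps the word, prefixes a letter, or removes the first letter with weight |I ∩ S|/L,
where S is the projection before that letter (`scaledF_cons`). The leading coefficient of g_k
supplies the factor k. What remains are three-term recursions with symbol γ + 2r cos θ, r² = γη,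
which is x(z) on the circle |z|² = η/γ (`tendsto_state_fluctuation_mul`).

Both recursions are diagonalised by sin(nθ). The overlap of the two index sets together with the
division by n + 1 multiplies the n-th mode by q^n/n, q = c/√(η₁η₂), up to a constant. These are, up
to the factor π, the eigenvalues of the logarithmic kernel (`integral_arcKernel_mul_sin`), so the
solution is the stated double integral. If η₁η₂ = 0, then c = 0 and both sides vanish. -/

/-- A subalgebra of an enveloping algebra that contains the Lie algebra is everything. -/
theorem mem_of_forall_ι_mem {L : Type*} [LieRing L] [LieAlgebra ℂ L]
    (S : Subalgebra ℂ (UniversalEnvelopingAlgebra ℂ L))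
    (h : ∀ x : L, UniversalEnvelopingAlgebra.ι ℂ x ∈ S) (z : UniversalEnvelopingAlgebra ℂ L) :
    z ∈ S := by
  let f : L →ₗ⁅ℂ⁆ S :=
    { toFun := fun x => ⟨UniversalEnvelopingAlgebra.ι ℂ x, h x⟩
      map_add' := fun x y => Subtype.ext (by simp)
      map_smul' := fun c x => Subtype.ext (by simp)
      map_lie' := fun {x y} => Subtype.ext (LieHom.map_lie (UniversalEnvelopingAlgebra.ι ℂ) x y) }
  have key : S.val.comp (UniversalEnvelopingAlgebra.lift ℂ f) =
      AlgHom.id ℂ (UniversalEnvelopingAlgebra ℂ L) := by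
    apply UniversalEnvelopingAlgebra.hom_ext
    ext x
    change ((UniversalEnvelopingAlgebra.lift ℂ f (UniversalEnvelopingAlgebra.ι ℂ x) : S) :
      UniversalEnvelopingAlgebra ℂ L) = UniversalEnvelopingAlgebra.ι ℂ x
    rw [UniversalEnvelopingAlgebra.lift_ι_apply]
    rfl
  have := DFunLike.congr_fun key z
  rw [AlgHom.id_apply] at this
  rw [← this]
  exact Subtype.coe_prop _

/-! ### The algebraic model of left-invariant differential operators -/

/-- Polynomials in the coordinates `u_ab = x_ab - δ_ab`. -/
abbrev PolyAlg (J : Finset ℕ) : Type := MvPolynomial (J × J) ℂ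

/-- The generic matrix `x = 1 + u`. -/
noncomputable def xMat (J : Finset ℕ) : Matrix J J (PolyAlg J) :=
  1 + Matrix.of fun a b => MvPolynomial.X (a, b)

/-- The matrix `x X` of polynomials. -/
noncomputable def xMul {J : Finset ℕ} (X : gl J) : Matrix J J (PolyAlg J) :=
  xMat J * Matrix.map X MvPolynomial.C

/-- The left-invariant vector field `x ↦ x X` as a derivation. -/
noncomputable def glDer {J : Finset ℕ} (X : gl J) : Derivation ℂ (PolyAlg J) (PolyAlg J) :=
  MvPolynomial.mkDerivation ℂ fun p => xMul X p.1 p.2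

theorem glDer_X {J : Finset ℕ} (X : gl J) (a b : J) :
    glDer X (MvPolynomial.X (a, b)) = xMul X a b := by
  simp [glDer, MvPolynomial.mkDerivation_X]

theorem glDer_xMat {J : Finset ℕ} (X : gl J) (a b : J) :
    glDer X (xMat J a b) = xMul X a b := by
  have h : glDer X ((1 : Matrix J J (PolyAlg J)) a b) = 0 := by
    by_cases hab : a = b
    · subst hab; simp
    · simp [hab]
  rw [← glDer_X]
  simp [xMat, h]

theorem xMul_add {J : Finset ℕ} (X Y : gl J) : xMul (X + Y) = xMul X + xMul Y := by
  rw [xMul, xMul, xMul, ← Matrix.mul_add]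
  congr 1
  ext i j : 2
  simp

theorem xMul_sub {J : Finset ℕ} (X Y : gl J) : xMul (X - Y) = xMul X - xMul Y := by
  rw [xMul, xMul, xMul, ← Matrix.mul_sub]
  congr 1
  ext i j : 2
  simp

theorem xMul_smul {J : Finset ℕ} (c : ℂ) (X : gl J) : xMul (c • X) = c • xMul X := by
  rw [xMul, xMul, ← Matrix.mul_smul]
  congr 1
  ext i j : 2
  simp [MvPolynomial.smul_eq_C_mul]

theorem glDer_xMul {J : Finset ℕ} (X Y : gl J) (a b : J) :
    glDer X (xMul Y a b) = xMul (X * Y) a b := by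
  have h1 : xMul (X * Y) = xMul X * Matrix.map Y MvPolynomial.C := by
    rw [xMul, xMul, Matrix.mul_assoc]
    congr 1
    ext i j : 2
    simp [Matrix.mul_apply]
  have : ∀ i, glDer X (xMat J a i * MvPolynomial.C (Y i b)) =
      xMul X a i * MvPolynomial.C (Y i b) := by
    intro i
    rw [Derivation.leibniz, glDer_xMat]
    simp only [MvPolynomial.derivation_C, smul_zero, smul_eq_mul]
    ring
  rw [h1, xMul, Matrix.mul_apply, map_sum, Matrix.mul_apply]
  exact Finset.sum_congr rfl fun i _ => this i

theorem glDer_trace {J : Finset ℕ} (X Y : gl J) :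
    glDer X (xMul Y).trace =
      (xMul (X * Y)).trace := by
  simp only [Matrix.trace, Matrix.diag_apply, map_sum, glDer_xMul]

theorem glDer_add {J : Finset ℕ} (X Y : gl J) : glDer (X + Y) = glDer X + glDer Y := by
  apply MvPolynomial.derivation_ext
  rintro ⟨a, b⟩
  rw [Derivation.add_apply, glDer_X, glDer_X, glDer_X, xMul_add, Matrix.add_apply]

theorem glDer_smul {J : Finset ℕ} (c : ℂ) (X : gl J) : glDer (c • X) = c • glDer X := by
  apply MvPolynomial.derivation_ext
  rintro ⟨a, b⟩
  rw [Derivation.smul_apply, glDer_X, glDer_X, xMul_smul, Matrix.smul_apply]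

theorem glDer_lie {J : Finset ℕ} (X Y : gl J) : glDer ⁅X, Y⁆ = ⁅glDer X, glDer Y⁆ := by
  apply MvPolynomial.derivation_ext
  rintro ⟨a, b⟩
  rw [Derivation.commutator_apply, glDer_X, glDer_X, glDer_X, glDer_xMul, glDer_xMul, Ring.lie_def,
    xMul_sub, Matrix.sub_apply]

/-- The representation of `gl(J)` on polynomials obtained from the left-invariant vector fields by
conjugating with `exp (s tr (x - 1))`. -/
noncomputable def polyRep (J : Finset ℕ) (s : ℂ) : gl J →ₗ⁅ℂ⁆ Module.End ℂ (PolyAlg J) where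
  toFun X := (glDer X).toLinearMap +
    LinearMap.mulLeft ℂ (s • (xMul X).trace)
  map_add' X Y := by
    rw [glDer_add, xMul_add, Matrix.trace_add, smul_add]
    refine LinearMap.ext fun f => ?_
    simp only [LinearMap.add_apply, LinearMap.mulLeft_apply, Derivation.coeFn_coe,
      Derivation.add_apply]
    ring
  map_smul' c X := by
    rw [glDer_smul, xMul_smul, Matrix.trace_smul, smul_comm]
    refine LinearMap.ext fun f => ?_
    simp only [LinearMap.add_apply, LinearMap.mulLeft_apply, Derivation.coeFn_coe,
      Derivation.smul_apply, RingHom.id_apply, LinearMap.smul_apply, smul_add, smul_mul_assoc]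
  map_lie' {X Y} := by
    refine LinearMap.ext fun f => ?_
    have h : (glDer ⁅X, Y⁆ : PolyAlg J → PolyAlg J) f =
        glDer X (glDer Y f) - glDer Y (glDer X f) := by
      rw [glDer_lie, Derivation.commutator_apply]
    rw [Ring.lie_def, Ring.lie_def] at *
    simp only [LinearMap.add_apply, LinearMap.mulLeft_apply, Derivation.coeFn_coe,
      LinearMap.sub_apply, Module.End.mul_apply, h, map_add, Derivation.leibniz, smul_eq_mul,
      glDer_trace, Derivation.map_smul, xMul_sub, Matrix.trace_sub, smul_sub]
    ring

theorem polyRep_apply {J : Finset ℕ} (s : ℂ) (X : gl J) (f : PolyAlg J) :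
    polyRep J s X f = glDer X f + s • (xMul X).trace * f := by
  simp [polyRep]

/-- The action of the enveloping algebra on polynomials. -/
noncomputable def polyAct (J : Finset ℕ) (s : ℂ) : Ugl J →ₐ[ℂ] Module.End ℂ (PolyAlg J) :=
  UniversalEnvelopingAlgebra.lift ℂ (polyRep J s)

/-- The function `χ(x) h(x - 1)` attached to a polynomial `h`. -/
noncomputable def polyFun (J : Finset ℕ) (s : ℝ) (h : PolyAlg J) : Coord J → ℂ := fun x =>
  (plancherelChar J s).1 x *
    MvPolynomial.eval (fun p : J × J => x p.1 p.2 - if p.1 = p.2 then 1 else 0) h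

theorem contDiff_polyFun (J : Finset ℕ) (s : ℝ) (h : PolyAlg J) :
    ContDiff ℂ ∞ (polyFun J s h) := by
  have h1 : ContDiff ℂ ∞ (plancherelChar J s).1 := (plancherelChar J s).2
  refine h1.mul ?_
  induction h using MvPolynomial.induction_on with
  | C a => simpa using contDiff_const
  | add p q hp hq => simpa using hp.add hq
  | mul_X p i hp =>
    have : ContDiff ℂ ∞ fun x : Coord J => x i.1 i.2 := contDiff_apply_apply ℂ ℂ i.1 i.2
    simpa using hp.mul (this.sub contDiff_const)

theorem eval_xMat {J : Finset ℕ} (x : Coord J) (a b : J) :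
    MvPolynomial.eval (fun p : J × J => x p.1 p.2 - if p.1 = p.2 then 1 else 0) (xMat J a b) =
      x a b := by
  by_cases hab : a = b
  · subst hab; simp [xMat]
  · simp [xMat, hab]

theorem eval_xMul {J : Finset ℕ} (x : Coord J) (X : gl J) (a b : J) :
    MvPolynomial.eval (fun p : J × J => x p.1 p.2 - if p.1 = p.2 then 1 else 0)
      (xMul X a b) = mulRightCLM X x a b := by
  rw [xMul, Matrix.mul_apply, map_sum, mulRightCLM_apply]
  exact Finset.sum_congr rfl fun i _ => by rw [map_mul, eval_xMat]; simp

/-- The product rule: the exponential contributes the factor s tr(xX), which is the multiplication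
term of `polyRep`. Both sides obey the same rule when the polynomial is multiplied by a coordinate.
-/
theorem fderiv_polyFun {J : Finset ℕ} (s : ℝ) (X : gl J) (h : PolyAlg J) (x : Coord J) :
    fderiv ℂ (polyFun J s h) x (mulRightCLM X x) = polyFun J s (polyRep J s X h) x := by
  have hd : ∀ h, DifferentiableAt ℂ (polyFun J s h) x := fun h =>
    (contDiff_infty_iff_fderiv.1 (contDiff_polyFun J s h)).1 x
  have hx : ∀ a b : J, HasFDerivAt (fun x : Coord J => x a b)
      (((ContinuousLinearMap.proj b : (J → ℂ) →L[ℂ] ℂ)).comp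
        (ContinuousLinearMap.proj a : Coord J →L[ℂ] (J → ℂ))) x := fun a b =>
    (((ContinuousLinearMap.proj b : (J → ℂ) →L[ℂ] ℂ)).comp
        (ContinuousLinearMap.proj a : Coord J →L[ℂ] (J → ℂ))).hasFDerivAt
  induction h using MvPolynomial.induction_on with
  | C c =>
    have h1 : polyFun J s (MvPolynomial.C c) = fun x : Coord J =>
        Complex.exp (s * ∑ i, (x i i - 1)) * c := by
      ext x; simp [polyFun, plancherelChar]
    have h2 : HasFDerivAt (fun x : Coord J => Complex.exp (s * ∑ i, (x i i - 1)) * c) _ x :=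
      (((HasFDerivAt.fun_sum fun i (_ : i ∈ Finset.univ) =>
        (hx i i).sub_const (1 : ℂ)).const_mul (s : ℂ)).cexp).mul_const c
    rw [h1, h2.fderiv]
    simp only [smul_apply, sum_apply,
      ContinuousLinearMap.comp_apply, ContinuousLinearMap.proj_apply, smul_eq_mul, polyFun,
      plancherelChar, polyRep_apply, MvPolynomial.derivation_C, zero_add, Matrix.trace,
      Matrix.diag_apply, map_mul, MvPolynomial.smul_eval, map_sum, eval_xMul,
      MvPolynomial.eval_C]
    ring
  | add p q hp hq =>
    have h1 : polyFun J s (p + q) = fun x => polyFun J s p x + polyFun J s q x := by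
      ext x; simp [polyFun, mul_add]
    rw [h1, fderiv_fun_add (hd p) (hd q), add_apply, hp, hq, map_add]
    simp [polyFun, mul_add]
  | mul_X p i hp =>
    obtain ⟨a, b⟩ := i
    have h1 : polyFun J s (p * MvPolynomial.X (a, b)) =
        fun x => polyFun J s p x * (x a b - if a = b then 1 else 0) := by
      ext x; simp [polyFun, mul_assoc]
    have h2 := (hd p).hasFDerivAt.mul ((hx a b).sub_const (if a = b then (1 : ℂ) else 0))
    have h3 : fderiv ℂ (fun x : Coord J => polyFun J s p x * (x a b - if a = b then 1 else 0)) x =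
        _ := HasFDerivAt.fderiv h2
    rw [h1, h3]
    simp only [add_apply, smul_apply, hp,
      ContinuousLinearMap.comp_apply, ContinuousLinearMap.proj_apply, smul_eq_mul]
    simp only [polyFun, polyRep_apply, Derivation.leibniz, glDer_X, map_add, map_mul, smul_eq_mul,
      MvPolynomial.eval_X, eval_xMul]
    ring

/-- The functions χ·h are stable under all left-invariant operators, so the analytic action may be
replaced by a polynomial one. Elements with this property form a subalgebra, and only the generators
need a check. -/
theorem diffOp_polyFun (J : Finset ℕ) (s : ℝ) (Z : Ugl J) : ∀ h : PolyAlg J,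
    diffOp J Z ⟨polyFun J s h, contDiff_polyFun J s h⟩ =
      ⟨polyFun J s (polyAct J s Z h), contDiff_polyFun J s _⟩ := by
  have hadd : ∀ p q : PolyAlg J, polyFun J s (p + q) = polyFun J s p + polyFun J s q := by
    intro p q; ext x; simp [polyFun, mul_add]
  have hsmul : ∀ (c : ℂ) (p : PolyAlg J), polyFun J s (c • p) = c • polyFun J s p := by
    intro c p; ext x; simp [polyFun]; ring
  let S : Subalgebra ℂ (Ugl J) :=
    { carrier := {Z | ∀ h : PolyAlg J, diffOp J Z ⟨polyFun J s h, contDiff_polyFun J s h⟩ =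
        ⟨polyFun J s (polyAct J s Z h), contDiff_polyFun J s _⟩}
      mul_mem' := by
        intro a b ha hb h
        rw [map_mul, Module.End.mul_apply, hb h, ha, map_mul, Module.End.mul_apply]
      add_mem' := by
        intro a b ha hb h
        rw [map_add, LinearMap.add_apply, hb h, ha h, map_add, LinearMap.add_apply]
        exact Subtype.ext (hadd _ _).symm
      algebraMap_mem' := by
        intro c h
        rw [AlgHom.commutes, AlgHom.commutes, Module.algebraMap_end_apply,
          Module.algebraMap_end_apply]
        exact Subtype.ext (hsmul _ _).symm }
  refine mem_of_forall_ι_mem S (fun X h => ?_) Z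
  rw [diffOp, polyAct, UniversalEnvelopingAlgebra.lift_ι_apply,
    UniversalEnvelopingAlgebra.lift_ι_apply]
  exact Subtype.ext (funext fun x => fderiv_polyFun s X h x)

/-- The state is the vacuum expectation in the algebraic model. -/
theorem state_eq (J : Finset ℕ) (s : ℝ) (Z : Ugl J) :
    state J s Z = MvPolynomial.constantCoeff (polyAct J s Z 1) := by
  have h1 : plancherelChar J s = ⟨polyFun J s 1, contDiff_polyFun J s 1⟩ :=
    Subtype.ext (funext fun x => by simp [polyFun])
  rw [state, h1, diffOp_polyFun]
  simp only [polyFun, plancherelChar, if_true, sub_self, Finset.sum_const_zero, mul_zero,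
    Complex.exp_zero, one_mul]
  exact DFunLike.congr_fun MvPolynomial.eval_zero' _

/-! ### Central elements acting by shifted power sums -/

/-- The generators `E_ij` of `U(gl(I))`, indexed by the positions in `I`. -/
noncomputable def Egen (I : Finset ℕ) (i j : Fin I.card) : Ugl I :=
  UniversalEnvelopingAlgebra.ι ℂ
    (Matrix.single (I.orderIsoOfFin rfl i) (I.orderIsoOfFin rfl j) 1 : gl I)

theorem Egen_comm (I : Finset ℕ) (i j m n : Fin I.card) :
    Egen I i j * Egen I m n - Egen I m n * Egen I i j =
      (if j = m then Egen I i n else 0) - (if i = n then Egen I m j else 0) := by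
  simp only [Egen]
  rw [← Ring.lie_def, ← LieHom.map_lie, Ring.lie_def, map_sub]
  congr 1
  · by_cases h : j = m
    · subst h; simp
    · rw [if_neg h, Matrix.single_mul_single_of_ne, map_zero]
      simpa using h
  · by_cases h : i = n
    · subst h; simp
    · rw [if_neg h, Matrix.single_mul_single_of_ne, map_zero]
      simpa using fun e => h e.symm

theorem mem_center_of_commute_Egen {I : Finset ℕ} {z : Ugl I}
    (h : ∀ i j, Egen I i j * z = z * Egen I i j) : z ∈ Subalgebra.center ℂ (Ugl I) := by
  rw [Subalgebra.mem_center_iff]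
  intro b
  have : b ∈ Subalgebra.centralizer ℂ {z} := by
    refine mem_of_forall_ι_mem _ (fun X => ?_) b
    rw [Subalgebra.mem_centralizer_iff]
    rintro _ rfl
    have hX : X = ∑ i : Fin I.card, ∑ j : Fin I.card,
        X (I.orderIsoOfFin rfl i) (I.orderIsoOfFin rfl j) •
          (Matrix.single (I.orderIsoOfFin rfl i) (I.orderIsoOfFin rfl j) 1 : gl I) := by
      conv_lhs => rw [Matrix.matrix_eq_sum_single X]
      rw [← (I.orderIsoOfFin rfl).toEquiv.sum_comp]
      refine Finset.sum_congr rfl fun i _ => ?_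
      rw [← (I.orderIsoOfFin rfl).toEquiv.sum_comp]
      refine Finset.sum_congr rfl fun j _ => ?_
      simp
    rw [hX]
    simp only [map_sum, map_smul, Finset.mul_sum, Finset.sum_mul, mul_smul_comm, smul_mul_assoc]
    exact Finset.sum_congr rfl fun i _ => Finset.sum_congr rfl fun j _ => by
      congr 1
      exact (h i j).symm
  rw [Subalgebra.mem_centralizer_iff] at this
  exact (this z rfl).symm

/-- The matrix `E - N` over `U(gl(I))`, `N = |I|`. -/
noncomputable def Emat (I : Finset ℕ) : Matrix (Fin I.card) (Fin I.card) (Ugl I) :=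
  Matrix.of (Egen I) - (I.card : Matrix (Fin I.card) (Fin I.card) (Ugl I))

theorem Emat_apply (I : Finset ℕ) (i j : Fin I.card) :
    Emat I i j = Egen I i j - if i = j then (I.card : Ugl I) else 0 := by
  rw [Emat, Matrix.sub_apply, Matrix.of_apply, ← Matrix.diagonal_natCast, Matrix.diagonal_apply]

theorem Egen_comm_Emat (I : Finset ℕ) (i j m n : Fin I.card) :
    Egen I i j * Emat I m n - Emat I m n * Egen I i j =
      (if j = m then Emat I i n else 0) - (if i = n then Emat I m j else 0) := by
  have h0 : Egen I i j * Emat I m n - Emat I m n * Egen I i j =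
      Egen I i j * Egen I m n - Egen I m n * Egen I i j := by
    rw [Emat_apply, mul_sub, sub_mul]
    have : Egen I i j * (if m = n then (I.card : Ugl I) else 0) =
        (if m = n then (I.card : Ugl I) else 0) * Egen I i j := by
      split_ifs
      · exact (Nat.cast_commute _ _).symm
      · simp
    rw [this]; abel
  rw [h0, Egen_comm, Emat_apply, Emat_apply]
  by_cases h1 : j = m <;> by_cases h2 : i = n
  · subst h1; subst h2; simp
  · subst h1; simp [h2]
  · subst h2; simp [h1, Ne.symm h1]
  · simp [h1, h2]

/-- Powers of E - N transform under the adjoint action like E itself: in the product of two matrices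
the delta terms at the summed index cancel, leaving those at the outer indices. Summing over the
diagonal makes the traces central. -/
theorem Egen_comm_Emat_pow (I : Finset ℕ) (k : ℕ) : ∀ i j m n : Fin I.card,
    Egen I i j * (Emat I ^ k) m n - (Emat I ^ k) m n * Egen I i j =
      (if j = m then (Emat I ^ k) i n else 0) - (if i = n then (Emat I ^ k) m j else 0) := by
  induction k with
  | zero =>
    intro i j m n
    simp only [pow_zero, Matrix.one_apply]
    by_cases h1 : j = m <;> by_cases h2 : i = n
    · subst h1; subst h2; by_cases h : i = j <;> simp [h]
    · subst h1
      by_cases h : j = n <;> simp [h, h2]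
    · subst h2
      by_cases h : i = m <;> by_cases h' : m = j <;> simp_all
    · by_cases h : m = n <;> simp [h1, h2, h]
  | succ k ih =>
    intro i j m n
    have key : ∀ p, Egen I i j * ((Emat I ^ k) m p * Emat I p n) -
        (Emat I ^ k) m p * Emat I p n * Egen I i j =
        (if j = m then (Emat I ^ k) i p * Emat I p n else 0) -
        (if i = p then (Emat I ^ k) m j * Emat I p n else 0) +
        ((if j = p then (Emat I ^ k) m p * Emat I i n else 0) -
        (if i = n then (Emat I ^ k) m p * Emat I p j else 0)) := by
      intro p
      have e1 : Egen I i j * ((Emat I ^ k) m p * Emat I p n) -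
          (Emat I ^ k) m p * Emat I p n * Egen I i j =
          (Egen I i j * (Emat I ^ k) m p - (Emat I ^ k) m p * Egen I i j) * Emat I p n +
          (Emat I ^ k) m p * (Egen I i j * Emat I p n - Emat I p n * Egen I i j) := by
        noncomm_ring
      rw [e1, ih, Egen_comm_Emat]
      simp only [sub_mul, mul_sub, ite_mul, mul_ite, zero_mul, mul_zero]
    rw [pow_succ, Matrix.mul_apply, Finset.mul_sum, Finset.sum_mul, ← Finset.sum_sub_distrib,
      Finset.sum_congr rfl fun p _ => key p]
    rw [Finset.sum_add_distrib, Finset.sum_sub_distrib, Finset.sum_sub_distrib]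
    simp only [Finset.sum_ite_eq, Finset.mem_univ, if_true]
    simp only [Matrix.mul_apply]
    by_cases h1 : j = m <;> by_cases h2 : i = n <;> simp [h1, h2] <;> abel

theorem trace_Emat_pow_mem_center (I : Finset ℕ) (k : ℕ) :
    (Emat I ^ k).trace ∈ Subalgebra.center ℂ (Ugl I) := by
  refine mem_center_of_commute_Egen fun i j => ?_
  rw [← sub_eq_zero, Matrix.trace, Finset.mul_sum, Finset.sum_mul, ← Finset.sum_sub_distrib]
  simp [Egen_comm_Emat_pow]

/-- The eigenvalues of the diagonal entries of `(E - N)^k` on a highest weight vector, where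
`a_i = lam_i - i`. -/
noncomputable def diagEig {N : ℕ} (a : Fin N → ℂ) : ℕ → Fin N → ℂ
  | 0, _ => 1
  | k + 1, i => a i * diagEig a k i - ∑ p ∈ Finset.Ioi i, diagEig a k p

/-- The contents `a_i = lam_i - i` of the ends of the rows, `i = 1, ..., N`. -/
noncomputable def rowEnd {N : ℕ} (lam : Fin N → ℤ) (i : Fin N) : ℂ :=
  (lam i : ℂ) - (((i : ℕ) : ℂ) + 1)

/-! ### Gelfand invariants on highest weight vectors -/

section Action

variable {I : Finset ℕ} {V : Type} [AddCommGroup V] [Module ℂ V] [LieRingModule (gl I) V]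
  [LieModule ℂ (gl I) V]

theorem lift_Egen (i j : Fin I.card) (v : V) :
    UniversalEnvelopingAlgebra.lift ℂ (LieModule.toEnd ℂ (gl I) V) (Egen I i j) v =
      ⁅(Matrix.single (I.orderIsoOfFin rfl i) (I.orderIsoOfFin rfl j) 1 : gl I), v⁆ := by
  rw [Egen, UniversalEnvelopingAlgebra.lift_ι_apply]
  rfl

/-- Expand the last factor E_pj of (E - N)^{k+1}. The terms p < j kill v, the term p = j is a
weight, and the terms p > j reduce to diagonal entries by a commutator. This gives the triangular
recursion `diagEig`. -/
theorem Emat_pow_highestWeight {lam : Fin I.card → ℤ} {v : V}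
    (hv : IsHighestWeightVector I lam v) (k : ℕ) :
    (∀ i j : Fin I.card, i < j →
      UniversalEnvelopingAlgebra.lift ℂ (LieModule.toEnd ℂ (gl I) V) ((Emat I ^ k) i j) v = 0) ∧
    ∀ i : Fin I.card,
      UniversalEnvelopingAlgebra.lift ℂ (LieModule.toEnd ℂ (gl I) V) ((Emat I ^ k) i i) v =
        diagEig (rowEnd lam) k i • v := by
  obtain ⟨-, hv1, hv2⟩ := hv
  set π := UniversalEnvelopingAlgebra.lift ℂ (LieModule.toEnd ℂ (gl I) V) with hπ
  have hE1 : ∀ i, π (Egen I i i) v = (lam i : ℂ) • v := fun i => by rw [hπ, lift_Egen, hv1]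
  have hE2 : ∀ i j, i < j → π (Egen I i j) v = 0 := fun i j h => by
    rw [hπ, lift_Egen, hv2 i j h]
  induction k with
  | zero =>
    refine ⟨fun i j hij => ?_, fun i => ?_⟩
    · simp [Matrix.one_apply_ne hij.ne]
    · simp [diagEig]
  | succ k ih =>
    obtain ⟨ih1, ih2⟩ := ih
    have hterm : ∀ i j p : Fin I.card, i ≤ j → π ((Emat I ^ k) i p * Emat I p j) v =
        if p = j then ((lam j : ℂ) - I.card) • π ((Emat I ^ k) i j) v
        else if j < p then (π ((Emat I ^ k) i j) v -
          if i = j then π ((Emat I ^ k) p p) v else 0) else 0 := by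
      intro i j p hij
      rcases lt_trichotomy p j with h | h | h
      · rw [if_neg h.ne, if_neg h.not_gt, Emat_apply, if_neg h.ne, sub_zero, map_mul,
          Module.End.mul_apply, hE2 _ _ h, map_zero]
      · subst h
        rw [if_pos rfl, Emat_apply, if_pos rfl, map_mul, Module.End.mul_apply, map_sub,
          LinearMap.sub_apply, hE1, map_natCast, Module.End.natCast_apply, map_sub, map_smul,
          sub_smul, ← Nat.cast_smul_eq_nsmul ℂ, map_smul]
      -- For p > j, move E_pj to the left of the entry (i, p) of the k-th power. By induction that
      -- entry kills v, as i ≤ j < p, so only the commutator survives.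
      · rw [if_neg h.ne', if_pos h, Emat_apply, if_neg h.ne', sub_zero]
        have e := Egen_comm_Emat_pow I k p j i p
        have e2 : (Emat I ^ k) i p * Egen I p j = Egen I p j * (Emat I ^ k) i p -
            ((if j = i then (Emat I ^ k) p p else 0) - (Emat I ^ k) i j) := by
          rw [if_pos rfl] at e
          rw [← e]; abel
        rw [e2, map_sub, LinearMap.sub_apply, map_mul, Module.End.mul_apply,
          ih1 i p (hij.trans_lt h), map_zero, map_sub, LinearMap.sub_apply]
        by_cases hh : i = j
        · subst hh; simp
        · simp [hh, Ne.symm hh]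
    have hsum : ∀ i j : Fin I.card, i ≤ j → π ((Emat I ^ (k + 1)) i j) v =
        ((lam j : ℂ) - I.card) • π ((Emat I ^ k) i j) v +
        ∑ p ∈ Finset.Ioi j, (π ((Emat I ^ k) i j) v -
          if i = j then π ((Emat I ^ k) p p) v else 0) := by
      intro i j hij
      rw [pow_succ, Matrix.mul_apply, map_sum, LinearMap.sum_apply,
        Finset.sum_congr rfl fun p _ => hterm i j p hij]
      rw [← Finset.add_sum_erase _ _ (Finset.mem_univ j), if_pos rfl]
      congr 1
      rw [← Finset.sum_subset (s₁ := Finset.Ioi j)]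
      · refine Finset.sum_congr rfl fun p hp => ?_
        have := Finset.mem_Ioi.1 hp
        rw [if_neg this.ne', if_pos this]
      · intro p hp
        exact Finset.mem_erase.2 ⟨(Finset.mem_Ioi.1 hp).ne', Finset.mem_univ _⟩
      · intro p hp hp'
        rw [if_neg (Finset.mem_erase.1 hp).1, if_neg fun h => hp' (Finset.mem_Ioi.2 h)]
    refine ⟨fun i j hij => ?_, fun i => ?_⟩
    · rw [hsum i j hij.le, ih1 i j hij]
      simp [hij.ne]
    · rw [hsum i i le_rfl]
      simp only [if_true, ih2]
      rw [Finset.sum_sub_distrib, Finset.sum_const, Fin.card_Ioi, ← Finset.sum_smul, diagEig,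
        ← Nat.cast_smul_eq_nsmul ℂ, smul_smul, smul_smul, ← sub_smul, ← add_smul]
      congr 1
      -- There are N - 1 - i indices above i, so the shift by -N turns the coefficient λ_i into λ_i
      -- - (i + 1), with i counted from zero.
      have : ((I.card - 1 - (i : ℕ) : ℕ) : ℂ) = (I.card : ℂ) - 1 - (i : ℕ) := by
        have := i.2
        rw [Nat.cast_sub (by omega), Nat.cast_sub (by omega), Nat.cast_one]
      rw [this, rowEnd]
      ring

/-- The eigenspace of a central element is a submodule; it contains v ≠ 0, hence is everything. -/
theorem central_smul_of_irreducible [LieModule.IsIrreducible ℂ (gl I) V] {z : Ugl I}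
    (hz : z ∈ Subalgebra.center ℂ (Ugl I)) {v : V} (hv : v ≠ 0) {c : ℂ}
    (h : UniversalEnvelopingAlgebra.lift ℂ (LieModule.toEnd ℂ (gl I) V) z v = c • v) (w : V) :
    UniversalEnvelopingAlgebra.lift ℂ (LieModule.toEnd ℂ (gl I) V) z w = c • w := by
  set π := UniversalEnvelopingAlgebra.lift ℂ (LieModule.toEnd ℂ (gl I) V) with hπ
  let K : LieSubmodule ℂ (gl I) V :=
    { carrier := {w | π z w = c • w}
      add_mem' := fun {a b} ha hb => by
        have ha' : π z a = c • a := ha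
        have hb' : π z b = c • b := hb
        change π z (a + b) = c • (a + b)
        rw [map_add, ha', hb', smul_add]
      zero_mem' := by simp
      smul_mem' := fun d a ha => by
        have ha' : π z a = c • a := ha
        change π z (d • a) = c • d • a
        rw [map_smul, ha', smul_comm]
      lie_mem := fun {X a} ha => by
        have ha' : π z a = c • a := ha
        change π z ⁅X, a⁆ = c • ⁅X, a⁆
        have h1 : ∀ b : V, ⁅X, b⁆ = π (UniversalEnvelopingAlgebra.ι ℂ X) b := fun b => by
          rw [hπ, UniversalEnvelopingAlgebra.lift_ι_apply]; rfl
        rw [h1, ← Module.End.mul_apply, ← map_mul,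
          ← Subalgebra.mem_center_iff.1 hz, map_mul, Module.End.mul_apply, ha', map_smul] }
  have hK : K = ⊤ := by
    rcases eq_bot_or_eq_top K with h0 | h0
    · exfalso
      have : v ∈ K := h
      rw [h0, LieSubmodule.mem_bot] at this
      exact hv this
    · exact h0
  have : w ∈ K := hK ▸ LieSubmodule.mem_top w
  exact this

end Action

/-- The functions on signatures that come from central elements. -/
noncomputable def centralFunctions (I : Finset ℕ) : Subalgebra ℂ ((Fin I.card → ℤ) → ℂ) where
  carrier := {f | ∃ z, CorrespondsTo I z f}
  add_mem' := by
    rintro f g ⟨z, hz, hf⟩ ⟨w, hw, hg⟩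
    refine ⟨z + w, add_mem hz hw, ?_⟩
    intro V _ _ _ _ _ _ lam hl hv v
    rw [map_add, LinearMap.add_apply, hf V lam hl hv, hg V lam hl hv, Pi.add_apply, add_smul]
  mul_mem' := by
    rintro f g ⟨z, hz, hf⟩ ⟨w, hw, hg⟩
    refine ⟨z * w, mul_mem hz hw, ?_⟩
    intro V _ _ _ _ _ _ lam hl hv v
    rw [map_mul, Module.End.mul_apply, hf V lam hl hv, hg V lam hl hv, Pi.mul_apply, mul_smul]
  algebraMap_mem' := by
    intro c
    refine ⟨algebraMap ℂ _ c, Subalgebra.algebraMap_mem _ _, ?_⟩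
    intro V _ _ _ _ _ _ lam hl hv v
    rw [AlgHom.commutes, Module.algebraMap_end_apply]
    rfl

theorem diagEig_sum_mem (I : Finset ℕ) (k : ℕ) :
    (fun lam : Fin I.card → ℤ => ∑ i, diagEig (rowEnd lam) k i) ∈ centralFunctions I := by
  refine ⟨(Emat I ^ k).trace, trace_Emat_pow_mem_center I k, ?_⟩
  intro V _ _ _ _ _ _ lam hl ⟨v, hv⟩ w
  refine central_smul_of_irreducible (trace_Emat_pow_mem_center I k) hv.1 ?_ w
  rw [Matrix.trace, map_sum, LinearMap.sum_apply, Finset.sum_smul]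
  exact Finset.sum_congr rfl fun i _ => (Emat_pow_highestWeight hv k).2 i

/-! ### The generating function of the Gelfand invariants -/

section PowerSeriesIdentity

open PowerSeries

variable {N : ℕ} (a : Fin N → ℂ)

/-- `1 - ∑_k T_k X^{k+1}`, where `T_k` is the sum over the rows `p ≥ j` of the eigenvalues. -/
noncomputable def gelfandSeries (j : ℕ) : PowerSeries ℂ :=
  1 - X * ∑ p ∈ Finset.univ.filter (fun p : Fin N => j ≤ (p : ℕ)), PowerSeries.mk fun k => diagEig a k p

/-- The coefficientwise form of the recursion that defines `diagEig`. -/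
theorem mk_diagEig (i : Fin N) :
    (PowerSeries.mk fun k => diagEig a k i) * (1 - C (a i) * X) =
      gelfandSeries a (i + 1) := by
  have hI : (Finset.Ioi i) = Finset.univ.filter fun p : Fin N => (i : ℕ) + 1 ≤ p := by
    ext p
    rw [Finset.mem_Ioi, Finset.mem_filter, Fin.lt_def]
    exact ⟨fun h => ⟨Finset.mem_univ _, h⟩, fun h => h.2⟩
  ext k
  rw [gelfandSeries, mul_sub, mul_one, ← mul_assoc, map_sub, map_sub]
  cases k with
  | zero => simp [diagEig]
  | succ k =>
    rw [coeff_succ_mul_X, coeff_succ_X_mul, coeff_mul_C, map_sum]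
    simp only [coeff_mk, diagEig, hI, coeff_one, Nat.succ_ne_zero, if_false]
    ring

/-- Splitting off row i subtracts X times the series of that row. By `mk_diagEig`, after
multiplication by 1 - a_i X this subtracts X times the next series, which shifts a_i to a_i + 1. -/
theorem gelfandSeries_step (i : Fin N) :
    gelfandSeries a i * (1 - C (a i) * X) = gelfandSeries a (i + 1) * (1 - C (a i + 1) * X) := by
  have h : gelfandSeries a i = gelfandSeries a (i + 1) - X * PowerSeries.mk fun k => diagEig a k i := by
    have : (Finset.univ.filter fun p : Fin N => (i : ℕ) ≤ p) =
        insert i (Finset.univ.filter fun p : Fin N => (i : ℕ) + 1 ≤ p) := by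
      ext p
      simp only [Finset.mem_filter, Finset.mem_univ, true_and, Finset.mem_insert, Fin.ext_iff]
      omega
    rw [gelfandSeries, gelfandSeries, this, Finset.sum_insert (by simp)]
    ring
  rw [h, sub_mul, mul_assoc, mk_diagEig, map_add, map_one]
  ring

/-- Telescoping of `gelfandSeries_step` over the rows; this is the Perelomov–Popov formula with the
denominators cleared. -/
theorem gelfandSeries_mul_prod :
    gelfandSeries a 0 * ∏ i, (1 - C (a i) * X) = ∏ i, (1 - C (a i + 1) * X) := by
  have h : ∀ m, m ≤ N → gelfandSeries a 0 * ∏ i ∈ Finset.univ.filter (fun i : Fin N => (i : ℕ) < m), (1 - C (a i) * X) =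
      gelfandSeries a m * ∏ i ∈ Finset.univ.filter (fun i : Fin N => (i : ℕ) < m), (1 - C (a i + 1) * X) := by
    intro m
    induction m with
    | zero => intro _; simp
    | succ m ih =>
      intro hm
      have : (Finset.univ.filter fun p : Fin N => (p : ℕ) < m + 1) =
          insert ⟨m, hm⟩ (Finset.univ.filter fun p : Fin N => (p : ℕ) < m) := by
        ext p
        simp only [Finset.mem_filter, Finset.mem_univ, true_and, Finset.mem_insert, Fin.ext_iff]
        omega
      rw [this, Finset.prod_insert (by simp), Finset.prod_insert (by simp)]
      have e := gelfandSeries_step a ⟨m, hm⟩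
      simp only at e
      calc _ = (gelfandSeries a 0 * ∏ i ∈ Finset.univ.filter (fun i : Fin N => (i : ℕ) < m), (1 - C (a i) * X)) *
            (1 - C (a ⟨m, hm⟩) * X) := by ring
        _ = (gelfandSeries a m * (1 - C (a ⟨m, hm⟩) * X)) *
            ∏ i ∈ Finset.univ.filter (fun i : Fin N => (i : ℕ) < m), (1 - C (a i + 1) * X) := by rw [ih (by omega)]; ring
        _ = _ := by rw [e]; ring
  have h1 := h N le_rfl
  have h2 : (Finset.univ.filter fun p : Fin N => (p : ℕ) < N) = Finset.univ := by
    ext p; simp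
  have h3 : gelfandSeries a N = 1 := by
    have : (Finset.univ.filter fun p : Fin N => N ≤ (p : ℕ)) = ∅ := by
      ext p; simp
    rw [gelfandSeries, this]; simp
  rwa [h2, h3, one_mul] at h1

theorem one_sub_mul_geom (c : ℂ) : (1 - C c * X) * (PowerSeries.mk fun k => c ^ k) = 1 := by
  ext k
  rw [sub_mul, one_mul, mul_comm (C c) X, mul_assoc, map_sub]
  cases k with
  | zero => simp
  | succ k =>
    rw [coeff_succ_X_mul, coeff_C_mul]
    simp [pow_succ, mul_comm, coeff_one]

theorem X_mul_deriv_prod (b : Fin N → ℂ) (s : Finset (Fin N)) :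
    X * derivative ℂ (∏ i ∈ s, (1 - C (b i) * X)) =
      (∏ i ∈ s, (1 - C (b i) * X)) * ∑ i ∈ s, (1 - PowerSeries.mk fun k => b i ^ k) := by
  induction s using Finset.induction_on with
  | empty => simp
  | insert i s hi ih =>
    rw [Finset.prod_insert hi, Finset.sum_insert hi, Derivation.leibniz, smul_eq_mul, smul_eq_mul,
      mul_add, mul_left_comm, ih]
    have h1 : X * derivative ℂ (1 - C (b i) * X) = (1 - C (b i) * X) *
        (1 - PowerSeries.mk fun k => b i ^ k) := by
      rw [mul_sub, one_sub_mul_geom, mul_one]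
      have : derivative ℂ (1 - C (b i) * X) = - C (b i) := by
        rw [map_sub, Derivation.leibniz]
        simp [derivative_C]
      rw [this]; ring
    calc _ = (1 - C (b i) * X) * ((∏ i ∈ s, (1 - C (b i) * X)) *
          ∑ i ∈ s, (1 - PowerSeries.mk fun k => b i ^ k)) + (∏ i ∈ s, (1 - C (b i) * X)) *
          (X * derivative ℂ (1 - C (b i) * X)) := by ring
      _ = _ := by rw [h1]; ring

/-- The logarithmic derivative of the product formula: each factor 1 - bX contributes one minus a
geometric series, so power sums of a_i and a_i + 1 appear. The product of the denominators can be
cancelled because its constant term is 1. -/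
theorem X_mul_deriv_gelfandSeries :
    X * derivative ℂ (gelfandSeries a 0) = gelfandSeries a 0 *
      (∑ i, (PowerSeries.mk fun k => a i ^ k) - ∑ i, PowerSeries.mk fun k => (a i + 1) ^ k) := by
  have h1 := X_mul_deriv_prod a Finset.univ
  have h2 := X_mul_deriv_prod (fun i => a i + 1) Finset.univ
  have h3 := gelfandSeries_mul_prod a
  rw [← h3, Derivation.leibniz, smul_eq_mul, smul_eq_mul] at h2
  have hne : (∏ i, (1 - C (a i) * X) : PowerSeries ℂ) ≠ 0 := by
    rw [Finset.prod_ne_zero_iff]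
    intro i _ h
    have := congrArg (coeff (R := ℂ) 0) h
    simp at this
  apply mul_left_cancel₀ hne
  rw [Finset.sum_sub_distrib] at h1 h2
  calc _ = X * (gelfandSeries a 0 * derivative ℂ (∏ i, (1 - C (a i) * X)) +
        (∏ i, (1 - C (a i) * X)) * derivative ℂ (gelfandSeries a 0)) -
        gelfandSeries a 0 * (X * derivative ℂ (∏ i, (1 - C (a i) * X))) := by ring
    _ = _ := by rw [h2, h1]; ring

theorem coeff_gelfandSeries_succ (n : ℕ) :
    coeff (n + 1) (gelfandSeries a 0) = - ∑ i, diagEig a n i := by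
  rw [gelfandSeries, map_sub, coeff_succ_X_mul, map_sum]
  simp [coeff_one]

theorem coeff_gelfandSeries_zero : coeff 0 (gelfandSeries a 0) = 1 := by
  simp [gelfandSeries]

/-- The differences of power sums in terms of the `T_k`. -/
theorem power_sum_diff (n : ℕ) :
    ∑ i, ((a i + 1) ^ n - a i ^ n) =
      - (n * coeff n (gelfandSeries a 0)) - ∑ k ∈ Finset.range n,
        coeff (n - k) (gelfandSeries a 0) * ∑ i, ((a i + 1) ^ k - a i ^ k) := by
  have h := congrArg (coeff n) (X_mul_deriv_gelfandSeries a)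
  have hl : coeff n (X * derivative ℂ (gelfandSeries a 0)) = n * coeff n (gelfandSeries a 0) := by
    cases n with
    | zero => simp
    | succ n =>
      rw [coeff_succ_X_mul, coeff_derivative]
      push_cast; ring
  rw [hl, mul_comm (gelfandSeries a 0), coeff_mul,
    Finset.Nat.sum_antidiagonal_eq_sum_range_succ_mk, Finset.sum_range_succ, Nat.sub_self,
    coeff_gelfandSeries_zero] at h
  have h2 : ∑ k ∈ Finset.range n,
      coeff (n - k) (gelfandSeries a 0) * ∑ i, ((a i + 1) ^ k - a i ^ k) =
      - ∑ k ∈ Finset.range n, (∑ i, a i ^ k - ∑ i, (a i + 1) ^ k) *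
        coeff (n - k) (gelfandSeries a 0) := by
    rw [← Finset.sum_neg_distrib]
    exact Finset.sum_congr rfl fun k _ => by rw [Finset.sum_sub_distrib]; ring
  simp only [map_sub, map_sum, coeff_mk] at h
  rw [h, h2, Finset.sum_sub_distrib]
  ring

end PowerSeriesIdentity

/-! ### Power sums come from central elements -/

theorem coeff_gelfandSeries_mem (I : Finset ℕ) (n : ℕ) :
    (fun lam : Fin I.card → ℤ => PowerSeries.coeff n (gelfandSeries (rowEnd lam) 0)) ∈
      centralFunctions I := by
  cases n with
  | zero =>
    simp only [coeff_gelfandSeries_zero]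
    exact one_mem _
  | succ n =>
    simp only [coeff_gelfandSeries_succ]
    exact neg_mem (diagEig_sum_mem I n)

/-- Newton-type recursion: `power_sum_diff` writes the n-th difference through series coefficients
and lower differences, and central functions form an algebra. -/
theorem power_sum_diff_mem (I : Finset ℕ) (n : ℕ) :
    (fun lam : Fin I.card → ℤ => ∑ i, ((rowEnd lam i + 1) ^ n - rowEnd lam i ^ n)) ∈
      centralFunctions I := by
  induction n using Nat.strong_induction_on with
  | _ n ih =>
    have h : (fun lam : Fin I.card → ℤ => ∑ i, ((rowEnd lam i + 1) ^ n - rowEnd lam i ^ n)) =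
        -((n : ℂ) • fun lam : Fin I.card → ℤ =>
          PowerSeries.coeff n (gelfandSeries (rowEnd lam) 0)) -
        ∑ k ∈ Finset.range n, (fun lam : Fin I.card → ℤ =>
          PowerSeries.coeff (n - k) (gelfandSeries (rowEnd lam) 0)) *
          fun lam => ∑ i, ((rowEnd lam i + 1) ^ k - rowEnd lam i ^ k) := by
      ext lam
      rw [power_sum_diff]
      simp
    rw [h]
    refine sub_mem (neg_mem (Subalgebra.smul_mem _ (coeff_gelfandSeries_mem I n) _))
      (sum_mem fun k hk => mul_mem (coeff_gelfandSeries_mem I _) (ih k (Finset.mem_range.1 hk)))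

/-- The (n + 1)-st difference (a + 1)^{n+1} - a^{n+1} is (n + 1)a^n plus lower powers, so the power
sums are obtained from the differences by triangular inversion. -/
theorem power_sum_mem (I : Finset ℕ) (n : ℕ) :
    (fun lam : Fin I.card → ℤ => ∑ i, rowEnd lam i ^ n) ∈ centralFunctions I := by
  induction n using Nat.strong_induction_on with
  | _ n ih =>
    have h : (fun lam : Fin I.card → ℤ => ∑ i, rowEnd lam i ^ n) = ((n : ℂ) + 1)⁻¹ •
        ((fun lam : Fin I.card → ℤ => ∑ i, ((rowEnd lam i + 1) ^ (n + 1) - rowEnd lam i ^ (n + 1))) -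
          ∑ k ∈ Finset.range n, ((n + 1).choose k : ℂ) •
            fun lam : Fin I.card → ℤ => ∑ i, rowEnd lam i ^ k) := by
      ext lam
      have hb : ∀ i, (rowEnd lam i + 1) ^ (n + 1) - rowEnd lam i ^ (n + 1) =
          ∑ k ∈ Finset.range n, ((n + 1).choose k : ℂ) * rowEnd lam i ^ k +
            ((n : ℂ) + 1) * rowEnd lam i ^ n := by
        intro i
        rw [add_pow, Finset.sum_range_succ, Finset.sum_range_succ]
        simp only [one_pow, mul_one, Nat.choose_self, Nat.cast_one, Nat.choose_succ_self_right,
          Nat.cast_add, add_sub_cancel_right]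
        rw [mul_comm (rowEnd lam i ^ n)]
        congr 1
        exact Finset.sum_congr rfl fun k _ => mul_comm _ _
      have hn : (n : ℂ) + 1 ≠ 0 := Nat.cast_add_one_ne_zero n
      simp only [Pi.smul_apply, Pi.sub_apply, Finset.sum_apply, hb, smul_eq_mul]
      rw [Finset.sum_add_distrib, Finset.sum_comm, ← Finset.mul_sum]
      simp only [← Finset.mul_sum]
      field_simp
      ring
    rw [h]
    refine Subalgebra.smul_mem _ (sub_mem (power_sum_diff_mem I _) (sum_mem fun k hk =>
      Subalgebra.smul_mem _ (ih k (Finset.mem_range.1 hk)) _)) _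

theorem shiftedPowerSum_mem (I : Finset ℕ) (k : ℕ) :
    shiftedPowerSum I.card k ∈ centralFunctions I := by
  have h : shiftedPowerSum I.card k =
      ∑ j ∈ Finset.range (k + 1), (((1 : ℂ) / 2) ^ (k - j) * (k.choose j : ℂ)) •
        (fun lam : Fin I.card → ℤ => ∑ i, rowEnd lam i ^ j) -
      algebraMap ℂ _ (∑ i : Fin I.card, (-(((i : ℕ) : ℂ) + 1) + 1 / 2) ^ k) := by
    ext lam
    simp only [shiftedPowerSum, Pi.sub_apply, Finset.sum_apply, Pi.smul_apply,
      Pi.algebraMap_apply, Algebra.algebraMap_self, RingHom.id_apply, smul_eq_mul]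
    rw [Finset.sum_sub_distrib]
    congr 1
    simp only [Finset.mul_sum]
    rw [Finset.sum_comm]
    refine Finset.sum_congr rfl fun i _ => ?_
    have : (lam i : ℂ) - ((i : ℕ) + 1) + 1 / 2 = rowEnd lam i + 1 / 2 := rfl
    rw [this, add_pow]
    exact Finset.sum_congr rfl fun j _ => by ring
  rw [h]
  exact sub_mem (sum_mem fun j _ => Subalgebra.smul_mem _ (power_sum_mem I j) _)
    (Subalgebra.algebraMap_mem _ _)

theorem pElt_correspondsTo (k : ℕ) (I : Finset ℕ) :
    CorrespondsTo I (pElt k I) (shiftedPowerSum I.card k) := by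
  have h : ∃ z : Ugl I, CorrespondsTo I z (shiftedPowerSum I.card k) := shiftedPowerSum_mem I k
  rw [pElt, dif_pos h]
  exact h.choose_spec

/-! ### Unitary representations of `gl(I)` -/

/-- The matrix unit `E_ij`, indexed by the positions in `I`. -/
abbrev glE (I : Finset ℕ) (i j : Fin I.card) : gl I :=
  Matrix.single (I.orderIsoOfFin rfl i) (I.orderIsoOfFin rfl j) 1

theorem glE_conjTranspose (I : Finset ℕ) (i j : Fin I.card) :
    (glE I i j).conjTranspose = glE I j i := by
  simp [glE]

theorem glE_lie (I : Finset ℕ) (i j m n : Fin I.card) :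
    ⁅glE I i j, glE I m n⁆ = (if j = m then glE I i n else 0) - (if i = n then glE I m j else 0) := by
  rw [Ring.lie_def]
  congr 1
  · by_cases h : j = m
    · subst h; simp [glE]
    · rw [if_neg h, Matrix.single_mul_single_of_ne]
      simpa using h
  · by_cases h : i = n
    · subst h; simp [glE]
    · rw [if_neg h, Matrix.single_mul_single_of_ne]
      simpa using fun e => h e.symm

/-- An inner product on a `gl(I)`-module is invariant under the compact form, and the diagonal
matrix units have integer eigenvalues. -/
structure IsUnitaryRep (I : Finset ℕ) (V : Type) [NormedAddCommGroup V] [InnerProductSpace ℂ V]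
    [LieRingModule (gl I) V] : Prop where
  inner_lie : ∀ (X : gl I) (v w : V), inner ℂ ⁅X, v⁆ w = inner ℂ v ⁅X.conjTranspose, w⁆
  integral : ∀ (i : Fin I.card) (v : V) (μ : ℂ), v ≠ 0 → ⁅glE I i i, v⁆ = μ • v → ∃ n : ℤ, μ = n

section Unitary

variable {I : Finset ℕ} {V : Type} [NormedAddCommGroup V] [InnerProductSpace ℂ V]
  [LieRingModule (gl I) V] [LieModule ℂ (gl I) V]

/-- The orthogonal complement of a submodule of a unitary module. -/
noncomputable def orthLie (hV : IsUnitaryRep I V) (W : LieSubmodule ℂ (gl I) V) :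
    LieSubmodule ℂ (gl I) V :=
  { W.toSubmoduleᗮ with
    lie_mem := fun {X v} hv => by
      have hv' : v ∈ W.toSubmoduleᗮ := hv
      change ⁅X, v⁆ ∈ W.toSubmoduleᗮ
      rw [Submodule.mem_orthogonal] at hv' ⊢
      intro u hu
      rw [← Matrix.conjTranspose_conjTranspose X, ← hV.inner_lie]
      exact hv' _ (W.lie_mem hu) }

theorem mem_orthLie {hV : IsUnitaryRep I V} {W : LieSubmodule ℂ (gl I) V} {v : V} :
    v ∈ orthLie hV W ↔ ∀ u ∈ W, inner ℂ u v = 0 :=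
  Submodule.mem_orthogonal _ _

theorem eq_zero_of_mem_orthLie {hV : IsUnitaryRep I V} {W : LieSubmodule ℂ (gl I) V} {v : V}
    (h1 : v ∈ W) (h2 : v ∈ orthLie hV W) : v = 0 :=
  inner_self_eq_zero.1 (mem_orthLie.1 h2 v h1)

variable [FiniteDimensional ℂ V]

theorem exists_orthLie_decomp (hV : IsUnitaryRep I V) (W : LieSubmodule ℂ (gl I) V) (v : V) :
    ∃ v₁ ∈ W, ∃ v₂ ∈ orthLie hV W, v = v₁ + v₂ :=
  Submodule.exists_add_mem_mem_orthogonal (K := W.toSubmodule) v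

theorem exists_orthLie_decomp_of_le (hV : IsUnitaryRep I V) {W' W : LieSubmodule ℂ (gl I) V}
    (h : W' ≤ W) {v : V} (hv : v ∈ W) :
    ∃ v₁ ∈ W', ∃ v₂ ∈ W ⊓ orthLie hV W', v = v₁ + v₂ := by
  obtain ⟨v₁, h1, v₂, h2, e⟩ := exists_orthLie_decomp hV W' v
  refine ⟨v₁, h1, v₂, ⟨?_, h2⟩, e⟩
  have : v₂ = v - v₁ := by rw [e]; abel
  rw [this]
  exact W.sub_mem hv (h h1)

theorem orthLie_inf_ne_bot (hV : IsUnitaryRep I V) {W' W : LieSubmodule ℂ (gl I) V}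
    (h : W' < W) : W ⊓ orthLie hV W' ≠ ⊥ := by
  intro hb
  refine h.not_ge fun v hv => ?_
  obtain ⟨v₁, h1, v₂, h2, e⟩ := exists_orthLie_decomp_of_le hV h.le hv
  rw [hb, LieSubmodule.mem_bot] at h2
  rw [e, h2, add_zero]
  exact h1

/-- For i < j, unitarity and the commutator [E_ij, E_ji] give ‖E_ji v‖² = (λ_i - λ_j)‖v‖², which
cannot be negative. -/
theorem antitone_of_highestWeight (hV : IsUnitaryRep I V) {lam : Fin I.card → ℤ} {v : V}
    (hv : IsHighestWeightVector I lam v) : Antitone lam := by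
  intro i j hij
  rcases hij.eq_or_lt with rfl | hij
  · exact le_rfl
  obtain ⟨h0, h1, h2⟩ := hv
  have e : ⁅glE I i j, ⁅glE I j i, v⁆⁆ = ((lam i : ℂ) - lam j) • v := by
    rw [leibniz_lie, glE_lie, if_pos rfl, if_pos rfl, h2 i j hij, lie_zero, add_zero, sub_lie, h1,
      h1, sub_smul]
  have h3 : inner ℂ ⁅glE I j i, v⁆ ⁅glE I j i, v⁆ = ((lam i : ℂ) - lam j) * inner ℂ v v := by
    rw [hV.inner_lie, glE_conjTranspose, e, inner_smul_right]
  rw [inner_self_eq_norm_sq_to_K, inner_self_eq_norm_sq_to_K] at h3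
  have h4 : ‖⁅glE I j i, v⁆‖ ^ 2 = ((lam i : ℝ) - lam j) * ‖v‖ ^ 2 := by
    apply Complex.ofReal_injective
    push_cast
    exact h3
  have h5 : 0 < ‖v‖ ^ 2 := by have := norm_pos_iff.2 h0; positivity
  have h6 : 0 ≤ ((lam i : ℝ) - lam j) := by
    by_contra h
    push Not at h
    have := mul_neg_of_neg_of_pos h h5
    have : 0 ≤ ‖⁅glE I j i, v⁆‖ ^ 2 := by positivity
    linarith
  exact_mod_cast sub_nonneg.1 h6

/-- The diagonal matrix units act by commuting symmetric operators on W, so W is spanned by joint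
eigenvectors. -/
theorem exists_weightVector (hV : IsUnitaryRep I V) {W : LieSubmodule ℂ (gl I) V} (hW : W ≠ ⊥) :
    ∃ v ∈ W, v ≠ 0 ∧ ∃ α : Fin I.card → ℂ, ∀ i, ⁅glE I i i, v⁆ = α i • v := by
  let T : Fin I.card → W.toSubmodule →ₗ[ℂ] W.toSubmodule := fun i =>
    { toFun := fun v => ⟨⁅glE I i i, (v : V)⁆, W.lie_mem v.2⟩
      map_add' := fun v w => Subtype.ext (lie_add _ _ _)
      map_smul' := fun c v => Subtype.ext (lie_smul _ _ _) }
  have hT : ∀ i, (T i).IsSymmetric := fun i v w => by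
    change inner ℂ ⁅glE I i i, (v : V)⁆ (w : V) = inner ℂ (v : V) ⁅glE I i i, (w : V)⁆
    rw [hV.inner_lie, glE_conjTranspose]
  have hc : Pairwise (Function.onFun Commute T) := fun i j hij => by
    refine LinearMap.ext fun v => Subtype.ext ?_
    change ⁅glE I i i, ⁅glE I j j, (v : V)⁆⁆ = ⁅glE I j j, ⁅glE I i i, (v : V)⁆⁆
    rw [leibniz_lie, glE_lie, if_neg hij, if_neg hij]
    simp
  have htop := LinearMap.IsSymmetric.iSup_iInf_eq_top_of_commute hT hc
  by_contra hcon
  push Not at hcon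
  apply hW
  have hbot : ∀ α : Fin I.card → ℂ, (⨅ j, Module.End.eigenspace (T j) (α j)) = ⊥ := by
    intro α
    rw [Submodule.eq_bot_iff]
    intro v hv
    by_contra hv0
    obtain ⟨i, hi⟩ := hcon v v.2 (fun h => hv0 (Subtype.ext h)) α
    rw [Submodule.mem_iInf] at hv
    exact hi (congrArg Subtype.val (Module.End.mem_eigenspace_iff.1 (hv i)))
  simp only [hbot, iSup_bot] at htop
  rw [LieSubmodule.eq_bot_iff]
  intro v hv
  have : (⟨v, hv⟩ : W.toSubmodule) ∈ (⊥ : Submodule ℂ W.toSubmodule) := htop ▸ Submodule.mem_top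
  exact congrArg Subtype.val ((Submodule.mem_bot ℂ).1 this)

/-- Choose a weight with maximal height -Σ i α_i. Heights are eigenvalues of a single operator H, so
there are finitely many. For i < j, E_ij raises the height by j - i > 0, so it must annihilate the
chosen vector. -/
theorem exists_highestWeight (hV : IsUnitaryRep I V) {W : LieSubmodule ℂ (gl I) V} (hW : W ≠ ⊥) :
    ∃ v ∈ W, ∃ lam : Fin I.card → ℤ, IsHighestWeightVector I lam v := by
  let P : Set (Fin I.card → ℂ) := {α | ∃ v ∈ W, v ≠ 0 ∧ ∀ i, ⁅glE I i i, v⁆ = α i • v}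
  let ht : (Fin I.card → ℂ) → ℂ := fun α => ∑ i : Fin I.card, -((i : ℕ) : ℂ) * α i
  let H : gl I := ∑ i : Fin I.card, -((i : ℕ) : ℂ) • glE I i i
  have hH : ∀ α ∈ P, Module.End.HasEigenvalue (LieModule.toEnd ℂ (gl I) V H) (ht α) := by
    rintro α ⟨v, -, hv0, hv⟩
    refine Module.End.hasEigenvalue_of_hasEigenvector (x := v)
      ⟨Module.End.mem_eigenspace_iff.2 ?_, hv0⟩
    rw [LieModule.toEnd_apply_apply, sum_lie, Finset.sum_smul]
    exact Finset.sum_congr rfl fun i _ => by rw [smul_lie, hv, smul_smul]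
  have hfin : (ht '' P).Finite := by
    refine (Module.End.finite_hasEigenvalue (LieModule.toEnd ℂ (gl I) V H)).subset ?_
    rintro _ ⟨α, hα, rfl⟩
    exact hH α hα
  have hne : (ht '' P).Nonempty := by
    obtain ⟨v, hv, hv0, α, h⟩ := exists_weightVector hV hW
    exact ⟨_, α, ⟨v, hv, hv0, h⟩, rfl⟩
  obtain ⟨_, ⟨α, ⟨v, hvW, hv0, hv⟩, rfl⟩, hmax⟩ := Set.exists_max_image _ Complex.re hfin hne
  choose lam hlam using fun i => hV.integral i v (α i) hv0 (hv i)
  refine ⟨v, hvW, lam, hv0, fun i => by rw [hv, hlam], fun i j hij => ?_⟩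
  by_contra hne
  have hw : ∀ p, ⁅glE I p p, ⁅glE I i j, v⁆⁆ =
      (α p + ((if p = i then 1 else 0) - (if p = j then 1 else 0))) • ⁅glE I i j, v⁆ := by
    intro p
    rw [leibniz_lie, glE_lie, hv, lie_smul, add_smul, add_comm (α p • _), sub_lie, sub_smul]
    congr 2
    · split_ifs with h
      · subst h; simp
      · simp
    · split_ifs with h
      · subst h; simp
      · simp
  have h1 := hmax _ ⟨_, ⟨⁅glE I i j, v⁆, W.lie_mem hvW, hne, hw⟩, rfl⟩
  have h2 : ht (fun p => α p + ((if p = i then 1 else 0) - (if p = j then 1 else 0))) =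
      ht α + (((j : ℕ) : ℂ) - ((i : ℕ) : ℂ)) := by
    simp only [ht, mul_add, mul_sub, Finset.sum_add_distrib, Finset.sum_sub_distrib]
    simp
    ring
  rw [h2, Complex.add_re, Complex.sub_re, Complex.natCast_re, Complex.natCast_re] at h1
  have h3 : ((i : ℕ) : ℝ) < ((j : ℕ) : ℝ) := by exact_mod_cast hij
  linarith

end Unitary

theorem gl_eq_sum_glE {I : Finset ℕ} (X : gl I) :
    X = ∑ i : Fin I.card, ∑ j : Fin I.card,
      X (I.orderIsoOfFin rfl i) (I.orderIsoOfFin rfl j) • glE I i j := by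
  conv_lhs => rw [Matrix.matrix_eq_sum_single X]
  rw [← (I.orderIsoOfFin rfl).toEquiv.sum_comp]
  refine Finset.sum_congr rfl fun i _ => ?_
  rw [← (I.orderIsoOfFin rfl).toEquiv.sum_comp]
  refine Finset.sum_congr rfl fun j _ => ?_
  simp

section Equivariance

variable {L : Type*} [LieRing L] [LieAlgebra ℂ L]

/-- Equivariant maps intertwine the actions of the enveloping algebra. -/
theorem lift_equivariant {M M' : Type*} [AddCommGroup M] [Module ℂ M] [AddCommGroup M']
    [Module ℂ M'] {ρ : L →ₗ⁅ℂ⁆ Module.End ℂ M} {ρ' : L →ₗ⁅ℂ⁆ Module.End ℂ M'} (φ : M →ₗ[ℂ] M')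
    (h : ∀ X v, φ (ρ X v) = ρ' X (φ v)) (z : UniversalEnvelopingAlgebra ℂ L) (v : M) :
    φ (UniversalEnvelopingAlgebra.lift ℂ ρ z v) =
      UniversalEnvelopingAlgebra.lift ℂ ρ' z (φ v) := by
  let S : Subalgebra ℂ (UniversalEnvelopingAlgebra ℂ L) :=
    { carrier := {z | ∀ v, φ (UniversalEnvelopingAlgebra.lift ℂ ρ z v) =
        UniversalEnvelopingAlgebra.lift ℂ ρ' z (φ v)}
      mul_mem' := by
        intro a b ha hb v
        rw [map_mul, Module.End.mul_apply, ha, hb, map_mul, Module.End.mul_apply]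
      add_mem' := by
        intro a b ha hb v
        rw [map_add, LinearMap.add_apply, map_add, ha, hb, map_add, LinearMap.add_apply]
      algebraMap_mem' := by
        intro c v
        rw [AlgHom.commutes, AlgHom.commutes, Module.algebraMap_end_apply,
          Module.algebraMap_end_apply, map_smul] }
  refine mem_of_forall_ι_mem S (fun X v => ?_) z v
  rw [UniversalEnvelopingAlgebra.lift_ι_apply, UniversalEnvelopingAlgebra.lift_ι_apply, h]

variable {M : Type*} [AddCommGroup M] [Module ℂ M] [LieRingModule L M] [LieModule ℂ L M]

/-- The kernel of an equivariant map. -/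
def kerLie (Φ : M →ₗ[ℂ] M) (h : ∀ (X : L) v, Φ ⁅X, v⁆ = ⁅X, Φ v⁆) : LieSubmodule ℂ L M :=
  { LinearMap.ker Φ with
    lie_mem := fun {X v} hv => by
      have hv' : Φ v = 0 := hv
      change Φ ⁅X, v⁆ = 0
      rw [h, hv', lie_zero] }

theorem lie_lift_comm {z : UniversalEnvelopingAlgebra ℂ L}
    (hz : z ∈ Subalgebra.center ℂ (UniversalEnvelopingAlgebra ℂ L)) (X : L) (v : M) :
    UniversalEnvelopingAlgebra.lift ℂ (LieModule.toEnd ℂ L M) z ⁅X, v⁆ =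
      ⁅X, UniversalEnvelopingAlgebra.lift ℂ (LieModule.toEnd ℂ L M) z v⁆ := by
  have h1 : ∀ b : M, ⁅X, b⁆ = UniversalEnvelopingAlgebra.lift ℂ (LieModule.toEnd ℂ L M)
      (UniversalEnvelopingAlgebra.ι ℂ X) b := fun b => by
    rw [UniversalEnvelopingAlgebra.lift_ι_apply]; rfl
  rw [h1, h1, ← Module.End.mul_apply, ← map_mul, ← Subalgebra.mem_center_iff.1 hz, map_mul,
    Module.End.mul_apply]

end Equivariance

/-! ### Central elements on highest weight vectors of unitary modules -/

section Unitary

variable {I : Finset ℕ} {V : Type} [NormedAddCommGroup V] [InnerProductSpace ℂ V]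
  [LieRingModule (gl I) V] [LieModule ℂ (gl I) V] [FiniteDimensional ℂ V]

/-- On a minimal submodule of a unitary module, a central element acts by the scalar of its highest
weight. -/
theorem act_of_minimal (hV : IsUnitaryRep I V) {z : Ugl I} {f : (Fin I.card → ℤ) → ℂ}
    (hz : CorrespondsTo I z f) {W : LieSubmodule ℂ (gl I) V}
    (hW : ∀ W' ≤ W, W' ≠ ⊥ → W' = W) {lam : Fin I.card → ℤ} {v : V} (hvW : v ∈ W)
    (hv : IsHighestWeightVector I lam v) {w : V} (hw : w ∈ W) :
    UniversalEnvelopingAlgebra.lift ℂ (LieModule.toEnd ℂ (gl I) V) z w = f lam • w := by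
  have : Nontrivial W := ⟨⟨⟨v, hvW⟩, 0, fun h => hv.1 (congrArg Subtype.val h)⟩⟩
  have : LieModule.IsIrreducible ℂ (gl I) W := by
    refine LieModule.IsIrreducible.mk fun N hN => ?_
    have h1 : N.map W.incl ≤ W := by
      intro x hx
      obtain ⟨y, -, rfl⟩ := (LieSubmodule.mem_map x).1 hx
      exact y.2
    have h2 : N.map W.incl ≠ ⊥ := by
      intro hb
      apply hN
      rw [LieSubmodule.eq_bot_iff] at hb ⊢
      intro x hx
      exact Subtype.ext (hb _ (LieSubmodule.mem_map_of_mem hx))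
    have h3 := hW _ h1 h2
    rw [eq_top_iff]
    intro x _
    have : (x : V) ∈ N.map W.incl := (SetLike.ext_iff.1 h3 _).2 x.2
    obtain ⟨y, hy, hxy⟩ := (LieSubmodule.mem_map _).1 this
    have : y = x := Subtype.ext hxy
    exact this ▸ hy
  have hv' : IsHighestWeightVector I lam (⟨v, hvW⟩ : W) :=
    ⟨fun h => hv.1 (congrArg Subtype.val h), fun i => Subtype.ext (hv.2.1 i),
      fun i j hij => Subtype.ext (hv.2.2 i j hij)⟩
  have h1 := hz.2 W lam (antitone_of_highestWeight hV hv) ⟨_, hv'⟩ ⟨w, hw⟩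
  have h2 := lift_equivariant (ρ := LieModule.toEnd ℂ (gl I) W)
    (ρ' := LieModule.toEnd ℂ (gl I) V) W.toSubmodule.subtype (fun X v => rfl) z ⟨w, hw⟩
  rw [h1] at h2
  exact h2.symm

/-- The scalars of `CorrespondsTo` are prescribed on irreducible modules only. Induction on
dimension: a submodule W that is not minimal splits orthogonally, and the components of v are zero
or again highest weight vectors of the same weight. -/
theorem act_highestWeight_of_mem (hV : IsUnitaryRep I V) {z : Ugl I}
    {f : (Fin I.card → ℤ) → ℂ} (hz : CorrespondsTo I z f) {lam : Fin I.card → ℤ} (n : ℕ) :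
    ∀ W : LieSubmodule ℂ (gl I) V, Module.finrank ℂ W.toSubmodule ≤ n → ∀ v ∈ W,
      IsHighestWeightVector I lam v →
      UniversalEnvelopingAlgebra.lift ℂ (LieModule.toEnd ℂ (gl I) V) z v = f lam • v := by
  induction n with
  | zero =>
    intro W hW v hv hvv
    have : W.toSubmodule = ⊥ := Submodule.finrank_eq_zero.1 (Nat.le_zero.1 hW)
    have : v ∈ W.toSubmodule := hv
    simp_all [hvv.1]
  | succ n ih =>
    intro W hn v hvW hv
    by_cases hW : ∀ W' ≤ W, W' ≠ ⊥ → W' = W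
    · exact act_of_minimal hV hz hW hvW hv hvW
    push Not at hW
    obtain ⟨W', hle, hne, hne'⟩ := hW
    have hlt : W' < W := lt_of_le_of_ne hle hne'
    have hlt2 : W ⊓ orthLie hV W' < W := by
      refine lt_of_le_of_ne inf_le_left fun h => hne ?_
      rw [LieSubmodule.eq_bot_iff]
      intro x hx
      have : x ∈ W ⊓ orthLie hV W' := (SetLike.ext_iff.1 h x).2 (hle hx)
      exact eq_zero_of_mem_orthLie hx this.2
    obtain ⟨v₁, h1, v₂, h2, e⟩ := exists_orthLie_decomp_of_le hV hle hvW
    have key : ∀ (X : gl I) (c : ℂ), ⁅X, v⁆ = c • v → ⁅X, v₁⁆ = c • v₁ ∧ ⁅X, v₂⁆ = c • v₂ := by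
      intro X c hX
      rw [e, lie_add, smul_add] at hX
      have e1 : ⁅X, v₁⁆ - c • v₁ = c • v₂ - ⁅X, v₂⁆ := by
        rw [sub_eq_sub_iff_add_eq_add, hX]; abel
      -- By the identity just proved the defect lies both in W' and in its orthogonal complement, so
      -- it vanishes.
      have m1 : ⁅X, v₁⁆ - c • v₁ ∈ W' := sub_mem (W'.lie_mem h1) (W'.smul_mem _ h1)
      have m2 : ⁅X, v₁⁆ - c • v₁ ∈ orthLie hV W' := by
        rw [e1]
        exact sub_mem ((orthLie hV W').smul_mem _ h2.2) ((orthLie hV W').lie_mem h2.2)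
      have e2 := eq_zero_of_mem_orthLie m1 m2
      refine ⟨sub_eq_zero.1 e2, ?_⟩
      rw [e2] at e1
      exact (sub_eq_zero.1 e1.symm).symm
    have fin : ∀ W'' : LieSubmodule ℂ (gl I) V, W'' < W → ∀ u ∈ W'',
        (∀ (X : gl I) (c : ℂ), ⁅X, v⁆ = c • v → ⁅X, u⁆ = c • u) →
        UniversalEnvelopingAlgebra.lift ℂ (LieModule.toEnd ℂ (gl I) V) z u = f lam • u := by
      intro W'' hlt u hu hk
      by_cases hu0 : u = 0
      · rw [hu0, map_zero, smul_zero]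
      refine ih W'' ?_ u hu ⟨hu0, fun i => hk _ _ (hv.2.1 i), fun i j hij => ?_⟩
      · have hlt' : W''.toSubmodule < W.toSubmodule := hlt
        have := Submodule.finrank_lt_finrank_of_lt hlt'
        omega
      · have := hk (glE I i j) 0 (by rw [zero_smul]; exact hv.2.2 i j hij)
        rwa [zero_smul] at this
    rw [e, map_add, smul_add, fin W' hlt v₁ h1 fun X c h => (key X c h).1,
      fin _ hlt2 v₂ h2 fun X c h => (key X c h).2]

/-- A central element acts on a highest weight vector of a unitary module by the corresponding
scalar. -/
theorem act_highestWeight (hV : IsUnitaryRep I V) {z : Ugl I} {f : (Fin I.card → ℤ) → ℂ}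
    (hz : CorrespondsTo I z f) {lam : Fin I.card → ℤ} {v : V}
    (hv : IsHighestWeightVector I lam v) :
    UniversalEnvelopingAlgebra.lift ℂ (LieModule.toEnd ℂ (gl I) V) z v = f lam • v :=
  act_highestWeight_of_mem hV hz _ ⊤ le_rfl v (LieSubmodule.mem_top v) hv

end Unitary

/-! ### Tensor products with a representation on column vectors -/

section Tensor

variable {I : Finset ℕ} {κ : Type} [Fintype κ] [DecidableEq κ]

/-- The module `ℂ^κ ⊗ V`, as functions `κ → V`. -/
def VecTensor (_σ : gl I →ₗ⁅ℂ⁆ Matrix κ κ ℂ) (V : Type) : Type := κ → V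

variable (σ : gl I →ₗ⁅ℂ⁆ Matrix κ κ ℂ) (V : Type) [NormedAddCommGroup V] [InnerProductSpace ℂ V]
  [LieRingModule (gl I) V] [LieModule ℂ (gl I) V]

instance : AddCommGroup (VecTensor σ V) := inferInstanceAs (AddCommGroup (κ → V))

instance : Module ℂ (VecTensor σ V) := inferInstanceAs (Module ℂ (κ → V))

theorem eq_zero_of_sum_inner_self {κ : Type} [Fintype κ] {E : Type*} [NormedAddCommGroup E] [InnerProductSpace ℂ E]
    (v : κ → E) (h : ∑ c, (inner ℂ (v c) (v c) : ℂ) = 0) : v = 0 := by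
  have h1 : ∑ c, ‖v c‖ ^ 2 = 0 := by
    apply Complex.ofReal_injective
    rw [Complex.ofReal_zero, ← h]
    push_cast
    exact Finset.sum_congr rfl fun c _ => (inner_self_eq_norm_sq_to_K (𝕜 := ℂ) (v c)).symm
  rw [Finset.sum_eq_zero_iff_of_nonneg fun c _ => by positivity] at h1
  funext c
  simpa using h1 c (Finset.mem_univ c)

/-- The inner product on `ℂ^κ ⊗ V`. -/
noncomputable def vecTensorCore : InnerProductSpace.Core ℂ (VecTensor σ V) where
  inner v w := ∑ c, inner ℂ (v c) (w c)
  conj_inner_symm v w := by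
    rw [map_sum]
    exact Finset.sum_congr rfl fun c _ => inner_conj_symm _ _
  re_inner_nonneg v := by
    rw [map_sum]
    exact Finset.sum_nonneg fun c _ => inner_self_nonneg (𝕜 := ℂ) (E := V)
  add_left v w u := by
    rw [← Finset.sum_add_distrib]
    exact Finset.sum_congr rfl fun c _ => inner_add_left _ _ _
  smul_left v w r := by
    rw [Finset.mul_sum]
    exact Finset.sum_congr rfl fun c _ => inner_smul_left _ _ _
  definite v h := eq_zero_of_sum_inner_self v h

noncomputable instance : NormedAddCommGroup (VecTensor σ V) :=
  @InnerProductSpace.Core.toNormedAddCommGroup ℂ (VecTensor σ V) _ _ _ (vecTensorCore σ V)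

noncomputable instance : InnerProductSpace ℂ (VecTensor σ V) :=
  InnerProductSpace.ofCore (vecTensorCore σ V).toCore

instance [FiniteDimensional ℂ V] : FiniteDimensional ℂ (VecTensor σ V) :=
  inferInstanceAs (FiniteDimensional ℂ (κ → V))

variable {V}

theorem vecTensor_inner (v w : VecTensor σ V) : inner ℂ v w = ∑ c, inner ℂ (v c) (w c) := rfl

instance : Bracket (gl I) (VecTensor σ V) :=
  ⟨fun X w c => ⁅X, w c⁆ + ∑ b, σ X c b • w b⟩

theorem vecTensor_lie (X : gl I) (w : VecTensor σ V) (c : κ) :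
    ⁅X, w⁆ c = ⁅X, w c⁆ + ∑ b, σ X c b • w b := rfl

theorem vecTensor_add (v w : VecTensor σ V) (c : κ) : (v + w) c = v c + w c := rfl

theorem vecTensor_smul (r : ℂ) (w : VecTensor σ V) (c : κ) : (r • w) c = r • w c := rfl

instance : LieRingModule (gl I) (VecTensor σ V) where
  add_lie X Y w := funext fun c => by
    simp only [vecTensor_add, vecTensor_lie, add_lie, map_add, Matrix.add_apply, add_smul,
      Finset.sum_add_distrib]
    abel
  lie_add X v w := funext fun c => by
    simp only [vecTensor_add, vecTensor_lie, lie_add, smul_add, Finset.sum_add_distrib]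
    abel
  leibniz_lie X Y w := funext fun c => by
    have h : ∀ A B : gl I, ∑ b, σ A c b • (⁅B, w b⁆ + ∑ d, σ B b d • w d) =
        ∑ b, σ A c b • ⁅B, w b⁆ + ∑ d, (σ A * σ B) c d • w d := by
      intro A B
      simp only [smul_add, Finset.sum_add_distrib, Finset.smul_sum, smul_smul, Matrix.mul_apply,
        Finset.sum_smul]
      congr 1
      exact Finset.sum_comm
    simp only [vecTensor_add, vecTensor_lie, lie_add, h, LieHom.map_lie, lie_sum, lie_smul]
    rw [leibniz_lie X Y (w c), Ring.lie_def (σ X) (σ Y)]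
    simp only [Matrix.sub_apply, sub_smul, Finset.sum_sub_distrib]
    abel

instance : LieModule ℂ (gl I) (VecTensor σ V) where
  smul_lie r X w := funext fun c => by
    simp only [vecTensor_smul, vecTensor_lie, smul_lie, map_smul, Matrix.smul_apply, smul_add,
      Finset.smul_sum, smul_assoc]
  lie_smul r X w := funext fun c => by
    simp only [vecTensor_smul, vecTensor_lie, lie_smul, smul_add, Finset.smul_sum]
    congr 1
    exact Finset.sum_congr rfl fun b _ => smul_comm _ _ _

theorem isUnitaryRep_vecTensor (hV : IsUnitaryRep I V)
    (hσ : ∀ X, σ X.conjTranspose = (σ X).conjTranspose)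
    (hd : ∀ i, ∃ d : κ → ℤ, σ (glE I i i) = Matrix.diagonal fun c => (d c : ℂ)) :
    IsUnitaryRep I (VecTensor σ V) where
  inner_lie X v w := by
    simp only [vecTensor_inner, vecTensor_lie, inner_add_left, inner_add_right, hV.inner_lie, hσ,
      Finset.sum_add_distrib, sum_inner, inner_sum, inner_smul_left, inner_smul_right,
      Matrix.conjTranspose_apply]
    congr 1
    exact Finset.sum_comm
  integral i v μ hv h := by
    obtain ⟨d, hd⟩ := hd i
    obtain ⟨c, hc⟩ : ∃ c, v c ≠ 0 := by
      by_contra hcon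
      push Not at hcon
      exact hv (funext hcon)
    have h1 : ⁅glE I i i, v c⁆ + ∑ b, σ (glE I i i) c b • v b = μ • v c := congrFun h c
    rw [hd, Finset.sum_eq_single c] at h1
    · rw [Matrix.diagonal_apply_eq] at h1
      have h2 : ⁅glE I i i, v c⁆ = (μ - d c) • v c := by
        rw [sub_smul, ← h1, add_sub_cancel_right]
      obtain ⟨n, hn⟩ := hV.integral i _ _ hc h2
      exact ⟨n + d c, by push_cast; rw [← hn]; ring⟩
    · intro b _ hb
      rw [Matrix.diagonal_apply_ne _ hb.symm, zero_smul]
    · intro h; exact absurd (Finset.mem_univ c) h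

end Tensor

/-! ### The action of `p_{k,I}` on `ℂ^I ⊗ V` -/

/-- Matrices over an algebra acting on `M` act on column vectors with entries in `M`. -/
noncomputable def matOp {U M n : Type*} [Ring U] [Algebra ℂ U] [AddCommGroup M] [Module ℂ M]
    [Fintype n] [DecidableEq n] (π : U →ₐ[ℂ] Module.End ℂ M) :
    Matrix n n U →ₐ[ℂ] Module.End ℂ (n → M) where
  toFun A :=
    { toFun := fun w c => ∑ b, π (A c b) (w b)
      map_add' := fun v w => funext fun c => by
        simp [Finset.sum_add_distrib]
      map_smul' := fun r w => funext fun c => by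
        simp [Finset.smul_sum] }
  map_one' := LinearMap.ext fun w => funext fun c => by
    change ∑ b, π ((1 : Matrix n n U) c b) (w b) = w c
    rw [Finset.sum_eq_single c]
    · simp
    · intro b _ hb; simp [Matrix.one_apply_ne hb.symm]
    · intro h; exact absurd (Finset.mem_univ c) h
  map_mul' A B := LinearMap.ext fun w => funext fun c => by
    change ∑ b, π ((A * B) c b) (w b) = ∑ d, π (A c d) (∑ b, π (B d b) (w b))
    simp only [Matrix.mul_apply, map_sum, map_mul, LinearMap.sum_apply, Module.End.mul_apply]
    exact Finset.sum_comm
  map_zero' := LinearMap.ext fun w => funext fun c => by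
    change ∑ b, π ((0 : Matrix n n U) c b) (w b) = 0
    simp
  map_add' A B := LinearMap.ext fun w => funext fun c => by
    change ∑ b, π ((A + B) c b) (w b) = ∑ b, π (A c b) (w b) + ∑ b, π (B c b) (w b)
    simp [Finset.sum_add_distrib]
  commutes' r := LinearMap.ext fun w => funext fun c => by
    change ∑ b, π (algebraMap ℂ (Matrix n n U) r c b) (w b) = r • w c
    rw [Finset.sum_eq_single c]
    · rw [Matrix.algebraMap_eq_diagonal, Matrix.diagonal_apply_eq, Pi.algebraMap_apply,
        AlgHom.commutes, Module.algebraMap_end_apply]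
    · intro b _ hb
      rw [Matrix.algebraMap_eq_diagonal, Matrix.diagonal_apply_ne _ hb.symm, map_zero]
      rfl
    · intro h; exact absurd (Finset.mem_univ c) h

theorem matOp_apply {U M n : Type*} [Ring U] [Algebra ℂ U] [AddCommGroup M] [Module ℂ M]
    [Fintype n] [DecidableEq n] (π : U →ₐ[ℂ] Module.End ℂ M) (A : Matrix n n U) (w : n → M)
    (c : n) : matOp π A w c = ∑ b, π (A c b) (w b) := rfl

/-- The matrix with entries `F_cb = E_bc` over `U(gl(I))`. -/
noncomputable def Fmat (I : Finset ℕ) : Matrix (Fin I.card) (Fin I.card) (Ugl I) :=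
  Matrix.of fun c b => Egen I b c

/-- The polynomial `(c + 1/2)^k - (c - 1/2)^k` of the content `c` of a box. -/
noncomputable def gPoly (k : ℕ) : Polynomial ℂ :=
  (Polynomial.X + Polynomial.C (1 / 2)) ^ k - (Polynomial.X - Polynomial.C (1 / 2)) ^ k

/-- The standard representation of `gl(I)`, indexed by the positions in `I`. -/
def stdRep (I : Finset ℕ) : gl I →ₗ⁅ℂ⁆ Matrix (Fin I.card) (Fin I.card) ℂ where
  toFun X := X.submatrix (I.orderIsoOfFin rfl) (I.orderIsoOfFin rfl)
  map_add' X Y := rfl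
  map_smul' c X := rfl
  map_lie' {X Y} := by
    have h : ∀ A B : gl I, (A * B).submatrix (I.orderIsoOfFin rfl) (I.orderIsoOfFin rfl) =
        A.submatrix (I.orderIsoOfFin rfl) (I.orderIsoOfFin rfl) *
          B.submatrix (I.orderIsoOfFin rfl) (I.orderIsoOfFin rfl) := fun A B =>
      (Matrix.submatrix_mul_equiv A B _ (I.orderIsoOfFin rfl).toEquiv _).symm
    rw [Ring.lie_def, Ring.lie_def, ← h, ← h]
    rfl

theorem stdRep_glE (I : Finset ℕ) (p q c b : Fin I.card) :
    stdRep I (glE I p q) c b = if p = c ∧ q = b then 1 else 0 := by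
  change (glE I p q) (I.orderIsoOfFin rfl c) (I.orderIsoOfFin rfl b) = _
  simp [Matrix.single_apply]

/-! ### The operator F and the coproduct formula -/

section

variable {I : Finset ℕ} {V : Type} [NormedAddCommGroup V] [InnerProductSpace ℂ V]
  [LieRingModule (gl I) V] [LieModule ℂ (gl I) V]

theorem stdTensor_lie (p q : Fin I.card) (w : VecTensor (stdRep I) V) (c : Fin I.card) :
    ⁅glE I p q, w⁆ c = ⁅glE I p q, w c⁆ + if p = c then w q else 0 := by
  rw [vecTensor_lie]
  congr 1
  rw [Finset.sum_eq_single q]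
  · rw [stdRep_glE]
    by_cases h : p = c <;> simp [h]
  · intro b _ hb
    rw [stdRep_glE, if_neg fun h => hb h.2.symm, zero_smul]
  · intro h; exact absurd (Finset.mem_univ q) h

theorem isUnitaryRep_stdTensor (hV : IsUnitaryRep I V) :
    IsUnitaryRep I (VecTensor (stdRep I) V) := by
  refine isUnitaryRep_vecTensor _ hV (fun X => rfl) fun i => ⟨fun c => if i = c then 1 else 0, ?_⟩
  ext c b
  rw [stdRep_glE, Matrix.diagonal_apply]
  by_cases h : c = b
  · subst h; by_cases h : i = c <;> simp [h]
  · rw [if_neg h, if_neg fun h' => h (h'.1.symm.trans h'.2)]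

/-- The operator `∑ E_cb ⊗ E_bc` on `ℂ^I ⊗ V`. -/
noncomputable def Fop (I : Finset ℕ) (V : Type) [NormedAddCommGroup V] [InnerProductSpace ℂ V]
    [LieRingModule (gl I) V] [LieModule ℂ (gl I) V] :
    Module.End ℂ (VecTensor (stdRep I) V) :=
  matOp (UniversalEnvelopingAlgebra.lift ℂ (LieModule.toEnd ℂ (gl I) V)) (Fmat I)

theorem Fop_apply (w : VecTensor (stdRep I) V) (c : Fin I.card) :
    Fop I V w c = ∑ b, ⁅glE I b c, w b⁆ := by
  exact Finset.sum_congr (s₁ := (Finset.univ : Finset (Fin I.card))) rfl fun b _ =>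
    lift_Egen b c (w b)

/-- F is the split Casimir tensor, which is invariant under gl(I); on matrix units this is a
cancellation of delta terms. -/
theorem Fop_lie (X : gl I) (w : VecTensor (stdRep I) V) : Fop I V ⁅X, w⁆ = ⁅X, Fop I V w⁆ := by
  have h : ∀ p q, Fop I V ⁅glE I p q, w⁆ = ⁅glE I p q, Fop I V w⁆ := by
    intro p q
    funext c
    rw [Fop_apply, stdTensor_lie, Fop_apply, lie_sum]
    have h1 : ∀ b, ⁅glE I b c, ⁅glE I p q, w⁆ b⁆ = ⁅glE I p q, ⁅glE I b c, w b⁆⁆ +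
        ((if p = c then ⁅glE I b q, w b⁆ else 0) - (if b = q then ⁅glE I p c, w b⁆ else 0)) +
        if p = b then ⁅glE I b c, w q⁆ else 0 := by
      intro b
      rw [stdTensor_lie, lie_add, leibniz_lie (glE I b c), glE_lie, sub_lie]
      have e1 : ⁅(if c = p then glE I b q else 0 : gl I), w b⁆ =
          if p = c then ⁅glE I b q, w b⁆ else 0 := by
        by_cases h : p = c
        · simp [h]
        · simp [h, Ne.symm h]
      have e2 : ⁅(if b = q then glE I p c else 0 : gl I), w b⁆ =
          if b = q then ⁅glE I p c, w b⁆ else 0 := by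
        by_cases h : b = q <;> simp [h]
      rw [e1, e2]
      have e3 : ⁅glE I b c, (if p = b then w q else 0 : V)⁆ =
          if p = b then ⁅glE I b c, w q⁆ else 0 := by
        by_cases h : p = b <;> simp [h]
      rw [e3]; abel
    rw [Finset.sum_congr rfl fun b _ => h1 b, Finset.sum_add_distrib, Finset.sum_add_distrib,
      Finset.sum_sub_distrib]
    simp only [Finset.sum_ite_eq, Finset.sum_ite_eq', Finset.mem_univ, if_true]
    by_cases hpc : p = c
    · simp only [hpc, if_true, Fop_apply]; abel
    · simp [hpc]
  rw [gl_eq_sum_glE X]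
  simp only [sum_lie, smul_lie, map_sum, map_smul, h]

theorem Fop_symmetric (hV : IsUnitaryRep I V) (v w : VecTensor (stdRep I) V) :
    inner ℂ (Fop I V v) w = inner ℂ v (Fop I V w) := by
  simp only [vecTensor_inner, Fop_apply, sum_inner, inner_sum, hV.inner_lie, glE_conjTranspose]
  exact Finset.sum_comm

variable [FiniteDimensional ℂ V]

/-- A highest weight vector of `ℂ^I ⊗ V` that is an eigenvector of `F`, with components in a
submodule: its last nonzero component is a highest weight vector. -/
theorem exists_component_highestWeight {v : VecTensor (stdRep I) V} {mu : Fin I.card → ℤ}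
    (hv : IsHighestWeightVector I mu v) {e : ℂ} (he : Fop I V v = e • v) :
    ∃ (m : Fin I.card) (lam : Fin I.card → ℤ), IsHighestWeightVector I lam (v m) ∧
      (∀ p, mu p = lam p + if p = m then 1 else 0) ∧ e = (lam m : ℂ) - ((m : ℕ) : ℂ) := by
  obtain ⟨hv0, hv1, hv2⟩ := hv
  classical
  have hne : (Finset.univ.filter fun c : Fin I.card => v c ≠ 0).Nonempty := by
    by_contra hcon
    rw [Finset.not_nonempty_iff_eq_empty, Finset.filter_eq_empty_iff] at hcon
    exact hv0 (funext fun c => not_not.1 (hcon (Finset.mem_univ c)))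
  obtain ⟨m, hm, hmax⟩ := Finset.exists_max_image _ id hne
  have hm0 : v m ≠ 0 := (Finset.mem_filter.1 hm).2
  have hgt : ∀ c, m < c → v c = 0 := by
    intro c hc
    by_contra h
    exact (hmax c (Finset.mem_filter.2 ⟨Finset.mem_univ _, h⟩)).not_gt hc
  have hw : ∀ p, ⁅glE I p p, v m⁆ = ((mu p - if p = m then 1 else 0 : ℤ) : ℂ) • v m := by
    intro p
    have h1 : ⁅glE I p p, v⁆ m = (mu p : ℂ) • v m := congrFun (hv1 p) m
    rw [stdTensor_lie] at h1
    by_cases h : p = m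
    · subst h
      rw [if_pos rfl] at h1 ⊢
      push_cast
      rw [sub_smul, ← h1, one_smul, add_sub_cancel_right]
    · rw [if_neg h, add_zero] at h1
      rw [if_neg h, sub_zero, h1]
  have hup : ∀ p q, p < q → ⁅glE I p q, v m⁆ = 0 := by
    intro p q hpq
    have h1 : ⁅glE I p q, v⁆ m = 0 := congrFun (hv2 p q hpq) m
    rw [stdTensor_lie] at h1
    by_cases h : p = m
    · subst h
      rwa [if_pos rfl, hgt q hpq, add_zero] at h1
    · rwa [if_neg h, add_zero] at h1
  refine ⟨m, fun p => mu p - if p = m then 1 else 0, ⟨hm0, hw, hup⟩, fun p => by ring, ?_⟩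
  have h1 : Fop I V v m = e • v m := congrFun he m
  rw [Fop_apply] at h1
  -- For b < m, the condition E_bm v = 0 read at the component b gives E_bm v_b = -v_m. These m
  -- terms turn the weight λ_m into the content λ_m - m of the new box.
  have hterm : ∀ b, ⁅glE I b m, v b⁆ = (if b = m then ((mu m : ℂ) - 1) • v m else 0) -
      if b < m then v m else 0 := by
    intro b
    rcases lt_trichotomy b m with h | h | h
    · have h2 : ⁅glE I b m, v⁆ b = 0 := congrFun (hv2 b m h) b
      rw [stdTensor_lie, if_pos rfl] at h2
      rw [if_neg h.ne, if_pos h, zero_sub]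
      exact eq_neg_of_add_eq_zero_left h2
    · subst h
      rw [if_pos rfl, if_neg (lt_irrefl _), sub_zero, hw]
      simp
    · rw [if_neg h.ne', if_neg h.not_gt, hgt b h, lie_zero, sub_zero]
  rw [Finset.sum_congr rfl fun b _ => hterm b, Finset.sum_sub_distrib, Finset.sum_ite_eq',
    if_pos (Finset.mem_univ _), ← Finset.sum_filter, Finset.sum_const,
    ← Nat.cast_smul_eq_nsmul ℂ, ← sub_smul] at h1
  have hcard : (Finset.univ.filter fun b : Fin I.card => b < m).card = (m : ℕ) := by
    rw [← Fin.card_Iio m]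
    congr 1
    ext b; simp
  rw [hcard] at h1
  have h2 := smul_left_injective ℂ hm0 h1
  simp only [if_true]
  push_cast
  rw [← h2]

/-- Only row m changes. With m counted from zero, the shifted coordinate moves from λ_m - m - 1/2 to
λ_m - m + 1/2, the two sides of the added box. -/
theorem shiftedPowerSum_add_box {N k : ℕ} {mu lam : Fin N → ℤ} {m : Fin N}
    (h : ∀ p, mu p = lam p + if p = m then 1 else 0) :
    shiftedPowerSum N k mu - shiftedPowerSum N k lam =
      (gPoly k).eval ((lam m : ℂ) - ((m : ℕ) : ℂ)) := by
  rw [shiftedPowerSum, shiftedPowerSum, ← Finset.sum_sub_distrib, Finset.sum_eq_single m]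
  · rw [h m, if_pos rfl, gPoly]
    simp only [Polynomial.eval_sub, Polynomial.eval_pow, Polynomial.eval_add, Polynomial.eval_X,
      Polynomial.eval_C]
    push_cast
    ring
  · intro p _ hp
    rw [h p, if_neg hp, add_zero, sub_self]
  · intro h; exact absurd (Finset.mem_univ m) h

/-- The action of an element of `U(gl(I))` on the components of `ℂ^I ⊗ V`. -/
noncomputable def compOp (z : Ugl I) (V : Type) [NormedAddCommGroup V]
    [InnerProductSpace ℂ V] [LieRingModule (gl I) V] [LieModule ℂ (gl I) V] :
    Module.End ℂ (VecTensor (stdRep I) V) where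
  toFun w := fun c => UniversalEnvelopingAlgebra.lift ℂ (LieModule.toEnd ℂ (gl I) V) z (w c)
  map_add' v w := funext fun c => map_add _ (v c) (w c)
  map_smul' r w := funext fun c => map_smul _ r (w c)

theorem compOp_apply (z : Ugl I) (w : VecTensor (stdRep I) V) (c : Fin I.card) :
    compOp z V w c = UniversalEnvelopingAlgebra.lift ℂ (LieModule.toEnd ℂ (gl I) V) z (w c) := rfl

/-- The difference between the two sides of the coproduct formula. -/
noncomputable def coproductDefect (k : ℕ) (z : Ugl I) (V : Type) [NormedAddCommGroup V]
    [InnerProductSpace ℂ V] [LieRingModule (gl I) V] [LieModule ℂ (gl I) V] :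
    Module.End ℂ (VecTensor (stdRep I) V) :=
  UniversalEnvelopingAlgebra.lift ℂ (LieModule.toEnd ℂ (gl I) (VecTensor (stdRep I) V)) z -
    compOp z V - Polynomial.aeval (Fop I V) (gPoly k)

theorem aeval_commute_lie {L M : Type*} [LieRing L] [LieAlgebra ℂ L] [AddCommGroup M] [Module ℂ M]
    [LieRingModule L M] [LieModule ℂ L M] {Φ : Module.End ℂ M}
    (h : ∀ (X : L) v, Φ ⁅X, v⁆ = ⁅X, Φ v⁆) (P : Polynomial ℂ) (X : L) (v : M) :
    Polynomial.aeval Φ P ⁅X, v⁆ = ⁅X, Polynomial.aeval Φ P v⁆ := by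
  induction P using Polynomial.induction_on' with
  | add p q hp hq => rw [map_add, LinearMap.add_apply, LinearMap.add_apply, hp, hq, lie_add]
  | monomial n a =>
    have hpow : ∀ n v, (Φ ^ n) ⁅X, v⁆ = ⁅X, (Φ ^ n) v⁆ := by
      intro n
      induction n with
      | zero => intro v; rfl
      | succ n ih => intro v; rw [pow_succ, Module.End.mul_apply, Module.End.mul_apply, h, ih]
    rw [Polynomial.aeval_monomial, Module.End.mul_apply, Module.End.mul_apply,
      Module.algebraMap_end_apply, Module.algebraMap_end_apply, hpow, lie_smul]

theorem coproductDefect_lie {k : ℕ} {z : Ugl I} (hz : z ∈ Subalgebra.center ℂ (Ugl I)) (X : gl I)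
    (w : VecTensor (stdRep I) V) :
    coproductDefect k z V ⁅X, w⁆ = ⁅X, coproductDefect k z V w⁆ := by
  have h2 : compOp z V ⁅X, w⁆ = ⁅X, compOp z V w⁆ := by
    funext c
    rw [compOp_apply, vecTensor_lie, vecTensor_lie, compOp_apply, map_add, lie_lift_comm hz,
      map_sum]
    congr 1
    exact Finset.sum_congr rfl fun b _ => by rw [map_smul, compOp_apply]
  rw [coproductDefect, LinearMap.sub_apply, LinearMap.sub_apply, LinearMap.sub_apply,
    LinearMap.sub_apply, lie_sub, lie_sub, h2, lie_lift_comm hz, aeval_commute_lie Fop_lie]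

theorem coproductDefect_Fop {k : ℕ} {z : Ugl I} (hz : z ∈ Subalgebra.center ℂ (Ugl I))
    (w : VecTensor (stdRep I) V) :
    coproductDefect k z V (Fop I V w) = Fop I V (coproductDefect k z V w) := by
  have h1 := lift_equivariant (ρ := LieModule.toEnd ℂ (gl I) (VecTensor (stdRep I) V))
    (ρ' := LieModule.toEnd ℂ (gl I) (VecTensor (stdRep I) V)) (Fop I V)
    (fun X v => Fop_lie X v) z w
  have h2 : compOp z V (Fop I V w) = Fop I V (compOp z V w) := by
    funext c
    rw [Fop_apply]
    have : compOp z V (Fop I V w) c =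
      UniversalEnvelopingAlgebra.lift ℂ (LieModule.toEnd ℂ (gl I) V) z (Fop I V w c) := rfl
    rw [this, Fop_apply, map_sum]
    exact Finset.sum_congr rfl fun b _ => lie_lift_comm hz _ _
  have h3 : Polynomial.aeval (Fop I V) (gPoly k) (Fop I V w) =
      Fop I V (Polynomial.aeval (Fop I V) (gPoly k) w) := by
    rw [← Module.End.mul_apply, ← Module.End.mul_apply]
    congr 1
    have e : Polynomial.aeval (Fop I V) (gPoly k * Polynomial.X) =
        Polynomial.aeval (Fop I V) (Polynomial.X * gPoly k) := by rw [mul_comm]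
    rwa [map_mul, map_mul, Polynomial.aeval_X] at e
  rw [coproductDefect, LinearMap.sub_apply, LinearMap.sub_apply, LinearMap.sub_apply,
    LinearMap.sub_apply, map_sub, map_sub, h2, h3, h1]

theorem aeval_apply_of_eq_smul {M : Type*} [AddCommGroup M] [Module ℂ M] {Φ : Module.End ℂ M}
    {v : M} {e : ℂ} (h : Φ v = e • v) (P : Polynomial ℂ) :
    Polynomial.aeval Φ P v = P.eval e • v := by
  by_cases hv : v = 0
  · rw [hv, map_zero, smul_zero]
  exact Module.End.aeval_apply_of_hasEigenvector ⟨Module.End.mem_eigenspace_iff.2 h, hv⟩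

/-- The kernel of the defect is a submodule stable under the symmetric operator F, so its orthogonal
complement in ℂ^I ⊗ W is stable too. If this were nonzero, it would contain a highest weight vector
that is an eigenvector of F. On such a vector both sides of the coproduct formula are scalars, and
they agree, which is a contradiction. -/
theorem coproductDefect_of_minimal (hV : IsUnitaryRep I V) {k : ℕ} {z : Ugl I}
    (hz : CorrespondsTo I z (shiftedPowerSum I.card k)) {W : LieSubmodule ℂ (gl I) V}
    (hW : ∀ W' ≤ W, W' ≠ ⊥ → W' = W) {w : VecTensor (stdRep I) V} (hw : ∀ c, w c ∈ W) :
    coproductDefect k z V w = 0 := by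
  have hT := isUnitaryRep_stdTensor hV
  let Q : LieSubmodule ℂ (gl I) (VecTensor (stdRep I) V) :=
    { carrier := {w | ∀ c, w c ∈ W}
      add_mem' := fun ha hb c => W.add_mem (ha c) (hb c)
      zero_mem' := fun c => W.zero_mem
      smul_mem' := fun r a ha c => W.smul_mem r (ha c)
      lie_mem := fun {X a} ha c => by
        rw [vecTensor_lie]
        exact W.add_mem (W.lie_mem (ha c)) (W.sum_mem fun b _ => W.smul_mem _ (ha b)) }
  let K := kerLie (coproductDefect k z V) (coproductDefect_lie hz.1)
  by_contra hcon
  have hlt : Q ⊓ K < Q := by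
    refine lt_of_le_of_ne inf_le_left fun h => hcon ?_
    exact ((SetLike.ext_iff.1 h w).2 hw).2
  have hne := orthLie_inf_ne_bot hT hlt
  set T := Q ⊓ orthLie hT (Q ⊓ K) with hTdef
  have hFQ : ∀ x ∈ Q, Fop I V x ∈ Q := by
    intro x hx c
    rw [Fop_apply]
    exact W.sum_mem fun b _ => W.lie_mem (hx b)
  have hFT : ∀ x ∈ T, Fop I V x ∈ T := by
    rintro x ⟨hx1, hx2⟩
    refine ⟨hFQ x hx1, mem_orthLie.2 fun u hu => ?_⟩
    rw [← Fop_symmetric hV]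
    refine mem_orthLie.1 hx2 _ ⟨hFQ u hu.1, ?_⟩
    have hu2 : coproductDefect k z V u = 0 := hu.2
    change coproductDefect k z V (Fop I V u) = 0
    rw [coproductDefect_Fop hz.1, hu2, map_zero]
  have : Nontrivial T.toSubmodule := (LieSubmodule.nontrivial_iff_ne_bot ℂ (gl I) _).2 hne
  obtain ⟨e, he⟩ := Module.End.exists_eigenvalue ((Fop I V).restrict (p := T.toSubmodule) hFT)
  obtain ⟨x, hx⟩ := he.exists_hasEigenvector
  let S : LieSubmodule ℂ (gl I) (VecTensor (stdRep I) V) :=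
    kerLie (Fop I V - e • LinearMap.id) fun X v => by
      simp only [LinearMap.sub_apply, LinearMap.smul_apply, LinearMap.id_apply, Fop_lie, lie_sub,
        lie_smul]
  have hSne : T ⊓ S ≠ ⊥ := by
    intro hb
    rw [LieSubmodule.eq_bot_iff] at hb
    apply hx.2
    refine Subtype.ext (hb x ⟨x.2, ?_⟩)
    have := congrArg Subtype.val hx.apply_eq_smul
    change Fop I V x - e • (x : VecTensor (stdRep I) V) = 0
    exact sub_eq_zero.2 this
  obtain ⟨v, ⟨hvT, hvS⟩, mu, hv⟩ := exists_highestWeight hT hSne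
  have hvF : Fop I V v = e • v := sub_eq_zero.1 hvS
  -- The last nonzero component identifies the row m of the added box and its content e. Minimality
  -- of W makes z act on all components by the scalar of lam.
  obtain ⟨m, lam, hlam, hmu, hee⟩ := exists_component_highestWeight hv hvF
  have h1 := act_highestWeight hT hz hv
  have h2 : compOp z V v = shiftedPowerSum I.card k lam • v := by
    funext c
    exact act_of_minimal hV hz hW (hvT.1 m) hlam (hvT.1 c)
  have h3 := aeval_apply_of_eq_smul hvF (gPoly k)
  have h4 : coproductDefect k z V v = 0 := by
    rw [coproductDefect, LinearMap.sub_apply, LinearMap.sub_apply, h1, h2, h3, ← sub_smul,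
      shiftedPowerSum_add_box hmu, hee, sub_self]
  exact hv.1 (eq_zero_of_mem_orthLie (hV := hT) (W := Q ⊓ K) ⟨hvT.1, h4⟩ hvT.2)

/-- Induction on dimension: if W is not minimal, split every component of w along a proper submodule
and its orthogonal complement, and use linearity of the defect. -/
theorem coproductDefect_of_mem (hV : IsUnitaryRep I V) {k : ℕ} {z : Ugl I}
    (hz : CorrespondsTo I z (shiftedPowerSum I.card k)) (n : ℕ) :
    ∀ W : LieSubmodule ℂ (gl I) V, Module.finrank ℂ W.toSubmodule ≤ n →
      ∀ w : VecTensor (stdRep I) V, (∀ c, w c ∈ W) → coproductDefect k z V w = 0 := by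
  induction n with
  | zero =>
    intro W hW w hw
    have : W.toSubmodule = ⊥ := Submodule.finrank_eq_zero.1 (Nat.le_zero.1 hW)
    have hw0 : w = 0 := funext fun c => by
      have h : w c ∈ W.toSubmodule := hw c
      rw [this] at h
      exact (Submodule.mem_bot ℂ).1 h
    rw [hw0, map_zero]
  | succ n ih =>
    intro W hn w hw
    by_cases hW : ∀ W' ≤ W, W' ≠ ⊥ → W' = W
    · exact coproductDefect_of_minimal hV hz hW hw
    push Not at hW
    obtain ⟨W', hle, hne, hne'⟩ := hW
    have hlt : W' < W := lt_of_le_of_ne hle hne'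
    have hlt2 : W ⊓ orthLie hV W' < W := by
      refine lt_of_le_of_ne inf_le_left fun h => hne ?_
      rw [LieSubmodule.eq_bot_iff]
      intro x hx
      have : x ∈ W ⊓ orthLie hV W' := (SetLike.ext_iff.1 h x).2 (hle hx)
      exact eq_zero_of_mem_orthLie hx this.2
    have hrank : ∀ W'' : LieSubmodule ℂ (gl I) V, W'' < W →
        Module.finrank ℂ W''.toSubmodule ≤ n := fun W'' hlt => by
      have hlt' : W''.toSubmodule < W.toSubmodule := hlt
      have := Submodule.finrank_lt_finrank_of_lt hlt'
      omega
    choose w₁ h1 w₂ h2 h12 using fun c => exists_orthLie_decomp_of_le hV hle (hw c)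
    have e : ∀ u₁ u₂ : VecTensor (stdRep I) V, w = u₁ + u₂ → coproductDefect k z V u₁ = 0 →
        coproductDefect k z V u₂ = 0 → coproductDefect k z V w = 0 := fun u₁ u₂ h a b => by
      rw [h, map_add, a, b, add_zero]
    exact e w₁ w₂ (funext h12) (ih W' (hrank _ hlt) w₁ h1) (ih _ (hrank _ hlt2) w₂ h2)

/-- The coproduct formula: a central element corresponding to a shifted power sum acts on
`ℂ^I ⊗ V` by its action on `V` plus the polynomial `gPoly` of `∑ E_cb ⊗ E_bc`. -/
theorem stdTensor_act (hV : IsUnitaryRep I V) {k : ℕ} {z : Ugl I}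
    (hz : CorrespondsTo I z (shiftedPowerSum I.card k)) (w : VecTensor (stdRep I) V) :
    UniversalEnvelopingAlgebra.lift ℂ (LieModule.toEnd ℂ (gl I) (VecTensor (stdRep I) V)) z w =
      compOp z V w + Polynomial.aeval (Fop I V) (gPoly k) w := by
  have := coproductDefect_of_mem hV hz _ ⊤ le_rfl w fun c => LieSubmodule.mem_top _
  rw [coproductDefect, LinearMap.sub_apply, LinearMap.sub_apply, sub_sub] at this
  exact sub_eq_zero.1 this

end

/-! ### The action of `U(gl(I))` on polynomials -/

section Incl

variable {I J : Finset ℕ} (h : I ⊆ J)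

/-- The element of `J` at position `b` of `I`. -/
def inclIdx (b : Fin I.card) : J := ⟨I.orderIsoOfFin rfl b, h (I.orderIsoOfFin rfl b).2⟩

theorem inclIdx_injective : Function.Injective (inclIdx h) := fun a b hab => by
  have := congrArg Subtype.val hab
  exact (I.orderIsoOfFin rfl).injective (Subtype.ext this)

theorem exists_inclIdx {j : J} (hj : (j : ℕ) ∈ I) : ∃ b, inclIdx h b = j := by
  obtain ⟨b, hb⟩ := (I.orderIsoOfFin rfl).surjective ⟨j, hj⟩
  have hb' : ((I.orderIsoOfFin rfl b : I) : ℕ) = j := by rw [hb]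
  exact ⟨b, Subtype.ext hb'⟩

theorem inclIdx_mem (b : Fin I.card) : (inclIdx h b : ℕ) ∈ I := (I.orderIsoOfFin rfl b).2

theorem inclMatrix_single (p : I) (a : J) :
    inclMatrix I J a p = if a = ⟨p, h p.2⟩ then 1 else 0 := by
  simp [inclMatrix, Subtype.ext_iff]

theorem glIncl_single (p q : I) :
    glIncl h (Matrix.single p q 1) = Matrix.single ⟨p, h p.2⟩ ⟨q, h q.2⟩ 1 := by
  ext a b
  change (inclMatrix I J * Matrix.single p q (1 : ℂ) * (inclMatrix I J).transpose) a b = _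
  rw [Matrix.mul_apply, Finset.sum_eq_single q, Matrix.mul_apply, Finset.sum_eq_single p]
  · rw [Matrix.transpose_apply, inclMatrix_single h, inclMatrix_single h, Matrix.single_apply_same,
      Matrix.single_apply]
    by_cases h1 : a = ⟨p, h p.2⟩ <;> by_cases h2 : b = ⟨q, h q.2⟩ <;> simp [h1, h2, eq_comm]
  · intro c _ hc
    rw [Matrix.single_apply_of_row_ne hc.symm, mul_zero]
  · simp
  · intro c _ hc
    rw [Matrix.mul_apply, Finset.sum_eq_zero, zero_mul]
    intro d _
    rw [Matrix.single_apply_of_col_ne _ _ hc.symm, mul_zero]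
  · simp

theorem glIncl_glE (p q : Fin I.card) :
    glIncl h (glE I p q) = Matrix.single (inclIdx h p) (inclIdx h q) 1 :=
  glIncl_single h _ _

theorem glIncl_conjTranspose (X : gl I) :
    glIncl h X.conjTranspose = (glIncl h X).conjTranspose := by
  change inclMatrix I J * X.conjTranspose * (inclMatrix I J).transpose =
    (inclMatrix I J * X * (inclMatrix I J).transpose).conjTranspose
  have e : (inclMatrix I J).conjTranspose = (inclMatrix I J).transpose := by
    ext a b; simp [inclMatrix, apply_ite]
  have e' : (inclMatrix I J).transpose.conjTranspose = inclMatrix I J := by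
    rw [← e, Matrix.conjTranspose_conjTranspose]
  rw [Matrix.conjTranspose_mul, Matrix.conjTranspose_mul, e, e', Matrix.mul_assoc]

theorem xMul_single {J : Finset ℕ} (p q a b : J) :
    xMul (Matrix.single p q (1 : ℂ)) a b = if b = q then xMat J a p else 0 := by
  rw [xMul, Matrix.mul_apply, Finset.sum_eq_single p]
  · by_cases hb : b = q
    · simp [hb]
    · simp [hb, Ne.symm hb]
  · intro c _ hc
    simp [Ne.symm hc]
  · simp

theorem trace_xMul_single {J : Finset ℕ} (p q : J) :
    (xMul (Matrix.single p q (1 : ℂ))).trace = xMat J q p := by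
  simp [Matrix.trace, xMul_single]

theorem stdRep_apply (X : gl I) (b c : Fin I.card) :
    stdRep I X b c = X (I.orderIsoOfFin rfl b) (I.orderIsoOfFin rfl c) := rfl

theorem glIncl_eq_sum (X : gl I) :
    glIncl h X = ∑ p : Fin I.card, ∑ q : Fin I.card,
      stdRep I X p q • Matrix.single (inclIdx h p) (inclIdx h q) (1 : ℂ) := by
  conv_lhs => rw [gl_eq_sum_glE X]
  simp only [map_sum, map_smul, glIncl_glE, stdRep_apply]

theorem xMul_sum {J : Finset ℕ} {ι : Type*} (t : Finset ι) (X : ι → gl J) :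
    xMul (∑ i ∈ t, X i) = ∑ i ∈ t, xMul (X i) := by
  classical
  induction t using Finset.induction_on with
  | empty =>
    have := xMul_smul (J := J) 0 0
    rw [zero_smul, zero_smul] at this
    simpa using this
  | insert i t hi ih => rw [Finset.sum_insert hi, Finset.sum_insert hi, xMul_add, ih]

/-- For fixed a, the entries x_ab with b ∈ I transform by the standard representation. Hence
multiplication by x_ab can be read as tensoring with it. -/
theorem xMul_glIncl (X : gl I) (a : J) (b : Fin I.card) :
    xMul (glIncl h X) a (inclIdx h b) =
      ∑ c, stdRep I X c b • xMat J a (inclIdx h c) := by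
  rw [glIncl_eq_sum h X]
  simp only [xMul_sum, xMul_smul, Matrix.sum_apply, Matrix.smul_apply, xMul_single,
    (inclIdx_injective h).eq_iff]
  refine Finset.sum_congr rfl fun c _ => ?_
  rw [Finset.sum_eq_single b]
  · simp
  · intro d _ hd; simp [hd.symm]
  · simp

theorem xMul_glIncl_of_notMem (X : gl I) (a : J) {b : J} (hb : (b : ℕ) ∉ I) :
    xMul (glIncl h X) a b = 0 := by
  rw [glIncl_eq_sum h X]
  simp only [xMul_sum, xMul_smul, Matrix.sum_apply, Matrix.smul_apply, xMul_single]
  refine Finset.sum_eq_zero fun c _ => Finset.sum_eq_zero fun d _ => ?_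
  rw [if_neg, smul_zero]
  intro e
  exact hb (e ▸ inclIdx_mem h d)

theorem xMul_eq_sum {J : Finset ℕ} (X : gl J) (a b : J) :
    xMul X a b = ∑ c, X c b • xMat J a c := by
  rw [xMul, Matrix.mul_apply]
  exact Finset.sum_congr rfl fun c _ => by
    rw [Matrix.map_apply, MvPolynomial.smul_eq_C_mul, mul_comm]

/-- The restriction of `polyRep` to `gl(I)`. -/
noncomputable def inclRep (s : ℂ) : gl I →ₗ⁅ℂ⁆ Module.End ℂ (PolyAlg J) :=
  (polyRep J s).comp (glIncl h)

/-- The action of `U(gl(I))` on polynomials. -/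
noncomputable def inclAct (s : ℂ) : Ugl I →ₐ[ℂ] Module.End ℂ (PolyAlg J) :=
  UniversalEnvelopingAlgebra.lift ℂ (inclRep h s)

theorem inclRep_apply (s : ℂ) (X : gl I) (f : PolyAlg J) :
    inclRep h s X f = glDer (glIncl h X) f + s • (xMul (glIncl h X)).trace * f :=
  polyRep_apply s _ f

theorem inclAct_ι (s : ℂ) (X : gl I) :
    inclAct h s (UniversalEnvelopingAlgebra.ι ℂ X) = inclRep h s X :=
  UniversalEnvelopingAlgebra.lift_ι_apply ℂ _ _

theorem polyAct_UglIncl (s : ℂ) (z : Ugl I) : polyAct J s (UglIncl h z) = inclAct h s z := by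
  have : (polyAct J s).comp (UglIncl h) = inclAct h s := by
    apply UniversalEnvelopingAlgebra.hom_ext
    ext X : 1
    change polyAct J s (UglIncl h (UniversalEnvelopingAlgebra.ι ℂ X)) =
      inclAct h s (UniversalEnvelopingAlgebra.ι ℂ X)
    rw [UglIncl, UniversalEnvelopingAlgebra.lift_ι_apply, polyAct, inclAct_ι]
    exact UniversalEnvelopingAlgebra.lift_ι_apply ℂ _ _
  exact DFunLike.congr_fun this z

theorem inclAct_Egen (s : ℂ) (p q : Fin I.card) (f : PolyAlg J) :
    inclAct h s (Egen I p q) f =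
      glDer (Matrix.single (inclIdx h p) (inclIdx h q) 1) f +
        s • xMat J (inclIdx h q) (inclIdx h p) * f := by
  rw [Egen, inclAct_ι, inclRep_apply, glIncl_glE, trace_xMul_single]

/-! ### Polynomials are spanned by unitary modules -/

/-- The trivial one-dimensional module. -/
def TrivRep (_I : Finset ℕ) : Type := ℂ

noncomputable instance : NormedAddCommGroup (TrivRep I) := inferInstanceAs (NormedAddCommGroup ℂ)

noncomputable instance : InnerProductSpace ℂ (TrivRep I) :=
  inferInstanceAs (InnerProductSpace ℂ ℂ)

instance : FiniteDimensional ℂ (TrivRep I) := inferInstanceAs (FiniteDimensional ℂ ℂ)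

noncomputable instance : LieRingModule (gl I) (TrivRep I) where
  bracket _ _ := 0
  add_lie _ _ _ := (add_zero _).symm
  lie_add _ _ _ := (add_zero _).symm
  leibniz_lie _ _ _ := (add_zero _).symm

theorem trivRep_lie (X : gl I) (v : TrivRep I) : ⁅X, v⁆ = 0 := rfl

instance : LieModule ℂ (gl I) (TrivRep I) where
  smul_lie _ _ _ := (smul_zero _).symm
  lie_smul _ _ _ := (smul_zero _).symm

/-- The inclusion of constants. -/
noncomputable def trivMap : TrivRep I →ₗ[ℂ] PolyAlg J where
  toFun c := algebraMap ℂ (PolyAlg J) c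
  map_add' a b := map_add (algebraMap ℂ (PolyAlg J)) a b
  map_smul' a b := (map_mul (algebraMap ℂ (PolyAlg J)) a b).trans (Algebra.smul_def _ _).symm

theorem isUnitaryRep_trivRep : IsUnitaryRep I (TrivRep I) where
  inner_lie X v w := by rw [trivRep_lie, trivRep_lie, inner_zero_left, inner_zero_right]
  integral i v μ hv h := by
    rw [trivRep_lie] at h
    exact ⟨0, by simpa using (smul_eq_zero.1 h.symm).resolve_right hv⟩

/-! ### Multiplication as an equivariant map from a tensor product -/

section VecMap

variable {κ : Type} [Fintype κ] [DecidableEq κ] (σ : gl I →ₗ⁅ℂ⁆ Matrix κ κ ℂ) {V : Type}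
  [NormedAddCommGroup V] [InnerProductSpace ℂ V] [LieRingModule (gl I) V] [LieModule ℂ (gl I) V]

/-- The map `ℂ^κ ⊗ V → A` given by multiplication. -/
noncomputable def vecMap (y : κ → PolyAlg J) (φ : V →ₗ[ℂ] PolyAlg J) :
    VecTensor σ V →ₗ[ℂ] PolyAlg J where
  toFun w := ∑ b, y b * φ (w b)
  map_add' v w := by
    simp only [vecTensor_add, map_add, mul_add, Finset.sum_add_distrib]
  map_smul' r w := by
    simp only [vecTensor_smul, map_smul, mul_smul_comm, Finset.smul_sum, RingHom.id_apply]

theorem vecMap_apply (y : κ → PolyAlg J) (φ : V →ₗ[ℂ] PolyAlg J) (w : VecTensor σ V) :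
    vecMap σ y φ w = ∑ b, y b * φ (w b) := rfl

/-- The vector `e_b ⊗ v`. -/
def vecSingle (b : κ) (v : V) : VecTensor σ V := (Pi.single b v : κ → V)

theorem vecSingle_same (b : κ) (v : V) : vecSingle σ b v b = v :=
  Pi.single_eq_same (M := fun _ => V) b v

theorem vecSingle_of_ne {b c : κ} (hc : c ≠ b) (v : V) : vecSingle σ b v c = 0 :=
  Pi.single_eq_of_ne (M := fun _ => V) hc v

theorem vecMap_single (y : κ → PolyAlg J) (φ : V →ₗ[ℂ] PolyAlg J) (b : κ) (v : V) :
    vecMap σ y φ (vecSingle σ b v) = y b * φ v := by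
  rw [vecMap_apply, Finset.sum_eq_single b]
  · rw [vecSingle_same]
  · intro c _ hc
    rw [vecSingle_of_ne _ hc, map_zero, mul_zero]
  · simp

/-- For s = 0 the operators are derivations, and the Leibniz rule is the action on a tensor product.
-/
theorem vecMap_lie {y : κ → PolyAlg J} {φ : V →ₗ[ℂ] PolyAlg J}
    (hy : ∀ X b, glDer (glIncl h X) (y b) = ∑ c, σ X c b • y c)
    (hφ : ∀ X v, φ ⁅X, v⁆ = inclRep h 0 X (φ v)) (X : gl I) (w : VecTensor σ V) :
    vecMap σ y φ ⁅X, w⁆ = inclRep h 0 X (vecMap σ y φ w) := by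
  simp only [vecMap_apply, vecTensor_lie, map_add, hφ, map_sum, map_smul, mul_add,
    Finset.sum_add_distrib]
  simp only [inclRep_apply, zero_smul, zero_mul, add_zero, map_sum, Derivation.leibniz,
    smul_eq_mul, Finset.sum_add_distrib, hy, Finset.mul_sum]
  congr 1
  rw [Finset.sum_comm]
  refine Finset.sum_congr rfl fun b _ => Finset.sum_congr rfl fun c _ => ?_
  rw [mul_smul_comm, mul_smul_comm, mul_comm]

end VecMap

/-- The polynomials in the image of an equivariant map from a unitary module. -/
def unitaryImages : Set (PolyAlg J) :=
  {f | ∃ (V : Type) (_ : NormedAddCommGroup V) (_ : InnerProductSpace ℂ V)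
    (_ : LieRingModule (gl I) V) (_ : LieModule ℂ (gl I) V) (_ : FiniteDimensional ℂ V)
    (_ : IsUnitaryRep I V) (φ : V →ₗ[ℂ] PolyAlg J) (_ : ∀ X v, φ ⁅X, v⁆ = inclRep h 0 X (φ v))
    (v : V), φ v = f}

theorem glIncl_isDiag (i : Fin I.card) :
    ∃ d : J → ℤ, glIncl h (glE I i i) = Matrix.diagonal fun c => (d c : ℂ) := by
  refine ⟨fun c => if c = inclIdx h i then 1 else 0, ?_⟩
  rw [glIncl_glE, ← Matrix.diagonal_single]
  congr 1
  ext c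
  by_cases hc : c = inclIdx h i
  · simp [hc]
  · simp [hc]

theorem xMat_mul_mem_unitaryImages {f : PolyAlg J} (hf : f ∈ unitaryImages h) (a b : J) :
    xMat J a b * f ∈ unitaryImages h := by
  obtain ⟨V, _, _, _, _, _, hV, φ, hφ, v, rfl⟩ := hf
  refine ⟨VecTensor (glIncl h) V, inferInstance, inferInstance, inferInstance, inferInstance,
    inferInstance, isUnitaryRep_vecTensor _ hV (glIncl_conjTranspose h) (glIncl_isDiag h),
    vecMap (glIncl h) (fun b => xMat J a b) φ, vecMap_lie h _ (fun X b => ?_) hφ,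
    vecSingle _ b v, vecMap_single _ _ _ _ _⟩
  rw [glDer_xMat, xMul_eq_sum]

/-- Constants come from the trivial module, and multiplying by x_ab keeps the image unitary: for
fixed a the row x_a· carries the representation of gl(I) on ℂ^J. The x_ab and the constants generate
all polynomials. -/
theorem span_unitaryImages : Submodule.span ℂ (unitaryImages h) = ⊤ := by
  rw [eq_top_iff]
  intro f _
  have hmul : ∀ a b : J, ∀ p ∈ Submodule.span ℂ (unitaryImages h),
      xMat J a b * p ∈ Submodule.span ℂ (unitaryImages h) := by
    intro a b p hp
    induction hp using Submodule.span_induction with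
    | mem p hp => exact Submodule.subset_span (xMat_mul_mem_unitaryImages h hp a b)
    | zero => rw [mul_zero]; exact Submodule.zero_mem _
    | add p q _ _ hp hq => rw [mul_add]; exact Submodule.add_mem _ hp hq
    | smul r p _ hp => rw [mul_smul_comm]; exact Submodule.smul_mem _ _ hp
  induction f using MvPolynomial.induction_on with
  | C c =>
    refine Submodule.subset_span ⟨TrivRep I, inferInstance, inferInstance, inferInstance,
      inferInstance, inferInstance, isUnitaryRep_trivRep,
      trivMap, fun X v => ?_, (c : ℂ), rfl⟩
    rw [trivRep_lie, map_zero, inclRep_apply, zero_smul, zero_mul, add_zero]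
    exact (Derivation.map_algebraMap _ _).symm
  | add p q hp hq => exact Submodule.add_mem _ (hp trivial) (hq trivial)
  | mul_X p i hp =>
    obtain ⟨a, b⟩ := i
    have e : p * MvPolynomial.X (a, b) =
        xMat J a b * p - (if a = b then (1 : ℂ) else 0) • p := by
      by_cases hab : a = b
      · subst hab; simp [xMat]; ring
      · simp [xMat, hab]; ring
    rw [e]
    exact Submodule.sub_mem _ (hmul a b p (hp trivial)) (Submodule.smul_mem _ _ (hp trivial))

/-- The matrix `g_k(F)` over `U(gl(I))`. -/
noncomputable def gMat (k : ℕ) (I : Finset ℕ) : Matrix (Fin I.card) (Fin I.card) (Ugl I) :=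
  Polynomial.aeval (Fmat I) (gPoly k)

theorem aeval_Fop {V : Type} [NormedAddCommGroup V] [InnerProductSpace ℂ V]
    [LieRingModule (gl I) V] [LieModule ℂ (gl I) V] (k : ℕ) (w : VecTensor (stdRep I) V)
    (c : Fin I.card) :
    Polynomial.aeval (Fop I V) (gPoly k) w c =
      ∑ b, UniversalEnvelopingAlgebra.lift ℂ (LieModule.toEnd ℂ (gl I) V) (gMat k I c b) (w b) := by
  have e : Polynomial.aeval (Fop I V) (gPoly k) =
      matOp (UniversalEnvelopingAlgebra.lift ℂ (LieModule.toEnd ℂ (gl I) V)) (gMat k I) :=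
    Polynomial.aeval_algHom_apply
      (matOp (UniversalEnvelopingAlgebra.lift ℂ (LieModule.toEnd ℂ (gl I) V))) (Fmat I) (gPoly k)
  rw [e]
  exact matOp_apply _ _ _ _

/-- The coproduct formula for left-invariant differential operators. -/
theorem inclAct_zero_xMat_mul {k : ℕ} {z : Ugl I}
    (hz : CorrespondsTo I z (shiftedPowerSum I.card k)) (a : J) (b : Fin I.card) (H : PolyAlg J) :
    inclAct h 0 z (xMat J a (inclIdx h b) * H) = xMat J a (inclIdx h b) * inclAct h 0 z H +
      ∑ c, xMat J a (inclIdx h c) * inclAct h 0 (gMat k I c b) H := by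
  have hH : H ∈ Submodule.span ℂ (unitaryImages h) := span_unitaryImages h ▸ Submodule.mem_top
  induction hH using Submodule.span_induction with
  | zero => simp
  | add p q _ _ hp hq =>
    simp only [mul_add, map_add, hp, hq, Finset.sum_add_distrib]; ring
  | smul r p _ hp =>
    simp only [mul_smul_comm, map_smul, hp, smul_add, Finset.smul_sum]
  | mem H hH =>
    obtain ⟨V, _, _, _, _, _, hV, φ, hφ, v, rfl⟩ := hH
    have hφ' : ∀ z v, φ (UniversalEnvelopingAlgebra.lift ℂ (LieModule.toEnd ℂ (gl I) V) z v) =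
        inclAct h 0 z (φ v) := lift_equivariant (ρ := LieModule.toEnd ℂ (gl I) V) φ hφ
    -- Transport of `stdTensor_act` along e_b ⊗ v ↦ x_ab φ(v).
    have h1 := lift_equivariant
      (ρ := LieModule.toEnd ℂ (gl I) (VecTensor (stdRep I) V)) (ρ' := inclRep h 0)
      (vecMap (stdRep I) (fun b => xMat J a (inclIdx h b)) φ)
      (vecMap_lie h _ (fun X b => by rw [glDer_xMat, xMul_glIncl]) hφ) z
      (vecSingle _ b v)
    rw [stdTensor_act hV hz, map_add, vecMap_single] at h1
    change _ = inclAct h 0 z _ at h1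
    rw [← h1, vecMap_apply, vecMap_apply]
    congr 1
    · rw [Finset.sum_eq_single b]
      · rw [compOp_apply, hφ', vecSingle_same]
      · intro c _ hc
        rw [compOp_apply, hφ', vecSingle_of_ne _ hc, map_zero, map_zero, mul_zero]
      · simp
    · refine Finset.sum_congr rfl fun c _ => ?_
      rw [aeval_Fop, Finset.sum_eq_single b, vecSingle_same, hφ']
      · intro d _ hd
        rw [vecSingle_of_ne _ hd, map_zero]
      · simp

end Incl

/-! ### Twisting by the character -/

/-- The ideal of polynomials without constant term. -/
noncomputable def augIdeal (J : Finset ℕ) : Ideal (PolyAlg J) :=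
  RingHom.ker (MvPolynomial.constantCoeff (R := ℂ) (σ := J × J))

theorem derivation_mem_pow {R A : Type*} [CommRing R] [CommRing A] [Algebra R A] (D : Derivation R A A)
    (I : Ideal A) (n : ℕ) : ∀ f ∈ I ^ n, D f ∈ I ^ (n - 1) := by
  induction n with
  | zero => intro f _; simp
  | succ n ih =>
    intro f hf
    rw [pow_succ] at hf
    rw [Nat.add_sub_cancel]
    induction hf using Submodule.mul_induction_on' with
    | mem_mul_mem a ha b hb =>
      rw [Derivation.leibniz, smul_eq_mul, smul_eq_mul]
      refine Ideal.add_mem _ (Ideal.mul_mem_right _ _ ha) ?_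
      rcases n with _ | n
      · simp
      · rw [pow_succ']
        exact Ideal.mul_mem_mul hb (ih a ha)
    | add a _ b _ ha hb =>
      rw [map_add]
      exact Ideal.add_mem _ ha hb

/-- The trace of the matrix `u`. -/
noncomputable def uTrace (J : Finset ℕ) : PolyAlg J := ∑ a, MvPolynomial.X (a, a)

theorem uTrace_mem (J : Finset ℕ) : uTrace J ∈ augIdeal J := by
  simp [augIdeal, RingHom.mem_ker, uTrace]

theorem glDer_uTrace {J : Finset ℕ} (X : gl J) : glDer X (uTrace J) = (xMul X).trace := by
  rw [uTrace, map_sum]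
  exact Finset.sum_congr rfl fun a _ => glDer_X X a a

/-- The truncation of `exp (s tr u)` in degree `m`. -/
noncomputable def truncExp (J : Finset ℕ) (s : ℂ) (m : ℕ) : PolyAlg J :=
  ∑ i ∈ Finset.range (m + 1), (s ^ i / (i.factorial : ℂ)) • uTrace J ^ i

theorem truncExp_succ (J : Finset ℕ) (s : ℂ) (m : ℕ) : truncExp J s (m + 1) =
    truncExp J s m + (s ^ (m + 1) / ((m + 1).factorial : ℂ)) • uTrace J ^ (m + 1) :=
  Finset.sum_range_succ _ _

theorem truncExp_zero (J : Finset ℕ) (s : ℂ) : truncExp J s 0 = 1 := by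
  simp [truncExp]

theorem glDer_truncExp_succ {J : Finset ℕ} (s : ℂ) (X : gl J) (m : ℕ) :
    glDer X (truncExp J s (m + 1)) = s • (xMul X).trace * truncExp J s m := by
  have hterm : ∀ i : ℕ, glDer X ((s ^ (i + 1) / ((i + 1).factorial : ℂ)) • uTrace J ^ (i + 1)) =
      s • (xMul X).trace * ((s ^ i / (i.factorial : ℂ)) • uTrace J ^ i) := by
    intro i
    rw [Derivation.map_smul, Derivation.leibniz_pow, glDer_uTrace, Nat.add_sub_cancel,
      ← Nat.cast_smul_eq_nsmul ℂ, smul_smul, smul_eq_mul, smul_mul_assoc, mul_smul_comm, smul_smul,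
      mul_comm (uTrace J ^ i)]
    congr 1
    have : (i.factorial : ℂ) ≠ 0 := by exact_mod_cast i.factorial_ne_zero
    have : ((i : ℂ) + 1) ≠ 0 := by exact_mod_cast i.succ_ne_zero
    rw [Nat.factorial_succ]
    push_cast
    field_simp
    ring
  induction m with
  | zero => rw [truncExp_succ, map_add, hterm, truncExp_zero]; simp
  | succ m ih => rw [truncExp_succ, map_add, ih, hterm, ← mul_add, ← truncExp_succ]

theorem glDer_truncExp_sub_mem {J : Finset ℕ} (s : ℂ) (X : gl J) (m : ℕ) :
    glDer X (truncExp J s m) - s • (xMul X).trace * truncExp J s m ∈ augIdeal J ^ m := by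
  rcases m with _ | m
  · simp
  · rw [glDer_truncExp_succ, truncExp_succ, ← mul_sub, sub_add_cancel_left]
    refine Ideal.mul_mem_left _ _ (Submodule.neg_mem _ ?_)
    exact Submodule.smul_of_tower_mem _ _ (Ideal.pow_mem_pow (uTrace_mem J) _)

/-! ### From s = 0 to general s by truncated exponentials -/

section Incl

variable {I J : Finset ℕ} (h : I ⊆ J)

/-- For s ≠ 0 the action is the one for s = 0 conjugated by exp(s tr u), which is not a polynomial.
An element of U(gl(I)) acts by a differential operator of some finite order d, so it lowers the adic
order at u = 0 by at most d, and a truncation in degree m conjugates correctly modulo order m - d.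
-/
theorem exists_order_inclAct (s : ℂ) (z : Ugl I) : ∃ d : ℕ,
    (∀ n, ∀ f ∈ augIdeal J ^ n, inclAct h 0 z f ∈ augIdeal J ^ (n - d)) ∧
      ∀ m f, inclAct h 0 z (truncExp J s m * f) - truncExp J s m * inclAct h s z f ∈
        augIdeal J ^ (m - d) := by
  let S : Subalgebra ℂ (Ugl I) :=
    { carrier := {z | ∃ d : ℕ,
        (∀ n, ∀ f ∈ augIdeal J ^ n, inclAct h 0 z f ∈ augIdeal J ^ (n - d)) ∧
          ∀ m f, inclAct h 0 z (truncExp J s m * f) - truncExp J s m * inclAct h s z f ∈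
            augIdeal J ^ (m - d)}
      mul_mem' := by
        rintro a b ⟨d, h1, h2⟩ ⟨d', h1', h2'⟩
        refine ⟨d' + d, fun n f hf => ?_, fun m f => ?_⟩
        · rw [map_mul, Module.End.mul_apply, ← Nat.sub_sub]
          exact h1 _ _ (h1' _ _ hf)
        · have e : inclAct h 0 (a * b) (truncExp J s m * f) -
              truncExp J s m * inclAct h s (a * b) f =
              inclAct h 0 a (inclAct h 0 b (truncExp J s m * f) -
                truncExp J s m * inclAct h s b f) +
              (inclAct h 0 a (truncExp J s m * inclAct h s b f) -
                truncExp J s m * inclAct h s a (inclAct h s b f)) := by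
            simp only [map_mul, Module.End.mul_apply, map_sub]
            ring
          rw [e]
          refine Ideal.add_mem _ ?_ ?_
          · rw [← Nat.sub_sub]
            exact h1 _ _ (h2' m f)
          · exact Ideal.pow_le_pow_right (by omega) (h2 m _)
      add_mem' := by
        rintro a b ⟨d, h1, h2⟩ ⟨d', h1', h2'⟩
        refine ⟨d' + d, fun n f hf => ?_, fun m f => ?_⟩
        · rw [map_add, LinearMap.add_apply]
          exact Ideal.add_mem _ (Ideal.pow_le_pow_right (by omega) (h1 _ _ hf))
            (Ideal.pow_le_pow_right (by omega) (h1' _ _ hf))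
        · have e := Ideal.add_mem _ (Ideal.pow_le_pow_right (show m - (d' + d) ≤ m - d by omega)
            (h2 m f)) (Ideal.pow_le_pow_right (show m - (d' + d) ≤ m - d' by omega) (h2' m f))
          rw [map_add, LinearMap.add_apply, map_add, LinearMap.add_apply, mul_add]
          convert e using 1
          ring
      algebraMap_mem' := by
        intro c
        refine ⟨0, fun n f hf => ?_, fun m f => ?_⟩
        · rw [AlgHom.commutes, Module.algebraMap_end_apply]
          exact Submodule.smul_of_tower_mem _ _ hf
        · rw [AlgHom.commutes, Module.algebraMap_end_apply, AlgHom.commutes,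
            Module.algebraMap_end_apply, mul_smul_comm, sub_self]
          exact Ideal.zero_mem _ }
  refine mem_of_forall_ι_mem S (fun X => ⟨1, fun n f hf => ?_, fun m f => ?_⟩) z
  · rw [inclAct_ι, inclRep_apply, zero_smul, zero_mul, add_zero]
    exact derivation_mem_pow _ _ _ _ hf
  · rw [inclAct_ι, inclAct_ι, inclRep_apply, inclRep_apply, zero_smul, zero_mul, add_zero,
      Derivation.leibniz, smul_eq_mul, smul_eq_mul]
    have e := Ideal.mul_mem_left _ f (glDer_truncExp_sub_mem s (glIncl h X) m)
    refine Ideal.pow_le_pow_right (Nat.sub_le m 1) ?_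
    convert e using 1
    ring

/-- The truncations are 1 modulo the augmentation ideal, so they can be removed one power at a time;
Krull's intersection theorem then forces f = 0. -/
theorem eq_zero_of_truncExp_mul_mem {s : ℂ} {f : PolyAlg J} {d : ℕ}
    (hf : ∀ m, truncExp J s m * f ∈ augIdeal J ^ (m - d)) : f = 0 := by
  have h1 : ∀ m, truncExp J s m - 1 ∈ augIdeal J := by
    intro m
    induction m with
    | zero => rw [truncExp_zero, sub_self]; exact Ideal.zero_mem _
    | succ m ih =>
      rw [truncExp_succ, add_sub_right_comm]
      refine Ideal.add_mem _ ih (Submodule.smul_of_tower_mem _ _ ?_)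
      exact Ideal.pow_mem_of_mem _ (uTrace_mem J) _ (Nat.succ_pos m)
  have h2 : ∀ n, f ∈ augIdeal J ^ n := by
    intro n
    have : ∀ j ≤ n, f ∈ augIdeal J ^ j := by
      intro j
      induction j with
      | zero => intro _; simp
      | succ j ih =>
        intro hj
        have e : f = truncExp J s (n + d) * f - (truncExp J s (n + d) - 1) * f := by ring
        rw [e]
        refine Ideal.sub_mem _ (Ideal.pow_le_pow_right (by omega) (hf (n + d))) ?_
        rw [pow_succ']
        exact Ideal.mul_mem_mul (h1 _) (ih (by omega))
    exact this n le_rfl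
  have h3 : f ∈ ⨅ n, augIdeal J ^ n := Ideal.mem_iInf.2 h2
  rw [Ideal.iInf_pow_eq_bot_of_isDomain _ ?_] at h3
  · exact h3
  · intro ht
    have : (1 : PolyAlg J) ∈ augIdeal J := ht ▸ Submodule.mem_top
    simp [augIdeal, RingHom.mem_ker] at this

/-- The coproduct formula for the operators twisted by the character. -/
theorem inclAct_xMat_mul (s : ℂ) {k : ℕ} {z : Ugl I}
    (hz : CorrespondsTo I z (shiftedPowerSum I.card k)) (a : J) (b : Fin I.card) (H : PolyAlg J) :
    inclAct h s z (xMat J a (inclIdx h b) * H) = xMat J a (inclIdx h b) * inclAct h s z H +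
      ∑ c, xMat J a (inclIdx h c) * inclAct h s (gMat k I c b) H := by
  choose d hd1 hd2 using exists_order_inclAct h s
  set x := xMat J a (inclIdx h b)
  have key : ∀ m, ∀ w : Ugl I, ∀ D, d w ≤ D → ∀ f,
      inclAct h 0 w (truncExp J s m * f) - truncExp J s m * inclAct h s w f ∈
        augIdeal J ^ (m - D) := fun m w D hD f =>
    Ideal.pow_le_pow_right (by omega) (hd2 w m f)
  rw [← sub_eq_zero]
  -- The sum of the orders of all operators in the identity dominates each of them.
  refine eq_zero_of_truncExp_mul_mem (s := s) (d := d z + ∑ c, d (gMat k I c b)) fun m => ?_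
  set D := d z + ∑ c, d (gMat k I c b)
  have hc : ∀ c, d (gMat k I c b) ≤ D := fun c =>
    (Finset.single_le_sum (f := fun c => d (gMat k I c b)) (fun _ _ => Nat.zero_le _)
      (Finset.mem_univ c)).trans (Nat.le_add_left _ _)
  have m1 := key m z D (Nat.le_add_right _ _) (x * H)
  have m2 := Ideal.mul_mem_left _ x (key m z D (Nat.le_add_right _ _) H)
  have m3 := Ideal.sum_mem (augIdeal J ^ (m - D)) (t := Finset.univ)
    (f := fun c => xMat J a (inclIdx h c) * (inclAct h 0 (gMat k I c b) (truncExp J s m * H) -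
      truncExp J s m * inclAct h s (gMat k I c b) H))
    fun c _ => Ideal.mul_mem_left _ _ (key m (gMat k I c b) D (hc c) H)
  have m4 := Ideal.sub_mem _ (Ideal.add_mem _ m2 m3) m1
  convert m4 using 1
  have e := inclAct_zero_xMat_mul h hz a b (truncExp J s m * H)
  have e' : truncExp J s m * (x * H) = x * (truncExp J s m * H) := by ring
  rw [e', e]
  simp only [mul_sub, mul_add, Finset.sum_sub_distrib, Finset.mul_sum]
  have e2 : ∀ c, xMat J a (inclIdx h c) * (truncExp J s m * inclAct h s (gMat k I c b) H) =
      truncExp J s m * (xMat J a (inclIdx h c) * inclAct h s (gMat k I c b) H) := fun c => by ring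
  simp only [e2]
  ring

/-- The vector fields of gl(I) change only the columns in I, so x_ab with b ∉ I behaves as a
constant. -/
theorem inclAct_xMat_mul_of_notMem (s : ℂ) (z : Ugl I) (a : J) {b : J} (hb : (b : ℕ) ∉ I)
    (H : PolyAlg J) :
    inclAct h s z (xMat J a b * H) = xMat J a b * inclAct h s z H := by
  let S : Subalgebra ℂ (Ugl I) :=
    { carrier := {z | ∀ H, inclAct h s z (xMat J a b * H) = xMat J a b * inclAct h s z H}
      mul_mem' := by
        intro p q hp hq H
        rw [map_mul (inclAct h s), Module.End.mul_apply, hq, hp, Module.End.mul_apply]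
      add_mem' := by
        intro p q hp hq H
        rw [map_add, LinearMap.add_apply, hq, hp, LinearMap.add_apply, mul_add]
      algebraMap_mem' := by
        intro c H
        rw [AlgHom.commutes, Module.algebraMap_end_apply, Module.algebraMap_end_apply,
          mul_smul_comm] }
  refine mem_of_forall_ι_mem S (fun X H => ?_) z H
  rw [inclAct_ι, inclRep_apply, inclRep_apply, Derivation.leibniz, glDer_xMat,
    xMul_glIncl_of_notMem h X a hb, smul_zero, add_zero, smul_eq_mul]
  ring

end Incl

/-! ### An exact formula for the covariance -/

/-- The infinitesimal left translations, acting on polynomials. -/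
noncomputable def transDer {J : Finset ℕ} (p j : J) : Derivation ℂ (PolyAlg J) (PolyAlg J) :=
  ∑ b, xMat J j b • MvPolynomial.pderiv (p, b)

theorem transDer_apply {J : Finset ℕ} (p j : J) (f : PolyAlg J) :
    transDer p j f = ∑ b, xMat J j b * MvPolynomial.pderiv (p, b) f := by
  have e := congrFun (map_sum (Derivation.coeFnAddMonoidHom (R := ℂ) (A := PolyAlg J)
    (M := PolyAlg J)) (fun b => xMat J j b • MvPolynomial.pderiv (p, b)) Finset.univ) f
  rw [Finset.sum_apply] at e
  exact e

theorem transDer_X {J : Finset ℕ} (p j a b : J) :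
    transDer p j (MvPolynomial.X (a, b)) = if a = p then xMat J j b else 0 := by
  rw [transDer_apply]
  simp only [MvPolynomial.pderiv_X, Pi.single_apply, Prod.mk.injEq]
  by_cases h : a = p <;> simp [h]

theorem transDer_xMat {J : Finset ℕ} (p j a b : J) :
    transDer p j (xMat J a b) = if a = p then xMat J j b else 0 := by
  have h : transDer p j ((1 : Matrix J J (PolyAlg J)) a b) = 0 := by
    by_cases hab : a = b
    · subst hab; simp
    · simp [hab]
  rw [← transDer_X]
  simp [xMat, h]

theorem transDer_xMul {J : Finset ℕ} (X : gl J) (p j a b : J) :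
    transDer p j (xMul X a b) = if a = p then xMul X j b else 0 := by
  rw [xMul_eq_sum, map_sum, xMul_eq_sum]
  simp only [Derivation.map_smul, transDer_xMat]
  by_cases h : a = p <;> simp [h]

/-- Left and right multiplications of the matrix x commute; on coordinates this is immediate, and
derivations are determined there. -/
theorem transDer_glDer {J : Finset ℕ} (X : gl J) (p j : J) (f : PolyAlg J) :
    transDer p j (glDer X f) = glDer X (transDer p j f) := by
  have h : ⁅transDer p j, glDer X⁆ = 0 := by
    apply MvPolynomial.derivation_ext
    rintro ⟨a, b⟩
    rw [Derivation.commutator_apply, glDer_X, transDer_X, transDer_xMul]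
    by_cases h : a = p <;> simp [h, glDer_xMat]
  have h1 : ⁅transDer p j, glDer X⁆ f = 0 := by rw [h]; rfl
  rw [Derivation.commutator_apply] at h1
  exact sub_eq_zero.1 h1

/-- The infinitesimal left translations, twisted by the character. -/
noncomputable def transOp {J : Finset ℕ} (s : ℂ) (p j : J) : PolyAlg J →ₗ[ℂ] PolyAlg J :=
  (transDer p j).toLinearMap + LinearMap.mulLeft ℂ (s • xMat J j p)

theorem transOp_apply {J : Finset ℕ} (s : ℂ) (p j : J) (f : PolyAlg J) :
    transOp s p j f = transDer p j f + s • xMat J j p * f := rfl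

/-! ### The gradient of D(p_k)1 -/

section Incl

variable {I J : Finset ℕ} (h : I ⊆ J)

theorem transOp_inclAct (s : ℂ) (p j : J) (z : Ugl I) (f : PolyAlg J) :
    transOp s p j (inclAct h s z f) = inclAct h s z (transOp s p j f) := by
  refine lift_equivariant (ρ := inclRep h s) (ρ' := inclRep h s) (transOp s p j)
    (fun X f => ?_) z f
  have ht : transDer p j (xMul (glIncl h X)).trace = xMul (glIncl h X) j p := by
    simp [Matrix.trace, map_sum, transDer_xMul]
  simp only [inclRep_apply, transOp_apply, map_add, transDer_glDer, Derivation.leibniz,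
    Derivation.map_smul, smul_eq_mul, ht, glDer_xMat]
  ring

theorem det_xMat_ne_zero (J : Finset ℕ) : (xMat J).det ≠ 0 := by
  intro h0
  have h1 : (MvPolynomial.constantCoeff (R := ℂ)).mapMatrix (xMat J) = 1 := by
    ext a b
    by_cases hab : a = b
    · subst hab; simp [xMat]
    · simp [xMat, hab]
  have h2 := RingHom.map_det (MvPolynomial.constantCoeff (R := ℂ)) (xMat J)
  rw [h1, h0, map_zero, Matrix.det_one] at h2
  exact zero_ne_one h2

/-- The polynomial det x is 1 at u = 0, hence nonzero, and the polynomial ring is a domain. -/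
theorem eq_zero_of_xMat_mulVec {J : Finset ℕ} {v : J → PolyAlg J}
    (hv : ∀ j, ∑ q, xMat J j q * v q = 0) : v = 0 :=
  Matrix.eq_zero_of_mulVec_eq_zero (det_xMat_ne_zero J) (funext hv)

/-- The projection onto the coordinates in `S`, as a matrix of polynomials. -/
noncomputable def projMat (S J : Finset ℕ) : Matrix J J (PolyAlg J) :=
  Matrix.diagonal fun j => if (j : ℕ) ∈ S then 1 else 0

theorem projMat_mul_apply (S J : Finset ℕ) (R : Matrix J J (PolyAlg J)) (j p : J) :
    (projMat S J * R) j p = if (j : ℕ) ∈ S then R j p else 0 := by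
  rw [projMat, Matrix.diagonal_mul]
  split_ifs <;> simp

/-- The operator `F` on matrices of polynomials. -/
noncomputable def matF (I J : Finset ℕ) (s : ℂ) : Module.End ℂ (Matrix J J (PolyAlg J)) where
  toFun R := Matrix.of fun c p => if (c : ℕ) ∈ I then ∑ b : J, if (b : ℕ) ∈ I then
    glDer (Matrix.single b c 1) (R b p) + s • xMat J c b * R b p else 0 else 0
  map_add' R R' := by
    ext1 c p
    simp only [Matrix.of_apply, Matrix.add_apply, map_add, mul_add]
    split_ifs
    · rw [← Finset.sum_add_distrib]
      refine Finset.sum_congr rfl fun b _ => ?_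
      split_ifs
      · ring
      · simp
    · simp
  map_smul' r R := by
    ext1 c p
    simp only [Matrix.of_apply, Matrix.smul_apply, Derivation.map_smul, RingHom.id_apply,
      Finset.smul_sum]
    split_ifs
    · rw [Finset.smul_sum]
      refine Finset.sum_congr rfl fun b _ => ?_
      split_ifs
      · rw [smul_add, mul_smul_comm]
      · simp
    · simp

theorem matF_apply (s : ℂ) (R : Matrix J J (PolyAlg J)) (c p : J) :
    matF I J s R c p = if (c : ℕ) ∈ I then ∑ b : J, if (b : ℕ) ∈ I then
      glDer (Matrix.single b c 1) (R b p) + s • xMat J c b * R b p else 0 else 0 := rfl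

theorem sum_inclIdx {M : Type*} [AddCommMonoid M] (f : J → M) :
    ∑ b : J, (if (b : ℕ) ∈ I then f b else 0) = ∑ b : Fin I.card, f (inclIdx h b) := by
  rw [← Finset.sum_filter]
  symm
  refine Finset.sum_bij (fun b _ => inclIdx h b) (fun b _ => ?_) (fun a _ b _ e => ?_)
    (fun j hj => ?_) (fun _ _ => rfl)
  · exact Finset.mem_filter.2 ⟨Finset.mem_univ _, inclIdx_mem h b⟩
  · exact inclIdx_injective h e
  · obtain ⟨b, hb⟩ := exists_inclIdx h (Finset.mem_filter.1 hj).2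
    exact ⟨b, Finset.mem_univ _, hb⟩

theorem matF_inclIdx (s : ℂ) (R : Matrix J J (PolyAlg J)) (c : Fin I.card) (p : J) :
    matF I J s R (inclIdx h c) p = ∑ b, inclAct h s (Egen I b c) (R (inclIdx h b) p) := by
  rw [matF_apply, if_pos (inclIdx_mem h c), sum_inclIdx h]
  exact Finset.sum_congr rfl fun b _ => (inclAct_Egen h s b c _).symm

theorem matF_of_notMem (s : ℂ) (R : Matrix J J (PolyAlg J)) {c : J} (hc : (c : ℕ) ∉ I) (p : J) :
    matF I J s R c p = 0 := by
  rw [matF_apply, if_neg hc]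

/-- The rows in `I` of the column `p`. -/
noncomputable def colRes (p : J) : Matrix J J (PolyAlg J) →ₗ[ℂ] (Fin I.card → PolyAlg J) where
  toFun R c := R (inclIdx h c) p
  map_add' _ _ := rfl
  map_smul' _ _ := rfl

theorem aeval_intertwine {M M' : Type*} [AddCommGroup M] [Module ℂ M] [AddCommGroup M']
    [Module ℂ M'] {F : Module.End ℂ M} {F' : Module.End ℂ M'} (φ : M →ₗ[ℂ] M')
    (hφ : ∀ x, φ (F x) = F' (φ x)) (P : Polynomial ℂ) (x : M) :
    φ (Polynomial.aeval F P x) = Polynomial.aeval F' P (φ x) := by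
  induction P using Polynomial.induction_on' with
  | add p q hp hq => simp only [map_add, LinearMap.add_apply, hp, hq]
  | monomial n a =>
    have hpow : ∀ n x, φ ((F ^ n) x) = (F' ^ n) (φ x) := by
      intro n
      induction n with
      | zero => intro x; rfl
      | succ n ih => intro x; rw [pow_succ, pow_succ, Module.End.mul_apply, ih, hφ]; rfl
    rw [Polynomial.aeval_monomial, Polynomial.aeval_monomial, Module.End.mul_apply,
      Module.End.mul_apply, Module.algebraMap_end_apply, Module.algebraMap_end_apply, map_smul, hpow]

theorem aeval_matF_inclIdx (s : ℂ) (k : ℕ) (R : Matrix J J (PolyAlg J)) (c : Fin I.card) (p : J) :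
    Polynomial.aeval (matF I J s) (gPoly k) R (inclIdx h c) p =
      ∑ b, inclAct h s (gMat k I c b) (R (inclIdx h b) p) := by
  have e := aeval_intertwine (F := matF I J s) (F' := matOp (inclAct h s) (Fmat I)) (colRes h p)
    (fun R => funext fun c => matF_inclIdx h s R c p) (gPoly k) R
  rw [Polynomial.aeval_algHom_apply (matOp (inclAct h s)) (Fmat I) (gPoly k)] at e
  exact congrFun e c

theorem aeval_matF_of_notMem (s : ℂ) (P : Polynomial ℂ) {R : Matrix J J (PolyAlg J)} {c : J}
    (hc : (c : ℕ) ∉ I) {p : J} (hR : R c p = 0) :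
    Polynomial.aeval (matF I J s) P R c p = 0 := by
  induction P using Polynomial.induction_on' with
  | add p q hp hq => rw [map_add, LinearMap.add_apply, Matrix.add_apply, hp, hq, add_zero]
  | monomial n a =>
    rw [Polynomial.aeval_monomial, Module.End.mul_apply, Module.algebraMap_end_apply,
      Matrix.smul_apply]
    rcases n with _ | n
    · rw [pow_zero, Module.End.one_apply, hR, smul_zero]
    · rw [pow_succ', Module.End.mul_apply, matF_of_notMem s _ hc, smul_zero]

/-- The derivatives of `D(p_k) 1`. -/
theorem pderiv_inclAct_one (s : ℂ) {k : ℕ} {z : Ugl I}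
    (hz : CorrespondsTo I z (shiftedPowerSum I.card k)) (p q : J) :
    MvPolynomial.pderiv (p, q) (inclAct h s z 1) =
      s • Polynomial.aeval (matF I J s) (gPoly k) (projMat I J) q p := by
  -- The twisted translation commutes with D(z) and sends 1 to s x_jp. Written out, its action on
  -- D(z)1 is x times the gradient plus the term of the character.
  have h1 : ∀ j, ∑ q, xMat J j q * MvPolynomial.pderiv (p, q) (inclAct h s z 1) +
      s • xMat J j p * inclAct h s z 1 = s • inclAct h s z (xMat J j p * 1) := by
    intro j
    rw [← transDer_apply, ← transOp_apply, transOp_inclAct, transOp_apply,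
      Derivation.map_one_eq_zero, zero_add, mul_one, map_smul, mul_one]
  have hz0 : ∀ q : J, (q : ℕ) ∉ I →
      Polynomial.aeval (matF I J s) (gPoly k) (projMat I J) q p = 0 := fun q hq =>
    aeval_matF_of_notMem s _ hq (by
      rw [projMat]
      by_cases hqp : q = p
      · subst hqp; rw [Matrix.diagonal_apply_eq, if_neg hq]
      · rw [Matrix.diagonal_apply_ne _ hqp])
  suffices h2 : ∀ j, ∑ q, xMat J j q * (MvPolynomial.pderiv (p, q) (inclAct h s z 1) -
      s • Polynomial.aeval (matF I J s) (gPoly k) (projMat I J) q p) = 0 from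
    sub_eq_zero.1 (congrFun (eq_zero_of_xMat_mulVec h2) q)
  intro j
  simp only [mul_sub, Finset.sum_sub_distrib]
  rw [eq_sub_of_add_eq (h1 j)]
  have h3 : ∑ q, xMat J j q * s • Polynomial.aeval (matF I J s) (gPoly k) (projMat I J) q p =
      ∑ c : Fin I.card, xMat J j (inclIdx h c) * s •
        ∑ b, inclAct h s (gMat k I c b) (projMat I J (inclIdx h b) p) := by
    simp only [← aeval_matF_inclIdx]
    rw [← sum_inclIdx h (fun q => xMat J j q *
      s • Polynomial.aeval (matF I J s) (gPoly k) (projMat I J) q p)]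
    refine Finset.sum_congr rfl fun q _ => ?_
    by_cases hq : (q : ℕ) ∈ I
    · rw [if_pos hq]
    · rw [if_neg hq, hz0 q hq, smul_zero, mul_zero]
  rw [h3]
  -- For p ∈ I the coproduct formula with H = 1 applies, and its first term cancels the term of the
  -- character. For p ∉ I the operator commutes with x_jp and the column p of the projection is
  -- zero.
  by_cases hp : (p : ℕ) ∈ I
  · obtain ⟨b, rfl⟩ := exists_inclIdx h hp
    rw [inclAct_xMat_mul h s hz]
    have h4 : ∀ c, ∑ b', inclAct h s (gMat k I c b') (projMat I J (inclIdx h b') (inclIdx h b)) =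
        inclAct h s (gMat k I c b) 1 := by
      intro c
      rw [Finset.sum_eq_single b]
      · rw [projMat, Matrix.diagonal_apply_eq, if_pos hp]
      · intro b' _ hb'
        rw [projMat, Matrix.diagonal_apply_ne _ (fun e => hb' (inclIdx_injective h e)), map_zero]
      · simp
    simp only [h4, smul_add, Finset.smul_sum, mul_smul_comm, smul_mul_assoc]
    ring
  · rw [inclAct_xMat_mul_of_notMem h s z j hp]
    have h4 : ∀ b', projMat I J (inclIdx h b') p = 0 := fun b' => by
      rw [projMat, Matrix.diagonal_apply_ne]
      rintro rfl
      exact hp (inclIdx_mem h b')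
    simp [h4]

end Incl

/-! ### Euler's formula and the exact covariance -/

/-- The operator dividing the part of degree `n` by `n + 1`. -/
noncomputable def radialInt (σ : Type*) : MvPolynomial σ ℂ →ₗ[ℂ] MvPolynomial σ ℂ :=
  (MvPolynomial.basisMonomials σ ℂ).constr ℂ fun m =>
    MvPolynomial.monomial m ((m.degree : ℂ) + 1)⁻¹

theorem radialInt_monomial {σ : Type*} (m : σ →₀ ℕ) (a : ℂ) :
    radialInt σ (MvPolynomial.monomial m a) =
      MvPolynomial.monomial m (a * ((m.degree : ℂ) + 1)⁻¹) := by
  have h1 : radialInt σ (MvPolynomial.monomial m 1) =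
      MvPolynomial.monomial m ((m.degree : ℂ) + 1)⁻¹ := by
    have := (MvPolynomial.basisMonomials σ ℂ).constr_basis ℂ (fun m =>
      MvPolynomial.monomial m ((m.degree : ℂ) + 1)⁻¹) m
    rwa [MvPolynomial.coe_basisMonomials] at this
  have h2 : MvPolynomial.monomial m a = a • MvPolynomial.monomial m (1 : ℂ) := by
    rw [MvPolynomial.smul_monomial, smul_eq_mul, mul_one]
  rw [h2, map_smul, h1, MvPolynomial.smul_monomial, smul_eq_mul]

theorem radialInt_of_isHomogeneous {σ : Type*} {f : MvPolynomial σ ℂ} {n : ℕ}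
    (hf : f.IsHomogeneous n) : radialInt σ f = ((n : ℂ) + 1)⁻¹ • f := by
  conv_lhs => rw [f.as_sum]
  conv_rhs => rw [f.as_sum]
  rw [map_sum, Finset.smul_sum]
  refine Finset.sum_congr rfl fun m hm => ?_
  have hd : m.degree = n := by
    rw [Finsupp.degree_eq_weight_one]
    exact hf (MvPolynomial.mem_support_iff.1 hm)
  rw [radialInt_monomial, MvPolynomial.smul_monomial, hd, smul_eq_mul, mul_comm]

/-- Since `radialInt` is g ↦ ∫₀¹ g(tu) dt, this is f(u) - f(0) = Σ u_p ∫₀¹ (∂_p f)(tu) dt. On a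
monomial of degree n it says that Σ u_p ∂_p multiplies by n. -/
theorem sum_X_mul_radialInt_pderiv {σ : Type*} [Fintype σ] (f : MvPolynomial σ ℂ) :
    ∑ p, MvPolynomial.X p * radialInt σ (MvPolynomial.pderiv p f) =
      f - MvPolynomial.C (MvPolynomial.constantCoeff f) := by
  classical
  induction f using MvPolynomial.induction_on' with
  | add p q hp hq => simp only [map_add, mul_add, Finset.sum_add_distrib, hp, hq]; ring
  | monomial m a =>
    have hterm : ∀ p, MvPolynomial.X p *
        radialInt σ (MvPolynomial.pderiv p (MvPolynomial.monomial m a)) =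
        MvPolynomial.monomial m (a * m p * (m.degree : ℂ)⁻¹) := by
      intro p
      rw [MvPolynomial.pderiv_monomial, radialInt_monomial]
      by_cases hp : m p = 0
      · simp [hp]
      · have hle : Finsupp.single p 1 ≤ m := by
          rw [Finsupp.single_le_iff]; omega
        have hm : Finsupp.single p 1 + (m - Finsupp.single p 1) = m := add_tsub_cancel_of_le hle
        have hd : ((m - Finsupp.single p 1).degree : ℂ) + 1 = m.degree := by
          conv_rhs => rw [← hm]
          rw [map_add, Finsupp.degree_single]
          push_cast; ring
        rw [hd]
        rw [MvPolynomial.X, MvPolynomial.monomial_mul, hm, one_mul]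
    rw [Finset.sum_congr rfl fun p _ => hterm p, ← map_sum, MvPolynomial.constantCoeff_monomial]
    by_cases hm : m = 0
    · subst hm; simp
    · rw [if_neg hm, map_zero, sub_zero]
      congr 1
      have hd : (m.degree : ℂ) ≠ 0 := by
        rw [Nat.cast_ne_zero, Ne, Finsupp.degree_eq_zero_iff]; exact hm
      rw [← Finset.sum_mul, ← Finset.mul_sum]
      have : ∑ p, (m p : ℂ) = m.degree := by
        rw [Finsupp.degree_eq_sum]; push_cast; rfl
      rw [this, mul_assoc, mul_inv_cancel₀ hd, mul_one]

/-- Entrywise `radialInt`. -/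
noncomputable def matInt (J : Finset ℕ) :
    Matrix J J (PolyAlg J) →ₗ[ℂ] Matrix J J (PolyAlg J) where
  toFun R := R.map (radialInt (J × J))
  map_add' R R' := by ext1 a b; simp
  map_smul' r R := by ext1 a b; simp

theorem matInt_apply {J : Finset ℕ} (R : Matrix J J (PolyAlg J)) (a b : J) :
    matInt J R a b = radialInt (J × J) (R a b) := rfl

/-- The vacuum expectation of the trace over `I`. -/
noncomputable def vacTrace (I J : Finset ℕ) : Matrix J J (PolyAlg J) →ₗ[ℂ] ℂ where
  toFun R := ∑ j : J, if (j : ℕ) ∈ I then MvPolynomial.constantCoeff (R j j) else 0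
  map_add' R R' := by
    rw [← Finset.sum_add_distrib]
    refine Finset.sum_congr rfl fun j _ => ?_
    split_ifs <;> simp
  map_smul' r R := by
    rw [RingHom.id_apply, Finset.smul_sum]
    refine Finset.sum_congr rfl fun j _ => ?_
    split_ifs <;> simp [MvPolynomial.smul_eq_C_mul]

theorem vacTrace_apply {I J : Finset ℕ} (R : Matrix J J (PolyAlg J)) :
    vacTrace I J R = ∑ j : J, if (j : ℕ) ∈ I then MvPolynomial.constantCoeff (R j j) else 0 := rfl

/-- Write f as its constant term plus Σ u_ab H_ab by Euler's formula, with u_ab = x_ab - δ_ab. At u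
= 0 the first term of the coproduct formula cancels against δ_ab, so only the terms with g_k(F)
remain. Columns outside I contribute nothing. -/
theorem constantCoeff_inclAct {I J : Finset ℕ} (h : I ⊆ J) (s : ℂ) {k : ℕ} {z : Ugl I}
    (hz : CorrespondsTo I z (shiftedPowerSum I.card k)) (f : PolyAlg J) :
    MvPolynomial.constantCoeff (inclAct h s z f) =
      MvPolynomial.constantCoeff f * MvPolynomial.constantCoeff (inclAct h s z 1) +
      ∑ c, ∑ b, MvPolynomial.constantCoeff (inclAct h s (gMat k I c b)
        (radialInt (J × J) (MvPolynomial.pderiv (inclIdx h c, inclIdx h b) f))) := by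
  have hx : ∀ a b : J, MvPolynomial.constantCoeff (xMat J a b) = if a = b then 1 else 0 := by
    intro a b
    by_cases hab : a = b
    · subst hab; simp [xMat]
    · simp [xMat, hab]
  have hu : ∀ (a b : J) (H : PolyAlg J), MvPolynomial.X (a, b) * H =
      xMat J a b * H - (if a = b then (1 : ℂ) else 0) • H := by
    intro a b H
    by_cases hab : a = b
    · subst hab; simp [xMat]; ring
    · simp [xMat, hab]
  have h1 : ∀ (a b : J) (H : PolyAlg J), (b : ℕ) ∉ I →
      MvPolynomial.constantCoeff (inclAct h s z (MvPolynomial.X (a, b) * H)) = 0 := by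
    intro a b H hb
    rw [hu, map_sub, inclAct_xMat_mul_of_notMem h s z a hb, map_smul, map_sub, map_mul, hx,
      MvPolynomial.smul_eq_C_mul, map_mul, MvPolynomial.constantCoeff_C, sub_self]
  have h2 : ∀ (a : J) (b : Fin I.card) (H : PolyAlg J),
      MvPolynomial.constantCoeff (inclAct h s z (MvPolynomial.X (a, inclIdx h b) * H)) =
      ∑ c, (if a = inclIdx h c then
        MvPolynomial.constantCoeff (inclAct h s (gMat k I c b) H) else 0) := by
    intro a b H
    rw [hu, map_sub, inclAct_xMat_mul h s hz, map_smul, map_sub, map_add, map_mul, hx,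
      MvPolynomial.smul_eq_C_mul, map_mul, MvPolynomial.constantCoeff_C, add_sub_cancel_left,
      map_sum]
    exact Finset.sum_congr rfl fun c _ => by rw [map_mul, hx]; split_ifs <;> simp
  have h0 : f = MvPolynomial.constantCoeff f • (1 : PolyAlg J) +
      ∑ a, ∑ b, MvPolynomial.X (a, b) *
        radialInt (J × J) (MvPolynomial.pderiv (a, b) f) := by
    rw [← Fintype.sum_prod_type (fun p : J × J => MvPolynomial.X p *
      radialInt (J × J) (MvPolynomial.pderiv p f)), sum_X_mul_radialInt_pderiv,
      MvPolynomial.smul_eq_C_mul]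
    ring
  conv_lhs => rw [h0]
  rw [map_add, map_add, map_smul, MvPolynomial.smul_eq_C_mul, map_mul,
    MvPolynomial.constantCoeff_C]
  congr 1
  simp only [map_sum]
  have h3 : ∀ a : J, ∑ b, MvPolynomial.constantCoeff (inclAct h s z (MvPolynomial.X (a, b) *
      radialInt (J × J) (MvPolynomial.pderiv (a, b) f))) =
      ∑ b : Fin I.card, ∑ c, (if a = inclIdx h c then
        MvPolynomial.constantCoeff (inclAct h s (gMat k I c b)
          (radialInt (J × J) (MvPolynomial.pderiv (a, inclIdx h b) f))) else 0) := by
    intro a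
    simp only [← h2]
    rw [← sum_inclIdx h (fun b => MvPolynomial.constantCoeff (inclAct h s z
      (MvPolynomial.X (a, b) * radialInt (J × J) (MvPolynomial.pderiv (a, b) f))))]
    refine Finset.sum_congr rfl fun b _ => ?_
    by_cases hb : (b : ℕ) ∈ I
    · rw [if_pos hb]
    · rw [if_neg hb, h1 _ _ _ hb]
  rw [Finset.sum_congr rfl fun a _ => h3 a, Finset.sum_comm]
  rw [Finset.sum_comm (s := (Finset.univ : Finset (Fin I.card))) (t := Finset.univ)
    (f := fun c b => MvPolynomial.constantCoeff (inclAct h s (gMat k I c b)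
        (radialInt (J × J) (MvPolynomial.pderiv (inclIdx h c, inclIdx h b) f))))]
  refine Finset.sum_congr rfl fun b _ => ?_
  rw [Finset.sum_comm]
  refine Finset.sum_congr rfl fun c _ => ?_
  rw [Finset.sum_ite_eq' , if_pos (Finset.mem_univ _)]

/-- The covariance of `p_{k,I₁}` and `p_{l,I₂}`. -/
theorem state_mul_sub {I₁ I₂ J : Finset ℕ} (h₁ : I₁ ⊆ J) (h₂ : I₂ ⊆ J) (s : ℝ) {k l : ℕ}
    {z₁ : Ugl I₁} {z₂ : Ugl I₂} (hz₁ : CorrespondsTo I₁ z₁ (shiftedPowerSum I₁.card k))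
    (hz₂ : CorrespondsTo I₂ z₂ (shiftedPowerSum I₂.card l)) :
    state J s (UglIncl h₁ z₁ * UglIncl h₂ z₂) -
        state J s (UglIncl h₁ z₁) * state J s (UglIncl h₂ z₂) =
      s * vacTrace I₁ J (Polynomial.aeval (matF I₁ J s) (gPoly k)
        (matInt J (Polynomial.aeval (matF I₂ J s) (gPoly l) (projMat I₂ J)))) := by
  rw [state_eq, state_eq, state_eq, map_mul, Module.End.mul_apply, polyAct_UglIncl,
    polyAct_UglIncl, constantCoeff_inclAct h₁ s hz₁, vacTrace_apply, mul_comm,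
    add_sub_cancel_left, sum_inclIdx h₁, Finset.mul_sum]
  refine Finset.sum_congr rfl fun c _ => ?_
  rw [aeval_matF_inclIdx, map_sum, Finset.mul_sum]
  refine Finset.sum_congr rfl fun b _ => ?_
  -- The derivative in x_cb is the entry (b, c) of the matrix for I₂: the indices are exchanged, and
  -- the two sums close up to a trace over I₁.
  rw [pderiv_inclAct_one h₂ s hz₂, map_smul, map_smul, matInt_apply, MvPolynomial.smul_eq_C_mul,
    map_mul, MvPolynomial.constantCoeff_C]

/-! ### Words in the matrix `u` and projections -/

section Words

variable {J : Finset ℕ}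

/-- The matrix `u = x - 1`. -/
noncomputable def uMat (J : Finset ℕ) : Matrix J J (PolyAlg J) :=
  Matrix.of fun a b => MvPolynomial.X (a, b)

theorem xMat_eq (J : Finset ℕ) : xMat J = 1 + uMat J := rfl

theorem projMat_mul_projMat (S T : Finset ℕ) :
    projMat S J * projMat T J = projMat (S ∩ T) J := by
  rw [projMat, projMat, projMat, Matrix.diagonal_mul_diagonal]
  congr 1
  ext1 j
  by_cases h1 : (j : ℕ) ∈ S <;> by_cases h2 : (j : ℕ) ∈ T <;> simp [h1, h2]

theorem projMat_self (J : Finset ℕ) : projMat J J = 1 := by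
  rw [projMat, ← Matrix.diagonal_one]
  congr 1
  ext1 j
  rw [if_pos j.2]

theorem projMat_apply_const (S : Finset ℕ) (a b : J) :
    projMat S J a b = MvPolynomial.C (if a = b ∧ (a : ℕ) ∈ S then 1 else 0) := by
  rw [projMat, Matrix.diagonal_apply]
  by_cases h1 : a = b
  · subst h1; by_cases h2 : (a : ℕ) ∈ S <;> simp [h2]
  · simp [h1]

theorem trace_projMat {I S : Finset ℕ} (h : I ⊆ J) :
    (projMat (I ∩ S) J).trace = (((I ∩ S).card : ℂ)) • (1 : PolyAlg J) := by
  have h1 : (projMat (I ∩ S) J).trace = ∑ j : J, if (j : ℕ) ∈ I ∩ S then (1 : PolyAlg J) else 0 := by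
    rw [projMat, Matrix.trace_diagonal]
  rw [h1, Finset.sum_coe_sort J fun j => if j ∈ I ∩ S then (1 : PolyAlg J) else 0,
    ← Finset.sum_filter, Finset.sum_const]
  have : J.filter (· ∈ I ∩ S) = I ∩ S := by
    ext j
    rw [Finset.mem_filter]
    exact ⟨fun h => h.2, fun hj => ⟨h (Finset.mem_inter.1 hj).1, hj⟩⟩
  rw [this, Nat.cast_smul_eq_nsmul]

/-- Entrywise application of the vector field `E_pj`. -/
noncomputable def matDer (p j : J) (R : Matrix J J (PolyAlg J)) : Matrix J J (PolyAlg J) :=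
  R.map (glDer (Matrix.single p j 1))

theorem matDer_apply (p j : J) (R : Matrix J J (PolyAlg J)) (a b : J) :
    matDer p j R a b = glDer (Matrix.single p j 1) (R a b) := rfl

theorem matDer_mul (p j : J) (R S : Matrix J J (PolyAlg J)) :
    matDer p j (R * S) = matDer p j R * S + R * matDer p j S := by
  ext1 a b
  simp only [matDer_apply, Matrix.add_apply, Matrix.mul_apply, map_sum, Derivation.leibniz,
    smul_eq_mul, ← Finset.sum_add_distrib]
  exact Finset.sum_congr rfl fun c _ => by ring

theorem matDer_smul (p j : J) (t : PolyAlg J) (R : Matrix J J (PolyAlg J)) :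
    matDer p j (t • R) = glDer (Matrix.single p j 1) t • R + t • matDer p j R := by
  ext1 a b
  simp only [matDer_apply, Matrix.add_apply, Matrix.smul_apply, Derivation.leibniz, smul_eq_mul]
  ring

theorem matDer_projMat (p j : J) (S : Finset ℕ) : matDer p j (projMat S J) = 0 := by
  ext1 a b
  rw [matDer_apply, projMat_apply_const, MvPolynomial.derivation_C]
  rfl

theorem matDer_uMat (p j a b : J) :
    matDer p j (uMat J) a b = if b = j then xMat J a p else 0 := by
  rw [matDer_apply, uMat, Matrix.of_apply, glDer_X, xMul_single]

theorem matDer_trace (p j : J) (R : Matrix J J (PolyAlg J)) :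
    glDer (Matrix.single p j 1) R.trace = (matDer p j R).trace := by
  simp only [Matrix.trace, map_sum, Matrix.diag_apply, matDer_apply]

/-- The contraction of `A` with the derivative of `R`. -/
noncomputable def contract (A R : Matrix J J (PolyAlg J)) : Matrix J J (PolyAlg J) :=
  Matrix.of fun j q => ∑ p, (A * matDer p j R) p q

theorem contract_apply (A R : Matrix J J (PolyAlg J)) (j q : J) :
    contract A R j q = ∑ p, (A * matDer p j R) p q := rfl

theorem contract_mul (A R S : Matrix J J (PolyAlg J)) :
    contract A (R * S) = contract A R * S + contract (A * R) S := by
  ext1 j q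
  have h1 : ∀ p, (A * matDer p j (R * S)) p q =
      (A * matDer p j R * S) p q + (A * R * matDer p j S) p q := fun p => by
    rw [matDer_mul, Matrix.mul_add, Matrix.mul_assoc, Matrix.mul_assoc, Matrix.add_apply]
  have h2 : (contract A R * S) j q = ∑ p, (A * matDer p j R * S) p q := by
    rw [Matrix.mul_apply]
    simp only [contract_apply, Finset.sum_mul]
    rw [Finset.sum_comm]
    exact Finset.sum_congr rfl fun p _ => Matrix.mul_apply.symm
  rw [Matrix.add_apply, h2, contract_apply, contract_apply, ← Finset.sum_add_distrib]
  exact Finset.sum_congr rfl fun p _ => h1 p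

theorem contract_projMat (A : Matrix J J (PolyAlg J)) (S : Finset ℕ) :
    contract A (projMat S J) = 0 := by
  ext1 j q
  simp [contract_apply, matDer_projMat]

/-- The field E_pj replaces u_aj by x_ap, which closes the loop to tr(A x). The summand 1 of x = 1 +
u makes a bare projection A contribute its rank; this is the only source of factors of order L in a
contraction. -/
theorem contract_uMat (A : Matrix J J (PolyAlg J)) :
    contract A (uMat J) = (A * xMat J).trace • (1 : Matrix J J (PolyAlg J)) := by
  ext1 j q
  rw [contract_apply, Matrix.smul_apply, Matrix.trace, smul_eq_mul, Finset.sum_mul]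
  refine Finset.sum_congr rfl fun p _ => ?_
  rw [Matrix.diag_apply, Matrix.mul_apply, Matrix.mul_apply, Finset.sum_mul]
  refine Finset.sum_congr rfl fun r _ => ?_
  rw [matDer_uMat, Matrix.one_apply]
  by_cases h : q = j
  · simp [h]
  · simp [h, Ne.symm h]

/-- The gradient of the trace of `A R` with respect to `R`. -/
noncomputable def traceGrad (A R : Matrix J J (PolyAlg J)) : Matrix J J (PolyAlg J) :=
  Matrix.of fun j b => (A * matDer b j R).trace

theorem traceGrad_apply (A R : Matrix J J (PolyAlg J)) (j b : J) :
    traceGrad A R j b = (A * matDer b j R).trace := rfl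

theorem traceGrad_mul (A R S : Matrix J J (PolyAlg J)) :
    traceGrad A (R * S) = traceGrad (S * A) R + traceGrad (A * R) S := by
  ext1 j b
  have h1 : (A * (matDer b j R * S)).trace = (S * A * matDer b j R).trace := by
    rw [← Matrix.mul_assoc, Matrix.trace_mul_comm, ← Matrix.mul_assoc]
  rw [Matrix.add_apply, traceGrad_apply, traceGrad_apply, traceGrad_apply, matDer_mul,
    Matrix.mul_add, Matrix.trace_add, h1, ← Matrix.mul_assoc]

theorem traceGrad_projMat (A : Matrix J J (PolyAlg J)) (S : Finset ℕ) :
    traceGrad A (projMat S J) = 0 := by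
  ext1 j q
  simp [traceGrad_apply, matDer_projMat]

/-- A derivative inside a trace opens the loop to a word, so no new trace arises. -/
theorem traceGrad_uMat (A : Matrix J J (PolyAlg J)) : traceGrad A (uMat J) = A * xMat J := by
  ext1 j b
  rw [traceGrad_apply, Matrix.trace, Matrix.mul_apply, Finset.sum_eq_single j]
  · rw [Matrix.diag_apply, Matrix.mul_apply]
    exact Finset.sum_congr rfl fun r _ => by rw [matDer_uMat, if_pos rfl]
  · intro q _ hq
    rw [Matrix.diag_apply, Matrix.mul_apply]
    exact Finset.sum_eq_zero fun r _ => by rw [matDer_uMat, if_neg hq, mul_zero]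
  · simp

/-- The multiplication part comes from the character and carries the factor s; the vector fields
give the contraction. -/
theorem matF_eq (I : Finset ℕ) (s : ℂ) (R : Matrix J J (PolyAlg J)) :
    matF I J s R = s • (projMat I J * xMat J * (projMat I J * R)) +
      projMat I J * contract (projMat I J) R := by
  ext1 c p
  rw [matF_apply, Matrix.add_apply, Matrix.smul_apply, Matrix.mul_assoc, projMat_mul_apply,
    projMat_mul_apply, Matrix.mul_apply, contract_apply]
  by_cases hc : (c : ℕ) ∈ I
  · rw [if_pos hc, if_pos hc, if_pos hc, Finset.smul_sum, ← Finset.sum_add_distrib]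
    refine Finset.sum_congr rfl fun b _ => ?_
    rw [projMat_mul_apply, projMat_mul_apply, matDer_apply]
    split_ifs
    · rw [smul_mul_assoc, add_comm]
    · simp
  · simp [hc]

/-- Words with `n` letters `u`, separated by projections. -/
inductive IsWord : ℕ → Matrix J J (PolyAlg J) → Prop
  | proj (S : Finset ℕ) : IsWord 0 (projMat S J)
  | cons (S : Finset ℕ) {n : ℕ} {W : Matrix J J (PolyAlg J)} (hW : IsWord n W) :
      IsWord (n + 1) (projMat S J * (uMat J * W))

theorem IsWord.proj_mul (S : Finset ℕ) {n : ℕ} {W : Matrix J J (PolyAlg J)} (hW : IsWord n W) :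
    IsWord n (projMat S J * W) := by
  cases hW with
  | proj T => rw [projMat_mul_projMat]; exact .proj _
  | cons T hW => rw [← Matrix.mul_assoc, projMat_mul_projMat]; exact .cons _ hW

theorem IsWord.mul {n m : ℕ} {W W' : Matrix J J (PolyAlg J)} (hW : IsWord n W)
    (hW' : IsWord m W') : IsWord (n + m) (W * W') := by
  induction hW with
  | proj S => rw [zero_add]; exact hW'.proj_mul S
  | cons S hW ih =>
    rw [Matrix.mul_assoc, Matrix.mul_assoc, Nat.add_right_comm]
    exact .cons S ih

theorem isWord_one : IsWord 0 (1 : Matrix J J (PolyAlg J)) := by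
  rw [← projMat_self]; exact .proj _

theorem isWord_uMat : IsWord 1 (uMat J) := by
  have := IsWord.cons J (isWord_one (J := J))
  rwa [projMat_self, Matrix.one_mul, Matrix.mul_one] at this

/-- Words multiplied by traces of words. -/
inductive IsTerm : ℕ → Matrix J J (PolyAlg J) → Prop
  | word {n : ℕ} {W : Matrix J J (PolyAlg J)} (hW : IsWord n W) : IsTerm n W
  | tr {n m : ℕ} {W R : Matrix J J (PolyAlg J)} (hW : IsWord (m + 1) W) (hR : IsTerm n R) :
      IsTerm (m + 1 + n) (W.trace • R)

theorem IsTerm.mul {n m : ℕ} {R R' : Matrix J J (PolyAlg J)} (hR : IsTerm n R)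
    (hR' : IsTerm m R') : IsTerm (n + m) (R * R') := by
  induction hR with
  | tr hW hR ih =>
    rw [smul_mul_assoc, Nat.add_assoc]
    exact .tr hW ih
  | @word n W hW =>
    induction hR' with
    | word hW' => exact .word (hW.mul hW')
    | @tr n' m' W' R' hW' hR' ih =>
      rw [mul_smul_comm, Nat.add_left_comm]
      exact .tr hW' ih

theorem IsWord.isHomogeneous {n : ℕ} {W : Matrix J J (PolyAlg J)} (hW : IsWord n W) (a b : J) :
    (W a b).IsHomogeneous n := by
  induction hW generalizing a b with
  | proj S =>
    rw [projMat_apply_const]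
    exact MvPolynomial.isHomogeneous_C _ _
  | @cons S n W hW ih =>
    rw [projMat_mul_apply]
    split_ifs
    · rw [Matrix.mul_apply]
      refine MvPolynomial.IsHomogeneous.sum _ _ _ fun c _ => ?_
      rw [Nat.add_comm]
      exact (MvPolynomial.isHomogeneous_X _ _).mul (ih c b)
    · exact MvPolynomial.isHomogeneous_zero _ _ _

theorem IsTerm.isHomogeneous {n : ℕ} {R : Matrix J J (PolyAlg J)} (hR : IsTerm n R) (a b : J) :
    (R a b).IsHomogeneous n := by
  induction hR with
  | word hW => exact hW.isHomogeneous a b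
  | @tr n m W R hW hR ih =>
    rw [Matrix.smul_apply, smul_eq_mul]
    exact (MvPolynomial.IsHomogeneous.sum _ _ _ fun c _ => hW.isHomogeneous c c).mul ih

theorem IsTerm.matInt {n : ℕ} {R : Matrix J J (PolyAlg J)} (hR : IsTerm n R) :
    matInt J R = ((n : ℂ) + 1)⁻¹ • R := by
  ext1 a b
  rw [matInt_apply, radialInt_of_isHomogeneous (hR.isHomogeneous a b), Matrix.smul_apply]

theorem norm_vacTrace_projMat {I S : Finset ℕ} (h : I ⊆ J) :
    vacTrace I J (projMat S J) = (I ∩ S).card := by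
  rw [vacTrace_apply]
  have : ∀ j : J, (if (j : ℕ) ∈ I then
      MvPolynomial.constantCoeff (projMat S J j j) else 0) = if (j : ℕ) ∈ I ∩ S then (1 : ℂ) else 0 := by
    intro j
    rw [projMat_apply_const, MvPolynomial.constantCoeff_C]
    by_cases h1 : (j : ℕ) ∈ I <;> by_cases h2 : (j : ℕ) ∈ S <;> simp [h1, h2]
  rw [Finset.sum_congr rfl fun j _ => this j,
    Finset.sum_coe_sort J fun j => if j ∈ I ∩ S then (1 : ℂ) else 0, ← Finset.sum_filter,
    Finset.sum_const]
  have : J.filter (· ∈ I ∩ S) = I ∩ S := by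
    ext j
    rw [Finset.mem_filter]
    exact ⟨fun h => h.2, fun hj => ⟨h (Finset.mem_inter.1 hj).1, hj⟩⟩
  rw [this, nsmul_eq_mul, mul_one]

theorem IsTerm.vacTrace_eq_zero {n : ℕ} {R : Matrix J J (PolyAlg J)} (hR : IsTerm n R)
    (hn : n ≠ 0) (I : Finset ℕ) : vacTrace I J R = 0 := by
  rw [vacTrace_apply]
  refine Finset.sum_eq_zero fun j _ => ?_
  split_ifs
  · rw [MvPolynomial.constantCoeff_eq]
    exact (hR.isHomogeneous j j).coeff_eq_zero (by simpa using hn.symm)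
  · rfl

theorem IsTerm.norm_vacTrace_le {n : ℕ} {R : Matrix J J (PolyAlg J)} (hR : IsTerm n R)
    {I : Finset ℕ} (h : I ⊆ J) : ‖vacTrace I J R‖ ≤ I.card := by
  by_cases hn : n = 0
  · cases hR with
    | word hW =>
      cases hW with
      | proj S =>
        rw [norm_vacTrace_projMat h, Complex.norm_natCast]
        exact_mod_cast Finset.card_le_card Finset.inter_subset_left
      | cons S hW => omega
    | tr hW hR => omega
  · rw [hR.vacTrace_eq_zero hn, norm_zero]
    positivity

/-- `HasSize d x R`: `R` is a linear combination of terms of degree at most `d`, with sum of the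
absolute values of the coefficients at most `x`. -/
inductive HasSize (d : ℕ) : ℝ → Matrix J J (PolyAlg J) → Prop
  | zero : HasSize d 0 0
  | term (α : ℂ) {n : ℕ} {R : Matrix J J (PolyAlg J)} (hR : IsTerm n R) (hn : n ≤ d) :
      HasSize d ‖α‖ (α • R)
  | add {x y : ℝ} {R R' : Matrix J J (PolyAlg J)} (hR : HasSize d x R) (hR' : HasSize d y R') :
      HasSize d (x + y) (R + R')
  | mono {x y : ℝ} {R : Matrix J J (PolyAlg J)} (hR : HasSize d x R) (hxy : x ≤ y) : HasSize d y R

theorem IsTerm.hasSize {d n : ℕ} {R : Matrix J J (PolyAlg J)} (hR : IsTerm n R) (hn : n ≤ d) :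
    HasSize d 1 R := by
  have := HasSize.term 1 hR hn
  rwa [norm_one, one_smul] at this

theorem HasSize.nonneg {d : ℕ} {x : ℝ} {R : Matrix J J (PolyAlg J)} (hR : HasSize d x R) :
    0 ≤ x := by
  induction hR with
  | zero => exact le_rfl
  | term α hR hn => exact norm_nonneg α
  | add _ _ h1 h2 => exact add_nonneg h1 h2
  | mono _ hxy h => exact h.trans hxy

/-- Sizes under a linear map that is bounded on terms. -/
theorem HasSize.map {d d' : ℕ} {x B : ℝ} {R : Matrix J J (PolyAlg J)} (hR : HasSize d x R)
    (Φ : Matrix J J (PolyAlg J) →ₗ[ℂ] Matrix J J (PolyAlg J)) (hB : 0 ≤ B)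
    (hΦ : ∀ n ≤ d, ∀ R, IsTerm n R → ∀ α : ℂ, HasSize d' (‖α‖ * B) (α • Φ R)) :
    HasSize d' (x * B) (Φ R) := by
  induction hR with
  | zero => rw [zero_mul, map_zero]; exact .zero
  | term α hR hn => rw [map_smul]; exact hΦ _ hn _ hR α
  | add _ _ h1 h2 => rw [add_mul, map_add]; exact h1.add h2
  | mono _ hxy h => exact h.mono (mul_le_mul_of_nonneg_right hxy hB)

theorem HasSize.smul {d : ℕ} {x : ℝ} {R : Matrix J J (PolyAlg J)} (hR : HasSize d x R) (β : ℂ) :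
    HasSize d (x * ‖β‖) (β • R) := by
  refine hR.map (LinearMap.lsmul ℂ _ β) (norm_nonneg β) fun n hn R hR α => ?_
  rw [LinearMap.lsmul_apply, smul_smul, ← norm_mul]
  exact .term _ hR hn

theorem HasSize.mono_deg {d d' : ℕ} {x : ℝ} {R : Matrix J J (PolyAlg J)} (hR : HasSize d x R)
    (hd : d ≤ d') : HasSize d' x R := by
  have := hR.map (d' := d') LinearMap.id zero_le_one fun n hn R hR α => by
    rw [mul_one]; exact .term _ hR (hn.trans hd)
  rwa [mul_one] at this

theorem HasSize.of_term {d : ℕ} {B : ℝ} {R : Matrix J J (PolyAlg J)} (h : HasSize d B R) (α : ℂ) :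
    HasSize d (‖α‖ * B) (α • R) := by
  rw [mul_comm]; exact h.smul α

theorem HasSize.matInt {d : ℕ} {x : ℝ} {R : Matrix J J (PolyAlg J)} (hR : HasSize d x R) :
    HasSize d x (matInt J R) := by
  have := hR.map (d' := d) (UnitaryPlancherel.matInt J) zero_le_one fun n hn R hR α => by
    refine HasSize.of_term ?_ α
    rw [hR.matInt]
    refine (HasSize.term _ hR hn).mono ?_
    rw [norm_inv]
    refine inv_le_one_of_one_le₀ ?_
    have : ((n : ℂ) + 1) = ((n + 1 : ℕ) : ℂ) := by push_cast; rfl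
    rw [this, Complex.norm_natCast]
    exact_mod_cast Nat.le_add_left 1 n
  rwa [mul_one] at this

theorem HasSize.tr_smul {d m : ℕ} {x : ℝ} {R W : Matrix J J (PolyAlg J)} (hR : HasSize d x R)
    (hW : IsWord (m + 1) W) : HasSize (m + 1 + d) x (W.trace • R) := by
  have := hR.map (d' := m + 1 + d) (LinearMap.lsmul (PolyAlg J) _ W.trace |>.restrictScalars ℂ)
    zero_le_one fun n hn R hR α => HasSize.of_term (IsTerm.hasSize (.tr hW hR) (by omega)) α
  rwa [mul_one] at this

theorem HasSize.term_mul {d n : ℕ} {x : ℝ} {R W : Matrix J J (PolyAlg J)} (hR : HasSize d x R)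
    (hW : IsTerm n W) : HasSize (n + d) x (W * R) := by
  have := hR.map (d' := n + d) (LinearMap.mulLeft ℂ W)
    zero_le_one fun m hm R hR α => HasSize.of_term (IsTerm.hasSize (hW.mul hR) (by omega)) α
  rwa [mul_one] at this

theorem HasSize.mul_term {d n : ℕ} {x : ℝ} {R W : Matrix J J (PolyAlg J)} (hR : HasSize d x R)
    (hW : IsTerm n W) : HasSize (d + n) x (R * W) := by
  have := hR.map (d' := d + n) (LinearMap.mulRight ℂ W)
    zero_le_one fun m hm R hR α => HasSize.of_term (IsTerm.hasSize (hR.mul hW) (by omega)) α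
  rwa [mul_one] at this

theorem HasSize.norm_vacTrace_le {d : ℕ} {x : ℝ} {R : Matrix J J (PolyAlg J)}
    (hR : HasSize d x R) {I : Finset ℕ} (h : I ⊆ J) : ‖vacTrace I J R‖ ≤ x * I.card := by
  induction hR with
  | zero => rw [map_zero, norm_zero, zero_mul]
  | term α hR hn =>
    rw [map_smul, smul_eq_mul, norm_mul]
    exact mul_le_mul_of_nonneg_left (hR.norm_vacTrace_le h) (norm_nonneg α)
  | add _ _ h1 h2 =>
    rw [map_add, add_mul]
    exact (norm_add_le _ _).trans (add_le_add h1 h2)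
  | mono _ hxy h => exact h.trans (mul_le_mul_of_nonneg_right hxy (Nat.cast_nonneg _))

theorem contract_proj_mul_uMat_mul (A W : Matrix J J (PolyAlg J)) (S : Finset ℕ) :
    contract A (projMat S J * (uMat J * W)) = (A * projMat S J).trace • W +
      ((A * projMat S J * uMat J).trace • W + contract (A * projMat S J * uMat J) W) := by
  rw [contract_mul, contract_projMat, Matrix.zero_mul, zero_add, contract_mul, contract_uMat,
    smul_mul_assoc, Matrix.one_mul, xMat_eq, Matrix.mul_add, Matrix.mul_one, Matrix.trace_add,
    add_smul, add_assoc]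

/-- Each of the m letters gives two terms, from x = 1 + u. As A already contains a letter, every
trace that arises contains one as well, so no cardinality enters the bound. -/
theorem IsWord.hasSize_contract {a m : ℕ} {A W : Matrix J J (PolyAlg J)} (hA : IsWord (a + 1) A)
    (hW : IsWord m W) : HasSize (a + 1 + m) (2 * m) (contract A W) := by
  induction hW generalizing a A with
  | proj S => rw [contract_projMat]; exact HasSize.zero.mono (by simp)
  | @cons S m W hW ih =>
    rw [contract_proj_mul_uMat_mul]
    have h1 : IsWord (a + 1) (A * projMat S J) := hA.mul (.proj S)
    have h2 : IsWord (a + 1 + 1) (A * projMat S J * uMat J) := h1.mul isWord_uMat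
    have := ((IsTerm.tr h1 (.word hW)).hasSize (d := a + 1 + (m + 1)) (by omega)).add
      (((IsTerm.tr h2 (.word hW)).hasSize (d := a + 1 + (m + 1)) (by omega)).add
        ((ih h2).mono_deg (d' := a + 1 + (m + 1)) (by omega)))
    refine this.mono (le_of_eq ?_)
    push_cast; ring

/-- The leading term of the contraction of a word with a projection. -/
theorem IsWord.hasSize_contract_proj {m : ℕ} {W : Matrix J J (PolyAlg J)} (hW : IsWord m W)
    (I S : Finset ℕ) (h : I ⊆ J) :
    HasSize (m + 1) (2 * m + 1) (contract (projMat I J) (projMat S J * (uMat J * W)) -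
      ((I ∩ S).card : ℂ) • W) := by
  rw [contract_proj_mul_uMat_mul, projMat_mul_projMat, trace_projMat h, smul_assoc, one_smul,
    add_sub_cancel_left]
  have h2 : IsWord (0 + 1) (projMat (I ∩ S) J * uMat J) := (IsWord.proj _).mul isWord_uMat
  have := ((IsTerm.tr h2 (.word hW)).hasSize (d := m + 1) (by omega)).add
        ((h2.hasSize_contract hW).mono_deg (d' := m + 1) (by omega))
  exact this.mono (le_of_eq (by ring))

/-- Only the first letter can close a loop around a bare projection; this costs at most |I|. -/
theorem IsWord.hasSize_contract_proj' {m : ℕ} {W : Matrix J J (PolyAlg J)} (hW : IsWord m W)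
    (I : Finset ℕ) (h : I ⊆ J) :
    HasSize m (I.card + 2 * m) (contract (projMat I J) W) := by
  cases hW with
  | proj S => rw [contract_projMat]; exact HasSize.zero.mono (by simp)
  | @cons S m W hW =>
    have h1 := (HasSize.term ((I ∩ S).card : ℂ) (.word hW) (Nat.le_succ m)).add
      (hW.hasSize_contract_proj I S h)
    rw [add_sub_cancel] at h1
    refine h1.mono ?_
    rw [Complex.norm_natCast]
    have : ((I ∩ S).card : ℝ) ≤ I.card := by
      exact_mod_cast Finset.card_le_card Finset.inter_subset_left
    push_cast
    linarith

theorem IsWord.hasSize_traceGrad {a m : ℕ} {A W : Matrix J J (PolyAlg J)} (hA : IsWord a A)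
    (hW : IsWord m W) : HasSize (a + m) (2 * m) (traceGrad A W) := by
  induction hW generalizing a A with
  | proj S => rw [traceGrad_projMat]; exact HasSize.zero.mono (by simp)
  | @cons S m W hW ih =>
    have h0 : traceGrad A (projMat S J * (uMat J * W)) = W * (A * projMat S J) +
        (W * (A * projMat S J) * uMat J + traceGrad (A * projMat S J * uMat J) W) := by
      rw [traceGrad_mul, traceGrad_projMat, zero_add, traceGrad_mul, traceGrad_uMat, xMat_eq,
        Matrix.mul_add, Matrix.mul_one, add_assoc]
    rw [h0]
    have h1 : IsWord a (A * projMat S J) := hA.mul (.proj S)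
    have h2 : IsWord (a + 1) (A * projMat S J * uMat J) := h1.mul isWord_uMat
    have h3 := hW.mul h1
    have := ((IsTerm.word h3).hasSize (d := a + (m + 1)) (by omega)).add
      (((IsTerm.word (h3.mul isWord_uMat)).hasSize (d := a + (m + 1)) (by omega)).add
        ((ih h2).mono_deg (d' := a + (m + 1)) (by omega)))
    refine this.mono (le_of_eq ?_)
    push_cast; ring

theorem contract_smul (I : Finset ℕ) (W R : Matrix J J (PolyAlg J)) :
    contract (projMat I J) (W.trace • R) = W.trace • contract (projMat I J) R +
      traceGrad 1 W * (projMat I J * R) := by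
  ext1 j q
  rw [Matrix.add_apply, Matrix.smul_apply, Matrix.mul_apply]
  simp only [contract_apply, matDer_smul, Matrix.mul_add, Matrix.add_apply, matDer_trace,
    Finset.sum_add_distrib, mul_smul_comm, Matrix.smul_apply, traceGrad_apply, Matrix.one_mul,
    Finset.mul_sum, smul_eq_mul]
  rw [add_comm]

/-- A derivative falling on a trace factor opens it and costs no cardinality, so |I| enters once,
through the word outside the traces. -/
theorem IsTerm.hasSize_contract_proj {n : ℕ} {R : Matrix J J (PolyAlg J)} (hR : IsTerm n R)
    (I : Finset ℕ) (h : I ⊆ J) :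
    HasSize n (I.card + 2 * n) (contract (projMat I J) R) := by
  induction hR with
  | word hW => exact hW.hasSize_contract_proj' I h
  | @tr n m W R hW hR ih =>
    rw [contract_smul]
    have h1 := ih.tr_smul hW
    have h2 := (isWord_one.hasSize_traceGrad hW).mul_term
      ((IsTerm.word (.proj I)).mul hR)
    refine (h1.add (h2.mono_deg (d' := m + 1 + n) (by omega))).mono (le_of_eq ?_)
    push_cast; ring

/-- The boundedness of the rescaled operator `F`. -/
theorem HasSize.matF {d : ℕ} {x : ℝ} {R : Matrix J J (PolyAlg J)} (hR : HasSize d x R)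
    {I : Finset ℕ} (h : I ⊆ J) (s ν : ℂ) :
    HasSize (d + 1) (x * (2 * ‖ν * s‖ + ‖ν‖ * (I.card + 2 * d))) (ν • matF I J s R) := by
  refine hR.map (d' := d + 1) (ν • UnitaryPlancherel.matF I J s) (by positivity)
    fun n hn R hR α => HasSize.of_term ?_ α
  have e : (ν • UnitaryPlancherel.matF I J s) R = (ν * s) • (projMat I J * (projMat I J * R)) +
      ((ν * s) • (projMat I J * uMat J * (projMat I J * R)) +
        ν • (projMat I J * contract (projMat I J) R)) := by
    rw [LinearMap.smul_apply, matF_eq, xMat_eq, Matrix.mul_add, Matrix.mul_one, Matrix.add_mul,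
      smul_add, smul_smul, smul_add, add_assoc]
  rw [e]
  have hp : ∀ S, IsTerm 0 (projMat S J) := fun S => .word (.proj S)
  have h1 := HasSize.term (d := d + 1) (ν * s) ((hp I).mul ((hp I).mul hR)) (by omega)
  have h2 := HasSize.term (d := d + 1) (ν * s)
    ((((hp I).mul (.word isWord_uMat)).mul ((hp I).mul hR))) (by omega)
  have h3 := ((((hR.hasSize_contract_proj I h).term_mul (hp I)).smul ν).mono_deg
    (d' := d + 1) (by omega))
  refine (h1.add (h2.add h3)).mono ?_
  have : (n : ℝ) ≤ d := by exact_mod_cast hn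
  nlinarith [norm_nonneg ν]

end Words

/-! ### Asymptotics -/

section Asymptotics

variable {J : ℕ → Finset ℕ}

/-- A sequence of matrices of bounded size. -/
def SizeBounded (R : ∀ L, Matrix (J L) (J L) (PolyAlg (J L))) : Prop :=
  ∃ (d : ℕ) (C : ℝ), ∀ᶠ L in atTop, HasSize d C (R L)

/-- A sequence of matrices whose size tends to zero. -/
def SizeNull (R : ∀ L, Matrix (J L) (J L) (PolyAlg (J L))) : Prop :=
  ∃ (d : ℕ) (f : ℕ → ℝ), Tendsto f atTop (𝓝 0) ∧ ∀ᶠ L in atTop, HasSize d (f L) (R L)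

variable {R R' : ∀ L, Matrix (J L) (J L) (PolyAlg (J L))}

theorem SizeNull.add (hR : SizeNull R) (hR' : SizeNull R') : SizeNull fun L => R L + R' L := by
  obtain ⟨d, f, hf, h⟩ := hR
  obtain ⟨d', f', hf', h'⟩ := hR'
  refine ⟨max d d', fun L => f L + f' L, by simpa using hf.add hf', ?_⟩
  filter_upwards [h, h'] with L h h'
  exact (h.mono_deg (le_max_left _ _)).add (h'.mono_deg (le_max_right _ _))

theorem sizeNull_zero : SizeNull fun L => (0 : Matrix (J L) (J L) (PolyAlg (J L))) :=
  ⟨0, fun _ => 0, tendsto_const_nhds, .of_forall fun _ => .zero⟩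

theorem SizeNull.sum {n : ℕ} {Q : ℕ → ∀ L, Matrix (J L) (J L) (PolyAlg (J L))}
    (h : ∀ i < n, SizeNull (Q i)) : SizeNull fun L => ∑ i ∈ Finset.range n, Q i L := by
  induction n with
  | zero => simpa using sizeNull_zero
  | succ n ih =>
    simp only [Finset.sum_range_succ]
    exact (ih fun i hi => h i (by omega)).add (h n (by omega))

theorem SizeBounded.smul_null (hR : SizeBounded R) {a : ℕ → ℂ} (ha : Tendsto a atTop (𝓝 0)) :
    SizeNull fun L => a L • R L := by
  obtain ⟨d, C, h⟩ := hR
  refine ⟨d, fun L => C * ‖a L‖, by simpa using ha.norm.const_mul C, ?_⟩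
  filter_upwards [h] with L h
  exact h.smul _

theorem SizeBounded.add (hR : SizeBounded R) (hR' : SizeBounded R') :
    SizeBounded fun L => R L + R' L := by
  obtain ⟨d, C, h⟩ := hR
  obtain ⟨d', C', h'⟩ := hR'
  refine ⟨max d d', C + C', ?_⟩
  filter_upwards [h, h'] with L h h'
  exact (h.mono_deg (le_max_left _ _)).add (h'.mono_deg (le_max_right _ _))

theorem SizeBounded.smul (hR : SizeBounded R) (a : ℂ) : SizeBounded fun L => a • R L := by
  obtain ⟨d, C, h⟩ := hR
  exact ⟨d, C * ‖a‖, h.mono fun L h => h.smul a⟩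

theorem SizeBounded.matInt (hR : SizeBounded R) :
    SizeBounded fun L => UnitaryPlancherel.matInt (J L) (R L) := by
  obtain ⟨d, C, h⟩ := hR
  exact ⟨d, C, h.mono fun L h => h.matInt⟩

theorem SizeNull.matInt (hR : SizeNull R) :
    SizeNull fun L => UnitaryPlancherel.matInt (J L) (R L) := by
  obtain ⟨d, f, hf, h⟩ := hR
  exact ⟨d, f, hf, h.mono fun L h => h.matInt⟩

theorem SizeNull.bounded (hR : SizeNull R) : SizeBounded R := by
  obtain ⟨d, f, hf, h⟩ := hR
  refine ⟨d, 1, ?_⟩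
  filter_upwards [h, hf.eventually_le_const zero_lt_one] with L h h'
  exact h.mono h'

variable {I : ℕ → Finset ℕ} {gam eta : ℝ}

/-- The rescaled operator `F / L`. -/
noncomputable def scaledF (I J : ℕ → Finset ℕ) (gam : ℝ) (L : ℕ) :
    Module.End ℂ (Matrix (J L) (J L) (PolyAlg (J L))) :=
  (L : ℂ)⁻¹ • matF (I L) (J L) ((gam * L : ℝ) : ℂ)

/-- After division by L, the cardinality and the factor s = γL become bounded. The constant depends
on the degree d, which is why degrees are tracked along with sizes. -/
theorem hasSize_scaledF (hI : ∀ L, I L ⊆ J L)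
    (hη : Tendsto (fun L : ℕ => ((I L).card : ℝ) / L) atTop (𝓝 eta)) (d : ℕ) :
    ∃ B : ℝ, 0 ≤ B ∧ ∀ᶠ L in atTop, ∀ x, ∀ R : Matrix (J L) (J L) (PolyAlg (J L)), HasSize d x R →
      HasSize (d + 1) (x * B) (scaledF I J gam L R) := by
  -- The term 2|γ| comes from the two summands of x = 1 + u, |η| + 1 eventually bounds |I|/L, and 2d
  -- bounds the other derivative terms.
  refine ⟨2 * |gam| + (|eta| + 1 + 2 * d), by positivity, ?_⟩
  have h1 : ∀ᶠ L : ℕ in atTop, ((I L).card : ℝ) / L ≤ |eta| + 1 :=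
    hη.eventually_le_const (by linarith [le_abs_self eta])
  filter_upwards [h1, eventually_ge_atTop 1] with L h1 hL x R hR
  refine (hR.matF (hI L) ((gam * L : ℝ) : ℂ) (L : ℂ)⁻¹).mono ?_
  refine mul_le_mul_of_nonneg_left ?_ hR.nonneg
  have hL0 : (L : ℂ) ≠ 0 := by exact_mod_cast (by omega : L ≠ 0)
  have hL1 : (1 : ℝ) ≤ L := by exact_mod_cast hL
  have e : (L : ℂ)⁻¹ * ((gam * L : ℝ) : ℂ) = gam := by
    push_cast; field_simp
  rw [e, Complex.norm_real, Real.norm_eq_abs, norm_inv, Complex.norm_natCast, mul_add,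
    inv_mul_eq_div]
  have h3 : (L : ℝ)⁻¹ * (2 * d) ≤ 1 * (2 * d) :=
    mul_le_mul_of_nonneg_right (inv_le_one_of_one_le₀ hL1) (by positivity)
  linarith

theorem SizeBounded.scaledF (hI : ∀ L, I L ⊆ J L)
    (hη : Tendsto (fun L : ℕ => ((I L).card : ℝ) / L) atTop (𝓝 eta)) (hR : SizeBounded R) :
    SizeBounded fun L => scaledF I J gam L (R L) := by
  obtain ⟨d, C, h⟩ := hR
  obtain ⟨B, -, hB⟩ := hasSize_scaledF (gam := gam) hI hη d
  refine ⟨d + 1, C * B, ?_⟩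
  filter_upwards [h, hB] with L h hB
  exact hB _ _ h

theorem SizeNull.scaledF (hI : ∀ L, I L ⊆ J L)
    (hη : Tendsto (fun L : ℕ => ((I L).card : ℝ) / L) atTop (𝓝 eta)) (hR : SizeNull R) :
    SizeNull fun L => scaledF I J gam L (R L) := by
  obtain ⟨d, f, hf, h⟩ := hR
  obtain ⟨B, -, hB⟩ := hasSize_scaledF (gam := gam) hI hη d
  refine ⟨d + 1, fun L => f L * B, by simpa using hf.mul_const B, ?_⟩
  filter_upwards [h, hB] with L h hB
  exact hB _ _ h

theorem SizeBounded.scaledF_pow (hI : ∀ L, I L ⊆ J L)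
    (hη : Tendsto (fun L : ℕ => ((I L).card : ℝ) / L) atTop (𝓝 eta)) (hR : SizeBounded R) (n : ℕ) :
    SizeBounded fun L => (UnitaryPlancherel.scaledF I J gam L ^ n) (R L) := by
  induction n with
  | zero => exact hR
  | succ n ih => simp only [pow_succ', Module.End.mul_apply]; exact ih.scaledF hI hη

theorem SizeNull.scaledF_pow (hI : ∀ L, I L ⊆ J L)
    (hη : Tendsto (fun L : ℕ => ((I L).card : ℝ) / L) atTop (𝓝 eta)) (hR : SizeNull R) (n : ℕ) :
    SizeNull fun L => (UnitaryPlancherel.scaledF I J gam L ^ n) (R L) := by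
  induction n with
  | zero => exact hR
  | succ n ih => simp only [pow_succ', Module.End.mul_apply]; exact ih.scaledF hI hη

theorem SizeNull.tendsto_vacTrace (hI : ∀ L, I L ⊆ J L)
    (hη : Tendsto (fun L : ℕ => ((I L).card : ℝ) / L) atTop (𝓝 eta)) (hR : SizeNull R) :
    Tendsto (fun L : ℕ => (L : ℂ)⁻¹ * vacTrace (I L) (J L) (R L)) atTop (𝓝 0) := by
  obtain ⟨d, f, hf, h⟩ := hR
  refine squeeze_zero_norm' (a := fun L : ℕ => f L * (((I L).card : ℝ) / L)) ?_
    (by simpa using hf.mul hη)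
  filter_upwards [h] with L h
  rw [norm_mul, norm_inv, Complex.norm_natCast]
  calc (L : ℝ)⁻¹ * ‖vacTrace (I L) (J L) (R L)‖ ≤ (L : ℝ)⁻¹ * (f L * (I L).card) :=
        mul_le_mul_of_nonneg_left (h.norm_vacTrace_le (hI L)) (by positivity)
    _ = f L * ((I L).card / L) := by ring

/-! ### The leading part of `g_k(F)` -/

theorem gPoly_coeff_succ (k n : ℕ) (hn : k ≤ n) : (gPoly k).coeff n = 0 := by
  rw [gPoly, Polynomial.coeff_sub, sub_eq_add_neg (Polynomial.X : Polynomial ℂ), ← Polynomial.C_neg,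
    Polynomial.coeff_X_add_C_pow, Polynomial.coeff_X_add_C_pow]
  rcases hn.eq_or_lt with rfl | hn
  · simp
  · simp [Nat.choose_eq_zero_of_lt hn]

theorem gPoly_coeff_self (k : ℕ) : (gPoly (k + 1)).coeff k = (k : ℂ) + 1 := by
  rw [gPoly, Polynomial.coeff_sub, sub_eq_add_neg (Polynomial.X : Polynomial ℂ), ← Polynomial.C_neg,
    Polynomial.coeff_X_add_C_pow, Polynomial.coeff_X_add_C_pow]
  simp
  ring

/-- The polynomial g_{k+1} has degree k and leading coefficient k + 1. In the rescaling by r^k, each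
lower power of F keeps a positive power of 1/r. -/
theorem aeval_gPoly {M : Type*} [AddCommGroup M] [Module ℂ M] (F : Module.End ℂ M) (k : ℕ)
    {r : ℂ} (hr : r ≠ 0) (v : M) :
    (r ^ k)⁻¹ • Polynomial.aeval F (gPoly (k + 1)) v = ((k : ℂ) + 1) • ((r⁻¹ • F) ^ k) v +
      ∑ i ∈ Finset.range k, ((gPoly (k + 1)).coeff i * (r⁻¹) ^ (k - i)) • ((r⁻¹ • F) ^ i) v := by
  have hd : (gPoly (k + 1)).natDegree < k + 1 := by
    rw [Nat.lt_succ_iff, Polynomial.natDegree_le_iff_coeff_eq_zero]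
    exact fun n hn => gPoly_coeff_succ _ _ hn
  have h1 : ∀ i ≤ k, ∀ a : ℂ, (r ^ k)⁻¹ • (a • F ^ i) v =
      (a * (r⁻¹) ^ (k - i)) • ((r⁻¹ • F) ^ i) v := by
    intro i hi a
    rw [smul_pow, LinearMap.smul_apply, LinearMap.smul_apply, smul_smul, smul_smul]
    congr 1
    have : r ^ k = r ^ (k - i) * r ^ i := by rw [← pow_add, Nat.sub_add_cancel hi]
    rw [this, mul_inv, inv_pow, inv_pow]
    ring
  rw [Polynomial.aeval_eq_sum_range' hd, LinearMap.sum_apply, Finset.smul_sum,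
    Finset.sum_range_succ, h1 k le_rfl, gPoly_coeff_self, Nat.sub_self, pow_zero, mul_one, add_comm]
  congr 1
  exact Finset.sum_congr rfl fun i hi => h1 i (Finset.mem_range.1 hi).le _

theorem SizeBounded.aeval_gPoly (hI : ∀ L, I L ⊆ J L)
    (hη : Tendsto (fun L : ℕ => ((I L).card : ℝ) / L) atTop (𝓝 eta)) (hR : SizeBounded R) (k : ℕ) :
    ∃ N : ∀ L, Matrix (J L) (J L) (PolyAlg (J L)), SizeNull N ∧ ∀ L : ℕ, L ≠ 0 →
      ((L : ℂ) ^ k)⁻¹ • Polynomial.aeval (matF (I L) (J L) ((gam * L : ℝ) : ℂ)) (gPoly (k + 1))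
        (R L) = ((k : ℂ) + 1) • (UnitaryPlancherel.scaledF I J gam L ^ k) (R L) + N L := by
  refine ⟨_, SizeNull.sum (n := k) (Q := fun i L =>
    ((gPoly (k + 1)).coeff i * ((L : ℂ)⁻¹) ^ (k - i)) •
      (UnitaryPlancherel.scaledF I J gam L ^ i) (R L)) fun i hi => ?_, fun L hL =>
        UnitaryPlancherel.aeval_gPoly _ _ (Nat.cast_ne_zero.2 hL) _⟩
  refine SizeBounded.smul_null (hR.scaledF_pow hI hη i) ?_
  have h0 : Tendsto (fun L : ℕ => (L : ℂ)⁻¹) atTop (𝓝 0) := tendsto_inv_atTop_nhds_zero_nat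
  have := (h0.pow (k - i)).const_mul ((gPoly (k + 1)).coeff i)
  rwa [zero_pow (by omega), mul_zero] at this

/-! ### Leading recursions -/

/-- The word `P (u P)^m W`. -/
noncomputable def repWord (I J : Finset ℕ) (W : Matrix J J (PolyAlg J)) :
    ℕ → Matrix J J (PolyAlg J)
  | 0 => projMat I J * W
  | m + 1 => projMat I J * (uMat J * repWord I J W m)

theorem isWord_repWord {I J : Finset ℕ} {W : Matrix J J (PolyAlg J)} {n : ℕ} (hW : IsWord n W)
    (m : ℕ) : IsWord (n + m) (repWord I J W m) := by
  induction m with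
  | zero => exact hW.proj_mul I
  | succ m ih => exact .cons I ih

theorem projMat_mul_repWord (I J : Finset ℕ) (W : Matrix J J (PolyAlg J)) (m : ℕ) :
    projMat I J * repWord I J W m = repWord I J W m := by
  cases m <;> rw [repWord, ← Matrix.mul_assoc, projMat_mul_projMat, Finset.inter_self]

theorem scaledF_apply {L : ℕ} (hL : L ≠ 0) (R : Matrix (J L) (J L) (PolyAlg (J L))) :
    scaledF I J gam L R = (gam : ℂ) • (projMat (I L) (J L) * (projMat (I L) (J L) * R)) +
      (gam : ℂ) • (projMat (I L) (J L) * (uMat (J L) * (projMat (I L) (J L) * R))) +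
        (L : ℂ)⁻¹ • (projMat (I L) (J L) * contract (projMat (I L) (J L)) R) := by
  have e : (L : ℂ)⁻¹ * ((gam * L : ℝ) : ℂ) = gam := by
    have : (L : ℂ) ≠ 0 := Nat.cast_ne_zero.2 hL
    push_cast; field_simp
  rw [scaledF, LinearMap.smul_apply, matF_eq, xMat_eq, Matrix.mul_add, Matrix.mul_one,
    Matrix.add_mul, smul_add, smul_smul, smul_add, e, Matrix.mul_assoc]

/-- The action of `F` on a word beginning with `P u`. -/
theorem scaledF_cons (hI : ∀ L, I L ⊆ J L) {S : ℕ → Finset ℕ} {n : ℕ}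
    {W : ∀ L, Matrix (J L) (J L) (PolyAlg (J L))} (hW : ∀ L, IsWord n (W L)) {a : ℝ}
    (hS : Tendsto (fun L : ℕ => ((I L ∩ S L).card : ℝ) / L) atTop (𝓝 a)) :
    ∃ N : ∀ L, Matrix (J L) (J L) (PolyAlg (J L)), SizeNull N ∧ ∀ L : ℕ, L ≠ 0 →
      scaledF I J gam L (projMat (S L) (J L) * (uMat (J L) * W L)) =
        (gam : ℂ) • (projMat (I L) (J L) * (projMat (S L) (J L) * (uMat (J L) * W L))) +
        (gam : ℂ) • (projMat (I L) (J L) * (uMat (J L) *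
          (projMat (I L) (J L) * (projMat (S L) (J L) * (uMat (J L) * W L))))) +
        (a : ℂ) • (projMat (I L) (J L) * W L) + N L := by
  have hc : Tendsto (fun L : ℕ => (((I L ∩ S L).card : ℝ) / L : ℝ) - (a : ℂ)) atTop (𝓝 0) := by
    have := (Complex.continuous_ofReal.tendsto a).comp hS
    simpa using this.sub_const (a : ℂ)
  have h0 : Tendsto (fun L : ℕ => (L : ℂ)⁻¹) atTop (𝓝 0) := tendsto_inv_atTop_nhds_zero_nat
  have b1 : SizeBounded fun L => projMat (I L) (J L) * W L :=
    ⟨n, 1, .of_forall fun L => (IsTerm.word ((hW L).proj_mul _)).hasSize le_rfl⟩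
  have b2 : SizeBounded fun L => projMat (I L) (J L) * (contract (projMat (I L) (J L))
      (projMat (S L) (J L) * (uMat (J L) * W L)) - ((I L ∩ S L).card : ℂ) • W L) :=
    ⟨0 + (n + 1), 2 * n + 1, .of_forall fun L =>
      ((hW L).hasSize_contract_proj (I L) (S L) (hI L)).term_mul (.word (.proj _))⟩
  -- Two errors: the difference between |I ∩ S|/L and its limit, and 1/L times the non-leading part
  -- of the contraction.
  refine ⟨_, (b1.smul_null hc).add (b2.smul_null h0), fun L hL => ?_⟩
  rw [scaledF_apply hL]
  have e1 : projMat (I L) (J L) * (projMat (I L) (J L) *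
      (projMat (S L) (J L) * (uMat (J L) * W L))) =
      projMat (I L) (J L) * (projMat (S L) (J L) * (uMat (J L) * W L)) := by
    rw [← Matrix.mul_assoc, projMat_mul_projMat, Finset.inter_self]
  rw [e1, Matrix.mul_sub, smul_sub, Matrix.mul_smul, smul_smul, add_assoc _ ((a : ℂ) • _)]
  congr 1
  push_cast
  rw [sub_smul, div_eq_inv_mul]
  abel

theorem scaledF_proj {L : ℕ} (hL : L ≠ 0) (T : Finset ℕ) :
    scaledF I J gam L (projMat T (J L)) =
      (gam : ℂ) • (projMat (I L) (J L) * projMat T (J L)) +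
        (gam : ℂ) • (projMat (I L) (J L) * (uMat (J L) *
          (projMat (I L) (J L) * projMat T (J L)))) := by
  rw [scaledF_apply hL, contract_projMat, Matrix.mul_zero, smul_zero, add_zero]
  congr 2
  rw [← Matrix.mul_assoc, projMat_mul_projMat, Finset.inter_self]

variable {I₂ : ℕ → Finset ℕ} {eta₁ eta₂ c : ℝ}

/-- Limits of the vacuum traces of powers of `F` applied to words. -/
theorem tendsto_vacTrace_scaledF_pow (hI : ∀ L, I L ⊆ J L)
    (h₁ : Tendsto (fun L : ℕ => ((I L).card : ℝ) / L) atTop (𝓝 eta₁))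
    (hc : Tendsto (fun L : ℕ => ((I L ∩ I₂ L).card : ℝ) / L) atTop (𝓝 c))
    {lam : ℕ → ℕ → ℕ → ℝ} (h0 : ∀ i j, lam 0 i j = if i = 0 ∧ j = 0 then c else 0)
    (hs : ∀ a i j, lam (a + 1) (i + 1) j =
      gam * lam a (i + 1) j + gam * lam a (i + 2) j + eta₁ * lam a i j)
    (hz : ∀ a j, lam (a + 1) 0 (j + 1) =
      gam * lam a 0 (j + 1) + gam * lam a 1 (j + 1) + c * lam a 0 j)
    (hzz : ∀ a, lam (a + 1) 0 0 = gam * lam a 0 0 + gam * lam a 1 0) (a : ℕ) :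
    ∀ i j, Tendsto (fun L : ℕ => (L : ℂ)⁻¹ * vacTrace (I L) (J L) ((scaledF I J gam L ^ a)
      (repWord (I L) (J L) (repWord (I₂ L) (J L) (projMat (I₂ L) (J L)) j) i)))
      atTop (𝓝 (lam a i j : ℂ)) := by
  have hV : ∀ L j, IsWord j (repWord (I₂ L) (J L) (projMat (I₂ L) (J L)) j) := fun L j => by
    simpa using isWord_repWord (I := I₂ L) (IsWord.proj (J := J L) (I₂ L)) j
  have hW : ∀ L j i, IsWord (j + i)
      (repWord (I L) (J L) (repWord (I₂ L) (J L) (projMat (I₂ L) (J L)) j) i) := fun L j i =>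
    isWord_repWord (hV L j) i
  induction a with
  | zero =>
    intro i j
    rw [h0]
    simp only [pow_zero, Module.End.one_apply]
    split_ifs with h
    · obtain ⟨rfl, rfl⟩ := h
      have e := (Complex.continuous_ofReal.tendsto c).comp hc
      refine e.congr fun L => ?_
      rw [repWord, repWord, projMat_mul_projMat, projMat_mul_projMat, norm_vacTrace_projMat (hI L),
        Finset.inter_self, ← Finset.inter_assoc, Finset.inter_self, Function.comp_apply]
      push_cast
      rw [div_eq_inv_mul]
    · refine tendsto_const_nhds.congr fun L => ?_
      rw [(IsTerm.word (hW L j i)).vacTrace_eq_zero (by omega), mul_zero, Complex.ofReal_zero]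
  | succ a ih =>
    -- reduce to a decomposition up to null sequences
    have fin : ∀ (R T₁ T₂ T₃ N : ∀ L, Matrix (J L) (J L) (PolyAlg (J L))) (x₁ x₂ x₃ b : ℝ),
        SizeNull N → (∀ L : ℕ, L ≠ 0 → scaledF I J gam L (R L) =
          (gam : ℂ) • T₁ L + (gam : ℂ) • T₂ L + (b : ℂ) • T₃ L + N L) →
        Tendsto (fun L : ℕ => (L : ℂ)⁻¹ * vacTrace (I L) (J L) ((scaledF I J gam L ^ a) (T₁ L)))
          atTop (𝓝 (x₁ : ℂ)) →
        Tendsto (fun L : ℕ => (L : ℂ)⁻¹ * vacTrace (I L) (J L) ((scaledF I J gam L ^ a) (T₂ L)))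
          atTop (𝓝 (x₂ : ℂ)) →
        Tendsto (fun L : ℕ => (L : ℂ)⁻¹ * vacTrace (I L) (J L) ((scaledF I J gam L ^ a) (T₃ L)))
          atTop (𝓝 (x₃ : ℂ)) →
        Tendsto (fun L : ℕ => (L : ℂ)⁻¹ * vacTrace (I L) (J L)
          ((scaledF I J gam L ^ (a + 1)) (R L))) atTop
          (𝓝 ((gam * x₁ + gam * x₂ + b * x₃ : ℝ) : ℂ)) := by
      intro R T₁ T₂ T₃ N x₁ x₂ x₃ b hN hR l1 l2 l3
      have l4 := (hN.scaledF_pow (gam := gam) hI h₁ a).tendsto_vacTrace hI h₁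
      have := (((l1.const_mul (gam : ℂ)).add (l2.const_mul (gam : ℂ))).add
        (l3.const_mul (b : ℂ))).add l4
      rw [add_zero] at this
      push_cast
      refine this.congr' ?_
      filter_upwards [eventually_ne_atTop 0] with L hL
      rw [pow_succ, Module.End.mul_apply, hR L hL]
      simp only [map_add, map_smul, smul_eq_mul]
      ring
    intro i j
    rcases i with _ | i
    · rcases j with _ | j
      -- Without letters nothing can be removed: the contraction of a projection is zero.
      · rw [hzz]
        have := fin (fun L => repWord (I L) (J L) (repWord (I₂ L) (J L) (projMat (I₂ L) (J L)) 0) 0)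
          _ _ (fun _ => 0) (fun _ => 0) _ _ 0 0 sizeNull_zero (fun L hL => ?_) (ih 0 0) (ih 1 0)
          (by simp)
        · simpa using this
        · simp only [repWord]
          rw [projMat_mul_projMat, projMat_mul_projMat, scaledF_proj hL]
          rw [projMat_mul_projMat, Finset.inter_self, ← Finset.inter_assoc, Finset.inter_self]
          simp
      -- No letter of the first block is left, so the outer projection is that of I ∩ I₂. Removing
      -- the first letter of the second block has the limiting weight c.
      · rw [hz]
        obtain ⟨N, hN, hR⟩ := scaledF_cons (gam := gam) (S := fun L => I L ∩ I₂ L) hI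
          (fun L => hV L j) (a := c) (by simpa [← Finset.inter_assoc] using hc)
        refine fin _ _ _ _ N _ _ _ c hN (fun L hL => ?_) (ih 0 (j + 1)) (ih 1 (j + 1)) (ih 0 j)
        have e : repWord (I L) (J L) (repWord (I₂ L) (J L) (projMat (I₂ L) (J L)) (j + 1)) 0 =
            projMat (I L ∩ I₂ L) (J L) *
              (uMat (J L) * repWord (I₂ L) (J L) (projMat (I₂ L) (J L)) j) := by
          rw [repWord, repWord, ← Matrix.mul_assoc, projMat_mul_projMat]
        rw [e, hR L hL]
        have e2 : projMat (I L) (J L) * (projMat (I L ∩ I₂ L) (J L) *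
              (uMat (J L) * repWord (I₂ L) (J L) (projMat (I₂ L) (J L)) j)) =
            projMat (I L ∩ I₂ L) (J L) *
              (uMat (J L) * repWord (I₂ L) (J L) (projMat (I₂ L) (J L)) j) := by
          rw [← Matrix.mul_assoc, projMat_mul_projMat, ← Finset.inter_assoc, Finset.inter_self]
        rw [e2, ← e]
        rfl
    -- Here the first letter follows the projection of I, and its removal has the limiting weight
    -- η₁.
    · rw [hs]
      obtain ⟨N, hN, hR⟩ := scaledF_cons (gam := gam) (S := I) hI (fun L => hW L j i) (a := eta₁)
        (by simpa using h₁)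
      refine fin _ _ _ _ N _ _ _ eta₁ hN (fun L hL => ?_) (ih (i + 1) j) (ih (i + 2) j) (ih i j)
      have e := hR L hL
      have e2 : projMat (I L) (J L) * (projMat (I L) (J L) * (uMat (J L) *
          repWord (I L) (J L) (repWord (I₂ L) (J L) (projMat (I₂ L) (J L)) j) i)) =
          projMat (I L) (J L) * (uMat (J L) *
          repWord (I L) (J L) (repWord (I₂ L) (J L) (projMat (I₂ L) (J L)) j) i) := by
        rw [← Matrix.mul_assoc, projMat_mul_projMat, Finset.inter_self]
      rw [e2, projMat_mul_repWord] at e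
      exact e

end Asymptotics

/-! ### The limit of the covariance in terms of recursions -/

section Covariance

variable {J I₁ I₂ : ℕ → Finset ℕ} {gam eta₁ eta₂ c : ℝ}

theorem matF_projMat_mul (I J : Finset ℕ) (s : ℂ) (R : Matrix J J (PolyAlg J)) :
    matF I J s (projMat I J * R) = matF I J s R := by
  ext1 c p
  rw [matF_apply, matF_apply]
  split_ifs
  · refine Finset.sum_congr rfl fun b _ => ?_
    split_ifs with hb
    · rw [projMat_mul_apply, if_pos hb]
    · rfl
  · rfl

theorem vacTrace_projMat_mul (I J : Finset ℕ) (R : Matrix J J (PolyAlg J)) :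
    vacTrace I J (projMat I J * R) = vacTrace I J R := by
  rw [vacTrace_apply, vacTrace_apply]
  refine Finset.sum_congr rfl fun j _ => ?_
  split_ifs with hj
  · rw [projMat_mul_apply, if_pos hj]
  · rfl

/-- Both F and the trace over I₁ see only the rows in I₁. Thus words over I₂ may be treated as words
with an empty first block. -/
theorem vacTrace_scaledF_pow_projMat_mul (a L : ℕ) (R : Matrix (J L) (J L) (PolyAlg (J L))) :
    vacTrace (I₁ L) (J L) ((scaledF I₁ J gam L ^ a) (projMat (I₁ L) (J L) * R)) =
      vacTrace (I₁ L) (J L) ((scaledF I₁ J gam L ^ a) R) := by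
  rcases a with _ | a
  · exact vacTrace_projMat_mul _ _ _
  · have h : scaledF I₁ J gam L (projMat (I₁ L) (J L) * R) = scaledF I₁ J gam L R := by
      rw [scaledF, LinearMap.smul_apply, LinearMap.smul_apply, matF_projMat_mul]
    rw [pow_succ, Module.End.mul_apply, Module.End.mul_apply, h]

/-- Limits of linear functionals of powers of `F` applied to words. -/
theorem tendsto_functional_scaledF_pow (hI : ∀ L, I₂ L ⊆ J L)
    (h₂ : Tendsto (fun L : ℕ => ((I₂ L).card : ℝ) / L) atTop (𝓝 eta₂))
    (Φ : ∀ L, Matrix (J L) (J L) (PolyAlg (J L)) →ₗ[ℂ] ℂ)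
    (hΦ : ∀ N : ∀ L, Matrix (J L) (J L) (PolyAlg (J L)), SizeNull N →
      Tendsto (fun L => Φ L (N L)) atTop (𝓝 0))
    {the : ℕ → ℕ → ℝ}
    (h0 : ∀ m, Tendsto (fun L => Φ L (repWord (I₂ L) (J L) (projMat (I₂ L) (J L)) m)) atTop
      (𝓝 (the 0 m : ℂ)))
    (hs : ∀ b m, the (b + 1) (m + 1) =
      gam * the b (m + 1) + gam * the b (m + 2) + eta₂ * the b m)
    (hz : ∀ b, the (b + 1) 0 = gam * the b 0 + gam * the b 1) (b : ℕ) :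
    ∀ m, Tendsto (fun L => Φ L ((scaledF I₂ J gam L ^ b)
      (repWord (I₂ L) (J L) (projMat (I₂ L) (J L)) m))) atTop (𝓝 (the b m : ℂ)) := by
  have hV : ∀ L j, IsWord j (repWord (I₂ L) (J L) (projMat (I₂ L) (J L)) j) := fun L j => by
    simpa using isWord_repWord (I := I₂ L) (IsWord.proj (J := J L) (I₂ L)) j
  induction b with
  | zero => exact h0
  | succ b ih =>
    intro m
    rcases m with _ | m
    · rw [hz]
      have := ((ih 0).const_mul (gam : ℂ)).add ((ih 1).const_mul (gam : ℂ))
      push_cast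
      refine this.congr' ?_
      filter_upwards [eventually_ne_atTop 0] with L hL
      have e : scaledF I₂ J gam L (repWord (I₂ L) (J L) (projMat (I₂ L) (J L)) 0) =
          (gam : ℂ) • repWord (I₂ L) (J L) (projMat (I₂ L) (J L)) 0 +
          (gam : ℂ) • repWord (I₂ L) (J L) (projMat (I₂ L) (J L)) 1 := by
        simp only [repWord, projMat_mul_projMat, Finset.inter_self]
        rw [scaledF_proj hL, projMat_mul_projMat, Finset.inter_self]
      rw [pow_succ, Module.End.mul_apply, e]
      simp only [map_add, map_smul, smul_eq_mul]
    · rw [hs]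
      obtain ⟨N, hN, hR⟩ := scaledF_cons (gam := gam) (S := I₂) hI (fun L => hV L m) (a := eta₂)
        (by simpa using h₂)
      have l4 := hΦ _ (hN.scaledF_pow (gam := gam) hI h₂ b)
      have := ((((ih (m + 1)).const_mul (gam : ℂ)).add ((ih (m + 2)).const_mul (gam : ℂ))).add
        ((ih m).const_mul (eta₂ : ℂ))).add l4
      rw [add_zero] at this
      push_cast
      refine this.congr' ?_
      filter_upwards [eventually_ne_atTop 0] with L hL
      have e := hR L hL
      have e2 : projMat (I₂ L) (J L) * (projMat (I₂ L) (J L) * (uMat (J L) *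
          repWord (I₂ L) (J L) (projMat (I₂ L) (J L)) m)) =
          projMat (I₂ L) (J L) * (uMat (J L) *
          repWord (I₂ L) (J L) (projMat (I₂ L) (J L)) m) := by
        rw [← Matrix.mul_assoc, projMat_mul_projMat, Finset.inter_self]
      rw [e2, projMat_mul_repWord] at e
      have e3 : scaledF I₂ J gam L (repWord (I₂ L) (J L) (projMat (I₂ L) (J L)) (m + 1)) =
          (gam : ℂ) • repWord (I₂ L) (J L) (projMat (I₂ L) (J L)) (m + 1) +
          (gam : ℂ) • repWord (I₂ L) (J L) (projMat (I₂ L) (J L)) (m + 2) +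
          (eta₂ : ℂ) • repWord (I₂ L) (J L) (projMat (I₂ L) (J L)) m + N L := e
      rw [pow_succ, Module.End.mul_apply, e3]
      simp only [map_add, map_smul, smul_eq_mul]

theorem state_algebraMap_mul {J : Finset ℕ} (s : ℝ) (r : ℂ) (Z : Ugl J) :
    state J s (algebraMap ℂ _ r * Z) = r * state J s Z := by
  rw [state_eq, state_eq, map_mul, AlgHom.commutes, Module.End.mul_apply,
    Module.algebraMap_end_apply, MvPolynomial.smul_eq_C_mul, map_mul,
    MvPolynomial.constantCoeff_C]

theorem state_sub {J : Finset ℕ} (s : ℝ) (Z Z' : Ugl J) :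
    state J s (Z - Z') = state J s Z - state J s Z' := by
  rw [state_eq, state_eq, state_eq, map_sub, LinearMap.sub_apply, map_sub]

theorem state_one (J : Finset ℕ) (s : ℝ) : state J s 1 = 1 := by
  rw [state_eq, map_one (polyAct J s), Module.End.one_apply, map_one]

theorem state_fluctuation_mul (gam : ℝ) (L k l : ℕ) {I₁ I₂ J : Finset ℕ} (h₁ : I₁ ⊆ J)
    (h₂ : I₂ ⊆ J) :
    state J (gam * L) (fluctuation gam L k h₁ * fluctuation gam L l h₂) =
      ((L : ℂ) ^ k)⁻¹ * ((L : ℂ) ^ l)⁻¹ *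
        (state J (gam * L) (UglIncl h₁ (pElt k I₁) * UglIncl h₂ (pElt l I₂)) -
          state J (gam * L) (UglIncl h₁ (pElt k I₁)) *
            state J (gam * L) (UglIncl h₂ (pElt l I₂))) := by
  set f := UglIncl h₁ (pElt k I₁)
  set g := UglIncl h₂ (pElt l I₂)
  set s := gam * (L : ℝ)
  have e : fluctuation gam L k h₁ * fluctuation gam L l h₂ =
      algebraMap ℂ (Ugl J) (((L : ℂ) ^ k)⁻¹ * ((L : ℂ) ^ l)⁻¹) *
        ((f * g - algebraMap ℂ (Ugl J) (state J s f) * g) -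
          (algebraMap ℂ (Ugl J) (state J s g) * f -
            algebraMap ℂ (Ugl J) (state J s f) * (algebraMap ℂ (Ugl J) (state J s g) * 1))) := by
    have hc : f * algebraMap ℂ (Ugl J) (state J s g) = algebraMap ℂ (Ugl J) (state J s g) * f :=
      (Algebra.commutes _ _).symm
    have e0 : (f - algebraMap ℂ (Ugl J) (state J s f)) * (g - algebraMap ℂ (Ugl J) (state J s g)) =
        (f * g - algebraMap ℂ (Ugl J) (state J s f) * g) -
          (algebraMap ℂ (Ugl J) (state J s g) * f -
            algebraMap ℂ (Ugl J) (state J s f) * (algebraMap ℂ (Ugl J) (state J s g) * 1)) := by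
      rw [sub_mul, mul_sub, mul_sub, hc, mul_one]
      abel
    rw [← e0, ← Algebra.smul_def, fluctuation, fluctuation, smul_mul_assoc, mul_smul_comm,
      smul_smul]
  rw [e, state_algebraMap_mul, state_sub, state_sub, state_sub, state_algebraMap_mul,
    state_algebraMap_mul, state_algebraMap_mul, state_algebraMap_mul, state_one]
  ring

/-- The limit of the covariance, in terms of solutions of recursions. -/
theorem tendsto_state_fluctuation_mul (hJ₁ : ∀ L, I₁ L ⊆ J L) (hJ₂ : ∀ L, I₂ L ⊆ J L)
    (h₁ : Tendsto (fun L : ℕ => ((I₁ L).card : ℝ) / L) atTop (𝓝 eta₁))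
    (h₂ : Tendsto (fun L : ℕ => ((I₂ L).card : ℝ) / L) atTop (𝓝 eta₂))
    (hc : Tendsto (fun L : ℕ => ((I₁ L ∩ I₂ L).card : ℝ) / L) atTop (𝓝 c))
    {lam : ℕ → ℕ → ℕ → ℝ} (hl0 : ∀ i j, lam 0 i j = if i = 0 ∧ j = 0 then c else 0)
    (hls : ∀ a i j, lam (a + 1) (i + 1) j =
      gam * lam a (i + 1) j + gam * lam a (i + 2) j + eta₁ * lam a i j)
    (hlz : ∀ a j, lam (a + 1) 0 (j + 1) =
      gam * lam a 0 (j + 1) + gam * lam a 1 (j + 1) + c * lam a 0 j)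
    (hlzz : ∀ a, lam (a + 1) 0 0 = gam * lam a 0 0 + gam * lam a 1 0) (a b : ℕ)
    {the : ℕ → ℕ → ℝ} (ht0 : ∀ m : ℕ, the 0 m = lam a 0 m / (m + 1))
    (hts : ∀ b m, the (b + 1) (m + 1) =
      gam * the b (m + 1) + gam * the b (m + 2) + eta₂ * the b m)
    (htz : ∀ b, the (b + 1) 0 = gam * the b 0 + gam * the b 1) :
    Tendsto (fun L : ℕ => state (J L) (gam * L)
      (fluctuation gam L (a + 1) (hJ₁ L) * fluctuation gam L (b + 1) (hJ₂ L))) atTop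
      (𝓝 (((a + 1) * (b + 1) * (gam * the b 0) : ℝ) : ℂ)) := by
  -- the functional `R ↦ L⁻¹ vacTrace (F₁ ^ a (∫ R))`
  let Φ : ∀ L, Matrix (J L) (J L) (PolyAlg (J L)) →ₗ[ℂ] ℂ := fun L =>
    (L : ℂ)⁻¹ • (vacTrace (I₁ L) (J L)).comp ((scaledF I₁ J gam L ^ a).comp (matInt (J L)))
  have hΦ_apply : ∀ L R, Φ L R = (L : ℂ)⁻¹ * vacTrace (I₁ L) (J L)
      ((scaledF I₁ J gam L ^ a) (matInt (J L) R)) := fun L R => rfl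
  have hΦ : ∀ N : ∀ L, Matrix (J L) (J L) (PolyAlg (J L)), SizeNull N →
      Tendsto (fun L => Φ L (N L)) atTop (𝓝 0) := fun N hN =>
    (hN.matInt.scaledF_pow (gam := gam) hJ₁ h₁ a).tendsto_vacTrace hJ₁ h₁
  have hV : ∀ L j, IsWord j (repWord (I₂ L) (J L) (projMat (I₂ L) (J L)) j) := fun L j => by
    simpa using isWord_repWord (I := I₂ L) (IsWord.proj (J := J L) (I₂ L)) j
  have h0 : ∀ m, Tendsto (fun L => Φ L (repWord (I₂ L) (J L) (projMat (I₂ L) (J L)) m)) atTop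
      (𝓝 (the 0 m : ℂ)) := by
    intro m
    -- Radial integration divides a word with m letters by m + 1; hence the denominator in the
    -- initial condition of `the`.
    have := (tendsto_vacTrace_scaledF_pow hJ₁ h₁ hc hl0 hls hlz hlzz a 0 m).const_mul
      (((m : ℂ) + 1)⁻¹)
    rw [ht0]
    push_cast
    rw [div_eq_inv_mul]
    refine this.congr fun L => ?_
    rw [hΦ_apply, (IsTerm.word (hV L m)).matInt, map_smul, map_smul, smul_eq_mul, repWord,
      vacTrace_scaledF_pow_projMat_mul]
    ring
  have hmain := tendsto_functional_scaledF_pow (gam := gam) hJ₂ h₂ Φ hΦ h0 hts htz b 0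
  have bV : SizeBounded fun L => projMat (I₂ L) (J L) :=
    ⟨0, 1, .of_forall fun L => (IsTerm.word (.proj _)).hasSize le_rfl⟩
  obtain ⟨N₂, hN₂, hG₂⟩ := bV.aeval_gPoly (gam := gam) hJ₂ h₂ b
  have b2 : SizeBounded fun L => ((b : ℂ) + 1) •
      (scaledF I₂ J gam L ^ b) (projMat (I₂ L) (J L)) + N₂ L :=
    ((bV.scaledF_pow hJ₂ h₂ b).smul _).add hN₂.bounded
  obtain ⟨N₁, hN₁, hG₁⟩ := b2.matInt.aeval_gPoly (gam := gam) hJ₁ h₁ a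
  have l1 := (((hmain.const_mul ((b : ℂ) + 1)).add (hΦ N₂ hN₂)).const_mul ((a : ℂ) + 1)).add
    (hN₁.tendsto_vacTrace hJ₁ h₁)
  have l2 := l1.const_mul (gam : ℂ)
  have elim : (gam : ℂ) * (((a : ℂ) + 1) * (((b : ℂ) + 1) * (the b 0 : ℂ) + 0) + 0) =
      (((a + 1) * (b + 1) * (gam * the b 0) : ℝ) : ℂ) := by push_cast; ring
  rw [elim] at l2
  refine l2.congr' ?_
  filter_upwards [eventually_ne_atTop 0] with L hL
  have hL0 : (L : ℂ) ≠ 0 := Nat.cast_ne_zero.2 hL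
  rw [state_fluctuation_mul, state_mul_sub (hJ₁ L) (hJ₂ L) (gam * L)
    (pElt_correspondsTo (a + 1) (I₁ L)) (pElt_correspondsTo (b + 1) (I₂ L))]
  set G₁ := Polynomial.aeval (matF (I₁ L) (J L) ((gam * L : ℝ) : ℂ)) (gPoly (a + 1)) with hG₁def
  set Q := Polynomial.aeval (matF (I₂ L) (J L) ((gam * L : ℝ) : ℂ)) (gPoly (b + 1))
    (projMat (I₂ L) (J L)) with hQ
  have eV : repWord (I₂ L) (J L) (projMat (I₂ L) (J L)) 0 = projMat (I₂ L) (J L) := by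
    rw [repWord, projMat_mul_projMat, Finset.inter_self]
  have e1 := hG₁ L hL
  rw [← hG₂ L hL, ← hQ, ← hG₁def] at e1
  have e3 : ((L : ℂ) ^ a)⁻¹ * (((L : ℂ) ^ b)⁻¹ * vacTrace (I₁ L) (J L) (G₁ (matInt (J L) Q))) =
      vacTrace (I₁ L) (J L) (((a : ℂ) + 1) • (scaledF I₁ J gam L ^ a) (matInt (J L)
        (((L : ℂ) ^ b)⁻¹ • Q)) + N₁ L) := by
    rw [← e1]
    simp only [map_smul, smul_eq_mul]
  -- Power counting: the factor s = γL absorbs one power, leaving L⁻¹ for the trace and L^{-a},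
  -- L^{-b} for polynomials in F of degrees a and b.
  have e4 : ((L : ℂ) ^ (a + 1))⁻¹ * ((L : ℂ) ^ (b + 1))⁻¹ * (((gam * L : ℝ) : ℂ) *
      vacTrace (I₁ L) (J L) (G₁ (matInt (J L) Q))) = gam * ((L : ℂ)⁻¹ *
      (((L : ℂ) ^ a)⁻¹ * (((L : ℂ) ^ b)⁻¹ * vacTrace (I₁ L) (J L) (G₁ (matInt (J L) Q))))) := by
    push_cast
    field_simp
    ring
  rw [e4, e3, hG₂ L hL, hΦ_apply, hΦ_apply, eV]
  simp only [map_add, map_smul, smul_eq_mul]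
  ring

end Covariance

/-! ### The logarithmic kernel -/

open MeasureTheory

/-- The distance from `q` to the point `e^{iα}` of the unit circle. -/
noncomputable def arcDist (q α : ℝ) : ℝ := ‖(q : ℂ) - Complex.exp (α * Complex.I)‖

/-- The kernel `ln |(q - e^{i(θ+φ)}) / (q - e^{i(θ-φ)})|`. -/
noncomputable def arcKernel (q θ φ : ℝ) : ℝ :=
  Real.log (arcDist q (θ + φ) / arcDist q (θ - φ))

theorem continuous_arcDist : Continuous fun p : ℝ × ℝ => arcDist p.1 p.2 := by
  unfold arcDist; fun_prop

theorem measurable_arcKernel (q : ℝ) : Measurable fun p : ℝ × ℝ => arcKernel q p.1 p.2 := by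
  have h1 : Measurable fun p : ℝ × ℝ => arcDist q (p.1 + p.2) :=
    (continuous_arcDist.comp (f := fun p : ℝ × ℝ => (q, p.1 + p.2)) (by fun_prop)).measurable
  have h2 : Measurable fun p : ℝ × ℝ => arcDist q (p.1 - p.2) :=
    (continuous_arcDist.comp (f := fun p : ℝ × ℝ => (q, p.1 - p.2)) (by fun_prop)).measurable
  exact Real.measurable_log.comp (h1.div h2)

theorem arcDist_sq (q α : ℝ) : arcDist q α ^ 2 = 1 - 2 * q * Real.cos α + q ^ 2 := by
  rw [arcDist, Complex.sq_norm, Complex.normSq_apply, Complex.sub_re, Complex.sub_im,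
    Complex.exp_ofReal_mul_I_re, Complex.exp_ofReal_mul_I_im, Complex.ofReal_re, Complex.ofReal_im]
  nlinarith [Real.sin_sq_add_cos_sq α]

theorem arcDist_le {q : ℝ} (h0 : 0 ≤ q) (h1 : q ≤ 1) (α : ℝ) : arcDist q α ≤ 2 := by
  refine (norm_sub_le _ _).trans ?_
  rw [Complex.norm_exp_ofReal_mul_I, Complex.norm_real, Real.norm_eq_abs, abs_of_nonneg h0]
  linarith

/-- A lower bound uniform in q, which controls the logarithmic singularity up to q = 1. -/
theorem abs_sin_le_arcDist (q α : ℝ) : |Real.sin α| ≤ arcDist q α := by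
  have := Complex.abs_im_le_norm ((q : ℂ) - Complex.exp (α * Complex.I))
  rwa [Complex.sub_im, Complex.exp_ofReal_mul_I_im, Complex.ofReal_im, zero_sub, abs_neg] at this

theorem one_sub_le_arcDist {q : ℝ} (h0 : 0 ≤ q) (α : ℝ) : 1 - q ≤ arcDist q α := by
  have := norm_sub_norm_le (Complex.exp (α * Complex.I)) (q : ℂ)
  rwa [Complex.norm_exp_ofReal_mul_I, Complex.norm_real, Real.norm_eq_abs, abs_of_nonneg h0,
    norm_sub_rev] at this

theorem abs_log_arcDist_le {q : ℝ} (h0 : 0 ≤ q) (h1 : q ≤ 1) {α : ℝ} (hα : Real.sin α ≠ 0) :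
    |Real.log (arcDist q α)| ≤ Real.log 2 + |Real.log (Real.sin α)| := by
  have hpos : 0 < |Real.sin α| := abs_pos.2 hα
  have h2 := Real.log_le_log hpos (abs_sin_le_arcDist q α)
  have h3 := Real.log_le_log (hpos.trans_le (abs_sin_le_arcDist q α)) (arcDist_le h0 h1 α)
  rw [Real.log_abs] at h2
  have h4 : 0 ≤ Real.log 2 := Real.log_nonneg one_le_two
  rw [abs_le]
  constructor
  · linarith [neg_abs_le (Real.log (Real.sin α))]
  · linarith [abs_nonneg (Real.log (Real.sin α))]

/-- An integrable bound for the kernel. -/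
noncomputable def kernelBound (θ φ : ℝ) : ℝ :=
  (Real.log 2 + |Real.log (Real.sin (θ + φ))|) + (Real.log 2 + |Real.log (Real.sin (θ - φ))|)

theorem abs_arcKernel_le {q : ℝ} (h0 : 0 ≤ q) (h1 : q ≤ 1) {θ φ : ℝ}
    (hp : Real.sin (θ + φ) ≠ 0) (hm : Real.sin (θ - φ) ≠ 0) :
    |arcKernel q θ φ| ≤ kernelBound θ φ := by
  have hx : arcDist q (θ + φ) ≠ 0 := ((abs_pos.2 hp).trans_le (abs_sin_le_arcDist q _)).ne'
  have hy : arcDist q (θ - φ) ≠ 0 := ((abs_pos.2 hm).trans_le (abs_sin_le_arcDist q _)).ne'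
  rw [arcKernel, Real.log_div hx hy]
  exact (abs_sub _ _).trans (add_le_add (abs_log_arcDist_le h0 h1 hp) (abs_log_arcDist_le h0 h1 hm))

theorem ae_sin_ne_zero (θ : ℝ) :
    ∀ᵐ φ : ℝ, Real.sin (θ + φ) ≠ 0 ∧ Real.sin (θ - φ) ≠ 0 := by
  have h1 : (Set.range fun n : ℤ => n * Real.pi - θ).Countable := Set.countable_range _
  have h2 : (Set.range fun n : ℤ => θ - n * Real.pi).Countable := Set.countable_range _
  filter_upwards [h1.ae_notMem volume, h2.ae_notMem volume] with φ a1 a2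
  constructor
  · intro h
    obtain ⟨n, hn⟩ := Real.sin_eq_zero_iff.1 h
    exact a1 ⟨n, by simp only [hn]; ring⟩
  · intro h
    obtain ⟨n, hn⟩ := Real.sin_eq_zero_iff.1 h
    exact a2 ⟨n, by simp only [hn]; ring⟩

theorem intervalIntegrable_abs_log_sin (a b : ℝ) :
    IntervalIntegrable (fun x => |Real.log (Real.sin x)|) volume a b :=
  (intervalIntegrable_log_sin (a := a) (b := b)).abs

theorem intervalIntegrable_kernelBound (θ : ℝ) :
    IntervalIntegrable (kernelBound θ) volume 0 Real.pi := by
  have h1 : IntervalIntegrable (fun φ => |Real.log (Real.sin (θ + φ))|) volume 0 Real.pi := by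
    have := (intervalIntegrable_abs_log_sin (θ + 0) (θ + Real.pi)).comp_add_left θ
    simpa using this
  have h2 : IntervalIntegrable (fun φ => |Real.log (Real.sin (θ - φ))|) volume 0 Real.pi := by
    have := (intervalIntegrable_abs_log_sin (θ - 0) (θ - Real.pi)).comp_sub_left θ
    simpa using this
  exact (intervalIntegrable_const.add h1).add (intervalIntegrable_const.add h2)

/-- The bound is a sum of π-periodic functions of θ + φ and θ - φ, so its integral over one period
does not depend on θ. -/
theorem exists_integral_kernelBound : ∃ M : ℝ, ∀ θ,
    ∫ φ in (0 : ℝ)..Real.pi, kernelBound θ φ = M := by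
  refine ⟨(∫ φ in (0 : ℝ)..Real.pi, (Real.log 2 + |Real.log (Real.sin φ)|)) +
    ∫ φ in (0 : ℝ)..Real.pi, (Real.log 2 + |Real.log (Real.sin φ)|), fun θ => ?_⟩
  set f : ℝ → ℝ := fun x => Real.log 2 + |Real.log (Real.sin x)| with hf
  have hp : Function.Periodic f Real.pi := fun x => by
    simp only [hf, Real.sin_add_pi, Real.log_neg_eq_log]
  have hi : ∀ a b, IntervalIntegrable f volume a b := fun a b =>
    intervalIntegrable_const.add (intervalIntegrable_abs_log_sin a b)
  have h1 : IntervalIntegrable (fun φ => f (θ + φ)) volume 0 Real.pi := by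
    have := (hi (θ + 0) (θ + Real.pi)).comp_add_left θ
    simpa using this
  have h2 : IntervalIntegrable (fun φ => f (θ - φ)) volume 0 Real.pi := by
    have := (hi (θ - 0) (θ - Real.pi)).comp_sub_left θ
    simpa using this
  have e : ∫ φ in (0 : ℝ)..Real.pi, kernelBound θ φ =
      (∫ φ in (0 : ℝ)..Real.pi, f (θ + φ)) + ∫ φ in (0 : ℝ)..Real.pi, f (θ - φ) :=
    intervalIntegral.integral_add h1 h2
  rw [e, intervalIntegral.integral_comp_add_left, intervalIntegral.integral_comp_sub_left]
  congr 1
  · have := hp.intervalIntegral_add_eq (θ + 0) 0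
    rwa [zero_add, add_assoc, zero_add] at this
  · have := hp.intervalIntegral_add_eq (θ - Real.pi) 0
    rw [sub_zero]
    rwa [zero_add, sub_add_cancel] at this

theorem intervalIntegrable_arcKernel {q : ℝ} (h0 : 0 ≤ q) (h1 : q ≤ 1) (θ : ℝ) :
    IntervalIntegrable (arcKernel q θ) volume 0 Real.pi := by
  refine (intervalIntegrable_kernelBound θ).mono_fun
    ((measurable_arcKernel q).of_uncurry_left (x := θ)).aestronglyMeasurable ?_
  refine ae_restrict_of_ae ?_
  filter_upwards [ae_sin_ne_zero θ] with φ hφ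
  have := abs_arcKernel_le h0 h1 hφ.1 hφ.2
  rw [Real.norm_eq_abs, Real.norm_eq_abs]
  exact this.trans (le_abs_self _)

/-- Tonelli's theorem: the norms of the inner integrals are bounded by the constant of
`exists_integral_kernelBound`. -/
theorem integrable_arcKernel {q : ℝ} (h0 : 0 ≤ q) (h1 : q ≤ 1) :
    IntegrableOn (fun p : ℝ × ℝ => arcKernel q p.1 p.2)
      (Set.Ioc 0 Real.pi ×ˢ Set.Ioc 0 Real.pi) := by
  obtain ⟨M, hM⟩ := exists_integral_kernelBound
  have hm := (measurable_arcKernel q).aestronglyMeasurable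
    (μ := (volume.restrict (Set.Ioc 0 Real.pi)).prod (volume.restrict (Set.Ioc 0 Real.pi)))
  rw [IntegrableOn, Measure.volume_eq_prod, ← Measure.prod_restrict, integrable_prod_iff hm]
  have hi : ∀ θ, Integrable (arcKernel q θ) (volume.restrict (Set.Ioc 0 Real.pi)) := fun θ =>
    (intervalIntegrable_iff_integrableOn_Ioc_of_le Real.pi_nonneg).1
      (intervalIntegrable_arcKernel h0 h1 θ)
  have hb : ∀ θ, Integrable (kernelBound θ) (volume.restrict (Set.Ioc 0 Real.pi)) := fun θ =>
    (intervalIntegrable_iff_integrableOn_Ioc_of_le Real.pi_nonneg).1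
      (intervalIntegrable_kernelBound θ)
  refine ⟨.of_forall hi, ?_⟩
  refine Integrable.mono' (g := fun _ => M) (integrable_const M)
    hm.norm.integral_prod_right' (.of_forall fun θ => ?_)
  rw [Real.norm_eq_abs, abs_of_nonneg (integral_nonneg fun _ => norm_nonneg _), ← hM θ,
    intervalIntegral.integral_of_le Real.pi_nonneg]
  refine integral_mono_ae (hi θ).norm (hb θ) (ae_restrict_of_ae ?_)
  filter_upwards [ae_sin_ne_zero θ] with φ hφ
  exact abs_arcKernel_le h0 h1 hφ.1 hφ.2

/-! ### Sine expansion of the kernel -/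

theorem integral_cos_int_mul {n : ℤ} (hn : n ≠ 0) :
    ∫ φ in (0 : ℝ)..Real.pi, Real.cos (n * φ) = 0 := by
  have hn' : (n : ℝ) ≠ 0 := by exact_mod_cast hn
  rw [intervalIntegral.integral_comp_mul_left _ hn', integral_cos, Real.sin_int_mul_pi, mul_zero,
    Real.sin_zero, sub_zero, smul_zero]

theorem integral_sin_mul_sin (m n : ℕ) (hn : n ≠ 0) :
    ∫ φ in (0 : ℝ)..Real.pi, Real.sin (m * φ) * Real.sin (n * φ) =
      if m = n then Real.pi / 2 else 0 := by
  have e : ∀ φ : ℝ, Real.sin (m * φ) * Real.sin (n * φ) =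
      (Real.cos (((m - n : ℤ) : ℝ) * φ) - Real.cos (((m + n : ℤ) : ℝ) * φ)) / 2 := by
    intro φ
    push_cast
    rw [sub_mul, add_mul, Real.cos_sub, Real.cos_add]
    ring
  simp only [e]
  rw [intervalIntegral.integral_div, intervalIntegral.integral_sub
    (Continuous.intervalIntegrable (by fun_prop) _ _)
    (Continuous.intervalIntegrable (by fun_prop) _ _),
    integral_cos_int_mul (n := m + n) (by omega)]
  split_ifs with h
  · subst h; simp
  · rw [integral_cos_int_mul (by omega)]; simp

/-- The distances |q - e^{iα}| and |1 - q e^{iα}| agree, and the real part of the series of -log(1 -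
z) is taken at z = q e^{iα}. The term n = 0 vanishes because division by zero gives zero. -/
theorem hasSum_log_arcDist {q : ℝ} (h0 : 0 ≤ q) (h1 : q < 1) (α : ℝ) :
    HasSum (fun n : ℕ => q ^ n / n * Real.cos (n * α)) (-Real.log (arcDist q α)) := by
  set z : ℂ := q * Complex.exp (α * Complex.I) with hz
  have hz1 : ‖z‖ < 1 := by
    rw [hz, norm_mul, Complex.norm_exp_ofReal_mul_I, Complex.norm_real, Real.norm_eq_abs,
      abs_of_nonneg h0, mul_one]
    exact h1
  have h := Complex.hasSum_re (Complex.hasSum_taylorSeries_neg_log hz1)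
  have e1 : (-Complex.log (1 - z)).re = -Real.log (arcDist q α) := by
    rw [Complex.neg_re, Complex.log_re]
    congr 2
    have h0 : 0 ≤ arcDist q α := norm_nonneg _
    rw [← sq_eq_sq₀ (norm_nonneg _) h0, arcDist_sq, Complex.sq_norm,
      Complex.normSq_apply, Complex.sub_re, Complex.sub_im, hz, Complex.re_ofReal_mul,
      Complex.im_ofReal_mul, Complex.exp_ofReal_mul_I_re, Complex.exp_ofReal_mul_I_im,
      Complex.one_re, Complex.one_im]
    nlinarith [Real.sin_sq_add_cos_sq α]
  rw [e1] at h
  refine h.congr_fun ?_ 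
  intro n
  have e2 : z ^ n / n = ((q ^ n / n : ℝ) : ℂ) * Complex.exp ((n * α : ℝ) * Complex.I) := by
    rw [hz, mul_pow, ← Complex.exp_nat_mul]
    push_cast
    rw [← mul_assoc]
    ring
  rw [e2, Complex.re_ofReal_mul, Complex.exp_ofReal_mul_I_re]

theorem hasSum_arcKernel {q : ℝ} (h0 : 0 ≤ q) (h1 : q < 1) (θ φ : ℝ) :
    HasSum (fun n : ℕ => q ^ n / n * (2 * Real.sin (n * θ) * Real.sin (n * φ)))
      (arcKernel q θ φ) := by
  have hne : ∀ α, arcDist q α ≠ 0 := fun α => by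
    have := one_sub_le_arcDist h0 α
    linarith
  have h := (hasSum_log_arcDist h0 h1 (θ - φ)).sub (hasSum_log_arcDist h0 h1 (θ + φ))
  have e : -Real.log (arcDist q (θ - φ)) - -Real.log (arcDist q (θ + φ)) = arcKernel q θ φ := by
    rw [arcKernel, Real.log_div (hne _) (hne _)]; ring
  rw [e] at h
  refine h.congr_fun fun n => ?_
  rw [mul_sub, mul_add, Real.cos_sub, Real.cos_add]
  ring

/-- Termwise integration, dominated by 2q^n; orthogonality of the sines keeps only n = N. -/
theorem integral_arcKernel_mul_sin_of_lt {q : ℝ} (h0 : 0 ≤ q) (h1 : q < 1) (θ : ℝ) {N : ℕ}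
    (hN : N ≠ 0) :
    ∫ φ in (0 : ℝ)..Real.pi, arcKernel q θ φ * Real.sin (N * φ) =
      Real.pi * q ^ N / N * Real.sin (N * θ) := by
  have hs := intervalIntegral.hasSum_integral_of_dominated_convergence (μ := volume) (a := 0)
    (b := Real.pi)
    (F := fun (n : ℕ) φ => q ^ n / n * (2 * Real.sin (n * θ) * Real.sin (n * φ)) * Real.sin (N * φ))
    (f := fun φ => arcKernel q θ φ * Real.sin (N * φ)) (fun n _ => 2 * q ^ n)
    (fun n => (Continuous.aestronglyMeasurable (by fun_prop)))
    (fun n => .of_forall fun φ _ => ?_)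
    (.of_forall fun φ _ => (summable_geometric_of_lt_one h0 h1).mul_left 2)
    intervalIntegrable_const
    (.of_forall fun φ _ => (hasSum_arcKernel h0 h1 θ φ).mul_right _)
  · have e : ∀ n : ℕ, ∫ φ in (0 : ℝ)..Real.pi,
        q ^ n / n * (2 * Real.sin (n * θ) * Real.sin (n * φ)) * Real.sin (N * φ) =
        if n = N then Real.pi * q ^ N / N * Real.sin (N * θ) else 0 := by
      intro n
      have e1 : ∀ φ : ℝ, q ^ n / n * (2 * Real.sin (n * θ) * Real.sin (n * φ)) * Real.sin (N * φ) =
          q ^ n / n * (2 * Real.sin (n * θ)) * (Real.sin (n * φ) * Real.sin (N * φ)) := fun φ => by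
        ring
      simp only [e1]
      rw [intervalIntegral.integral_const_mul, integral_sin_mul_sin n N hN]
      split_ifs with h
      · subst h; ring
      · rw [mul_zero]
    simp only [e] at hs
    exact hs.unique (hasSum_ite_eq N _)
  · have hq : |q ^ n / n| ≤ q ^ n := by
      rw [abs_of_nonneg (by positivity)]
      rcases n with _ | n
      · simp
      · exact div_le_self (by positivity) (by push_cast; linarith [(Nat.cast_nonneg n : (0 : ℝ) ≤ n)])
    rw [Real.norm_eq_abs, abs_mul, abs_mul, abs_mul, abs_mul, abs_two]
    have s1 := Real.abs_sin_le_one (n * θ)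
    have s2 := Real.abs_sin_le_one (n * φ)
    have s3 := Real.abs_sin_le_one (N * φ)
    calc |q ^ n / n| * (2 * |Real.sin (n * θ)| * |Real.sin (n * φ)|) * |Real.sin (N * φ)|
        ≤ q ^ n * (2 * 1 * 1) * 1 := by gcongr
      _ = 2 * q ^ n := by ring

/-- The functions `sin (N φ)` are eigenfunctions of the kernel. -/
theorem integral_arcKernel_mul_sin {q : ℝ} (h0 : 0 ≤ q) (h1 : q ≤ 1) (θ : ℝ) {N : ℕ}
    (hN : N ≠ 0) :
    ∫ φ in (0 : ℝ)..Real.pi, arcKernel q θ φ * Real.sin (N * φ) =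
      Real.pi * q ^ N / N * Real.sin (N * θ) := by
  rcases h1.lt_or_eq with h1 | rfl
  · exact integral_arcKernel_mul_sin_of_lt h0 h1 θ hN
  -- At q = 1 the geometric domination is lost. The identity is obtained by letting q tend to 1 from
  -- below, under the bound `kernelBound`, which does not depend on q.
  have hq : ∀ᶠ q : ℝ in 𝓝[<] 1, 0 ≤ q ∧ q < 1 := by
    filter_upwards [Ioo_mem_nhdsLT (zero_lt_one' ℝ)] with q hq
    exact ⟨hq.1.le, hq.2⟩
  have hl : Tendsto (fun q => ∫ φ in (0 : ℝ)..Real.pi, arcKernel q θ φ * Real.sin (N * φ)) (𝓝[<] 1)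
      (𝓝 (∫ φ in (0 : ℝ)..Real.pi, arcKernel 1 θ φ * Real.sin (N * φ))) := by
    refine intervalIntegral.tendsto_integral_filter_of_dominated_convergence (kernelBound θ)
      (.of_forall fun q => ?_) ?_ (intervalIntegrable_kernelBound θ) ?_
    · exact (((measurable_arcKernel q).of_uncurry_left (x := θ)).mul
        (by fun_prop)).aestronglyMeasurable
    · filter_upwards [hq] with q hq
      filter_upwards [ae_sin_ne_zero θ] with φ hφ _
      rw [Real.norm_eq_abs, abs_mul]
      have := abs_arcKernel_le hq.1 hq.2.le hφ.1 hφ.2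
      calc _ ≤ kernelBound θ φ * 1 :=
            mul_le_mul this (Real.abs_sin_le_one _) (abs_nonneg _) ((abs_nonneg _).trans this)
        _ = _ := mul_one _
    · filter_upwards [ae_sin_ne_zero θ] with φ hφ _
      have hd : ∀ α, Tendsto (fun q => arcDist q α) (𝓝[<] 1) (𝓝 (arcDist 1 α)) := fun α =>
        ((continuous_arcDist.comp (f := fun q : ℝ => (q, α)) (by fun_prop)).tendsto 1).mono_left
          nhdsWithin_le_nhds
      have hne : ∀ α, Real.sin α ≠ 0 → arcDist 1 α ≠ 0 := fun α h =>
        ((abs_pos.2 h).trans_le (abs_sin_le_arcDist 1 α)).ne'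
      refine Tendsto.mul_const _ ?_
      exact ((hd _).div (hd _) (hne _ hφ.2)).log (div_ne_zero (hne _ hφ.1) (hne _ hφ.2))
  have hr : Tendsto (fun q : ℝ => Real.pi * q ^ N / N * Real.sin (N * θ)) (𝓝[<] 1)
      (𝓝 (Real.pi * 1 ^ N / N * Real.sin (N * θ))) := by
    have : Continuous fun q : ℝ => Real.pi * q ^ N / N * Real.sin (N * θ) := by fun_prop
    exact (this.tendsto 1).mono_left nhdsWithin_le_nhds
  refine tendsto_nhds_unique hl (hr.congr' ?_)
  filter_upwards [hq] with q hq
  exact (integral_arcKernel_mul_sin_of_lt hq.1 hq.2 θ hN).symm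

/-! ### Solution of the recursions -/

/-- From 2 cos t sin((n+1)t) = sin((n+2)t) + sin(nt): multiplication by g + 2r cos t acts on sine
coefficients by the three-term recursion of F. Since sin 0 = 0, the boundary case needs no separate
rule. -/
theorem integral_affine_cos_mul_sin {w : ℝ → ℝ} (hw : IntervalIntegrable w volume 0 Real.pi)
    (g r : ℝ) (n : ℕ) :
    ∫ t in (0 : ℝ)..Real.pi, (g + 2 * r * Real.cos t) * w t * Real.sin ((n + 1 : ℕ) * t) =
      g * (∫ t in (0 : ℝ)..Real.pi, w t * Real.sin ((n + 1 : ℕ) * t)) +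
        r * ((∫ t in (0 : ℝ)..Real.pi, w t * Real.sin ((n + 2 : ℕ) * t)) +
          ∫ t in (0 : ℝ)..Real.pi, w t * Real.sin (n * t)) := by
  have hi : ∀ m : ℕ, IntervalIntegrable (fun t => w t * Real.sin (m * t)) volume 0 Real.pi :=
    fun m => hw.mul_continuousOn (Continuous.continuousOn (by fun_prop))
  rw [← intervalIntegral.integral_add (hi _) (hi _), ← intervalIntegral.integral_const_mul,
    ← intervalIntegral.integral_const_mul,
    ← intervalIntegral.integral_add ((hi _).const_mul _) (((hi _).add (hi _)).const_mul _)]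
  refine intervalIntegral.integral_congr fun t _ => ?_
  have e1 : ((n + 2 : ℕ) : ℝ) * t = ((n + 1 : ℕ) : ℝ) * t + t := by push_cast; ring
  have e2 : (n : ℝ) * t = ((n + 1 : ℕ) : ℝ) * t - t := by push_cast; ring
  simp only [e1, e2, Real.sin_add, Real.sin_sub]
  ring

/-- The weight `(γ + 2 r cos θ)^a sin θ`. -/
noncomputable def arcWeight (g r : ℝ) (a : ℕ) (θ : ℝ) : ℝ :=
  (g + 2 * r * Real.cos θ) ^ a * Real.sin θ

theorem continuous_arcWeight (g r : ℝ) (a : ℕ) : Continuous (arcWeight g r a) := by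
  unfold arcWeight; fun_prop

/-- The sine coefficients of `arcWeight`. -/
noncomputable def weightCoeff (g r : ℝ) (a n : ℕ) : ℝ :=
  ∫ θ in (0 : ℝ)..Real.pi, arcWeight g r a θ * Real.sin (n * θ)

theorem weightCoeff_zero_right (g r : ℝ) (a : ℕ) : weightCoeff g r a 0 = 0 := by
  simp [weightCoeff]

theorem weightCoeff_zero (g r : ℝ) (n : ℕ) :
    weightCoeff g r 0 (n + 1) = if n = 0 then Real.pi / 2 else 0 := by
  have := integral_sin_mul_sin 1 (n + 1) n.succ_ne_zero
  rw [weightCoeff]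
  simp only [arcWeight, pow_zero, one_mul]
  simp only [Nat.cast_one, one_mul] at this
  rw [this]
  by_cases h : n = 0
  · simp [h]
  · rw [if_neg h, if_neg (by omega)]

theorem weightCoeff_succ (g r : ℝ) (a n : ℕ) : weightCoeff g r (a + 1) (n + 1) =
    g * weightCoeff g r a (n + 1) + r * (weightCoeff g r a (n + 2) + weightCoeff g r a n) := by
  have h := integral_affine_cos_mul_sin
    ((continuous_arcWeight g r a).intervalIntegrable 0 Real.pi) g r n
  rw [weightCoeff, weightCoeff, weightCoeff, weightCoeff, ← h]
  refine intervalIntegral.integral_congr fun t _ => ?_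
  simp only [arcWeight, pow_succ]
  ring

theorem integrableOn_mul_arcKernel {q : ℝ} (h0 : 0 ≤ q) (h1 : q ≤ 1) {f : ℝ × ℝ → ℝ}
    (hf : Continuous f) :
    IntegrableOn (fun p : ℝ × ℝ => f p * arcKernel q p.1 p.2)
      (Set.Ioc 0 Real.pi ×ˢ Set.Ioc 0 Real.pi) :=
  IntegrableOn.continuousOn_mul_of_subset (K := Set.Icc 0 Real.pi ×ˢ Set.Icc 0 Real.pi)
    hf.continuousOn (integrable_arcKernel h0 h1)
    (isCompact_Icc.prod isCompact_Icc) (measurableSet_Ioc.prod measurableSet_Ioc)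
    (Set.prod_mono Set.Ioc_subset_Icc_self Set.Ioc_subset_Icc_self)

theorem intervalIntegrable_integral {g : ℝ → ℝ → ℝ}
    (hg : IntegrableOn (fun p : ℝ × ℝ => g p.1 p.2) (Set.Ioc 0 Real.pi ×ˢ Set.Ioc 0 Real.pi)) :
    IntervalIntegrable (fun θ => ∫ φ in (0 : ℝ)..Real.pi, g θ φ) volume 0 Real.pi := by
  rw [intervalIntegrable_iff_integrableOn_Ioc_of_le Real.pi_nonneg]
  simp only [intervalIntegral.integral_of_le Real.pi_nonneg]
  rw [IntegrableOn, Measure.volume_eq_prod, ← Measure.prod_restrict] at hg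
  exact hg.integral_prod_left

/-- The iterated integral of the kernel against weights. -/
noncomputable def kernelCoeff (g r₁ r₂ q : ℝ) (a b n : ℕ) : ℝ :=
  ∫ θ in (0 : ℝ)..Real.pi, arcWeight g r₁ a θ *
    ∫ φ in (0 : ℝ)..Real.pi, (g + 2 * r₂ * Real.cos φ) ^ b * arcKernel q θ φ * Real.sin (n * φ)

theorem kernelCoeff_zero_right (g r₁ r₂ q : ℝ) (a b : ℕ) : kernelCoeff g r₁ r₂ q a b 0 = 0 := by
  simp [kernelCoeff]

theorem kernelCoeff_zero (g r₁ r₂ : ℝ) {q : ℝ} (h0 : 0 ≤ q) (h1 : q ≤ 1) (a n : ℕ) :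
    kernelCoeff g r₁ r₂ q a 0 (n + 1) =
      Real.pi * q ^ (n + 1) / (n + 1) * weightCoeff g r₁ a (n + 1) := by
  rw [kernelCoeff, weightCoeff, ← intervalIntegral.integral_const_mul]
  refine intervalIntegral.integral_congr fun θ _ => ?_
  simp only [pow_zero, one_mul]
  rw [integral_arcKernel_mul_sin h0 h1 θ (show n + 1 ≠ 0 by omega)]
  push_cast
  ring

/-- The recursion of the inner integral passes through the outer one; the inner integrals are
integrable in θ because the kernel is jointly integrable. -/
theorem kernelCoeff_succ (g r₁ r₂ : ℝ) {q : ℝ} (h0 : 0 ≤ q) (h1 : q ≤ 1) (a b n : ℕ) :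
    kernelCoeff g r₁ r₂ q a (b + 1) (n + 1) = g * kernelCoeff g r₁ r₂ q a b (n + 1) +
      r₂ * (kernelCoeff g r₁ r₂ q a b (n + 2) + kernelCoeff g r₁ r₂ q a b n) := by
  have hi : ∀ m : ℕ, IntervalIntegrable (fun θ => arcWeight g r₁ a θ *
      ∫ φ in (0 : ℝ)..Real.pi, (g + 2 * r₂ * Real.cos φ) ^ b * arcKernel q θ φ * Real.sin (m * φ))
      volume 0 Real.pi := by
    intro m
    refine IntervalIntegrable.continuousOn_mul ?_ (continuous_arcWeight g r₁ a).continuousOn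
    have := integrableOn_mul_arcKernel h0 h1
      (f := fun p => (g + 2 * r₂ * Real.cos p.2) ^ b * Real.sin (m * p.2)) (by fun_prop)
    refine intervalIntegrable_integral (this.congr (.of_forall fun p => ?_))
    simp only
    ring
  simp only [kernelCoeff]
  rw [← intervalIntegral.integral_add (hi _) (hi _), ← intervalIntegral.integral_const_mul,
    ← intervalIntegral.integral_const_mul,
    ← intervalIntegral.integral_add ((hi _).const_mul _) (((hi _).add (hi _)).const_mul _)]
  refine intervalIntegral.integral_congr fun θ _ => ?_
  have h := integral_affine_cos_mul_sin (w := fun φ => (g + 2 * r₂ * Real.cos φ) ^ b *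
    arcKernel q θ φ) ((intervalIntegrable_arcKernel h0 h1 θ).continuousOn_mul
      (Continuous.continuousOn (by fun_prop))) g r₂ n
  have e : ∀ φ : ℝ, (g + 2 * r₂ * Real.cos φ) ^ (b + 1) * arcKernel q θ φ *
      Real.sin ((n + 1 : ℕ) * φ) = (g + 2 * r₂ * Real.cos φ) *
        ((g + 2 * r₂ * Real.cos φ) ^ b * arcKernel q θ φ) * Real.sin ((n + 1 : ℕ) * φ) := fun φ => by
    rw [pow_succ]; ring
  simp only [e]
  rw [h]
  ring

/-! ### The limiting covariance in angular coordinates -/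

/-- The signed half-amplitude of `x(z)` on the circle `|z|² = η/γ`. -/
noncomputable def arcAmp (gam eta : ℝ) : ℝ := -(gam * Real.sqrt (eta / gam))

theorem xCoord_arc (gam eta θ : ℝ) :
    xCoord gam (arc gam eta θ) = gam + 2 * arcAmp gam eta * Real.cos θ := by
  rw [xCoord, arc, Complex.re_ofReal_mul, Complex.exp_ofReal_mul_I_re, arcAmp]
  ring

theorem deriv_xCoord_arc (gam eta θ : ℝ) :
    deriv (fun t => xCoord gam (arc gam eta t)) θ = -(2 * arcAmp gam eta * Real.sin θ) := by
  simp only [xCoord_arc]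
  have h : HasDerivAt (fun t => gam + 2 * arcAmp gam eta * Real.cos t)
      (2 * arcAmp gam eta * -Real.sin θ) θ :=
    ((Real.hasDerivAt_cos θ).const_mul _).const_add gam
  rw [h.deriv]
  ring

theorem covIntegrand_of_amp_eq_zero {gam eta₁ eta₂ : ℝ}
    (h : arcAmp gam eta₁ * arcAmp gam eta₂ = 0) (c : ℝ) (k l : ℕ) (θ φ : ℝ) :
    covIntegrand gam eta₁ eta₂ c k l θ φ = 0 := by
  rw [covIntegrand, deriv_xCoord_arc, deriv_xCoord_arc]
  rcases mul_eq_zero.1 h with h | h <;> simp [h]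

/-- The common modulus √(η₁/γ)√(η₂/γ) cancels in the quotient, leaving q = c/√(η₁η₂) and the two
unit vectors. -/
theorem covKernel_arc {gam eta₁ eta₂ c q : ℝ}
    (hm : Real.sqrt (eta₁ / gam) * Real.sqrt (eta₂ / gam) ≠ 0)
    (hq : c / gam = Real.sqrt (eta₁ / gam) * Real.sqrt (eta₂ / gam) * q) (θ φ : ℝ) :
    covKernel gam c (arc gam eta₁ θ) (arc gam eta₂ φ) =
      1 / (2 * Real.pi) * arcKernel q θ φ := by
  rw [covKernel, arcKernel, arcDist, arcDist, ← norm_div]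
  congr 3
  set m₁ := Real.sqrt (eta₁ / gam)
  set m₂ := Real.sqrt (eta₂ / gam)
  have hm' : (m₁ : ℂ) * m₂ ≠ 0 := by exact_mod_cast hm
  rw [hq]
  have e1 : ((m₁ * m₂ * q : ℝ) : ℂ) - arc gam eta₁ θ * arc gam eta₂ φ =
      (m₁ * m₂) * ((q : ℂ) - Complex.exp ((θ + φ : ℝ) * Complex.I)) := by
    rw [arc, arc]
    push_cast
    rw [add_mul, Complex.exp_add]
    ring
  have e2 : ((m₁ * m₂ * q : ℝ) : ℂ) - arc gam eta₁ θ * (starRingEnd ℂ) (arc gam eta₂ φ) =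
      (m₁ * m₂) * ((q : ℂ) - Complex.exp ((θ - φ : ℝ) * Complex.I)) := by
    rw [arc, arc, map_mul, Complex.conj_ofReal, ← Complex.exp_conj, map_mul, Complex.conj_I,
      Complex.conj_ofReal]
    push_cast
    rw [sub_mul, sub_eq_add_neg ((θ : ℂ) * Complex.I), Complex.exp_add, mul_neg]
    ring
  rw [e1, e2, mul_div_mul_left _ _ hm']

theorem covIntegrand_eq {gam eta₁ eta₂ c q : ℝ}
    (hm : Real.sqrt (eta₁ / gam) * Real.sqrt (eta₂ / gam) ≠ 0)
    (hq : c / gam = Real.sqrt (eta₁ / gam) * Real.sqrt (eta₂ / gam) * q) (a b : ℕ) (θ φ : ℝ) :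
    covIntegrand gam eta₁ eta₂ c (a + 1) (b + 1) θ φ =
      2 * arcAmp gam eta₁ * arcAmp gam eta₂ / Real.pi *
        (arcWeight gam (arcAmp gam eta₁) a θ * ((gam + 2 * arcAmp gam eta₂ * Real.cos φ) ^ b *
          arcKernel q θ φ * Real.sin φ)) := by
  rw [covIntegrand, covKernel_arc hm hq, deriv_xCoord_arc, deriv_xCoord_arc, xCoord_arc, xCoord_arc,
    arcWeight, Nat.add_sub_cancel, Nat.add_sub_cancel]
  have := Real.pi_ne_zero
  field_simp

theorem integral_covIntegrand {gam eta₁ eta₂ c q : ℝ}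
    (hm : Real.sqrt (eta₁ / gam) * Real.sqrt (eta₂ / gam) ≠ 0)
    (hq : c / gam = Real.sqrt (eta₁ / gam) * Real.sqrt (eta₂ / gam) * q) (a b : ℕ) :
    ∫ θ in (0 : ℝ)..Real.pi, ∫ φ in (0 : ℝ)..Real.pi,
      covIntegrand gam eta₁ eta₂ c (a + 1) (b + 1) θ φ =
      2 * arcAmp gam eta₁ * arcAmp gam eta₂ / Real.pi *
        kernelCoeff gam (arcAmp gam eta₁) (arcAmp gam eta₂) q a b 1 := by
  simp only [covIntegrand_eq hm hq, intervalIntegral.integral_const_mul, kernelCoeff, Nat.cast_one,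
    one_mul]

theorem integrableOn_covIntegrand {gam eta₁ eta₂ c q : ℝ}
    (hm : Real.sqrt (eta₁ / gam) * Real.sqrt (eta₂ / gam) ≠ 0)
    (hq : c / gam = Real.sqrt (eta₁ / gam) * Real.sqrt (eta₂ / gam) * q) (h0 : 0 ≤ q) (h1 : q ≤ 1)
    (a b : ℕ) :
    IntegrableOn (fun p : ℝ × ℝ => covIntegrand gam eta₁ eta₂ c (a + 1) (b + 1) p.1 p.2)
      (Set.Ioo 0 Real.pi ×ˢ Set.Ioo 0 Real.pi) := by
  have hw := continuous_arcWeight gam (arcAmp gam eta₁) a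
  have := integrableOn_mul_arcKernel h0 h1
    (f := fun p => 2 * arcAmp gam eta₁ * arcAmp gam eta₂ / Real.pi *
      (arcWeight gam (arcAmp gam eta₁) a p.1 * ((gam + 2 * arcAmp gam eta₂ * Real.cos p.2) ^ b *
        Real.sin p.2))) (by fun_prop)
  refine IntegrableOn.mono_set (this.congr (.of_forall fun p => ?_))
    (Set.prod_mono Set.Ioo_subset_Ioc_self Set.Ioo_subset_Ioc_self)
  simp only [covIntegrand_eq hm hq]
  ring

theorem arcAmp_sq {gam eta : ℝ} (hg : 0 < gam) (he : 0 ≤ eta) :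
    arcAmp gam eta * arcAmp gam eta = gam * eta := by
  have h := Real.mul_self_sqrt (show 0 ≤ eta / gam by positivity)
  calc arcAmp gam eta * arcAmp gam eta =
        gam * gam * (Real.sqrt (eta / gam) * Real.sqrt (eta / gam)) := by rw [arcAmp]; ring
    _ = gam * eta := by rw [h]; field_simp

/-! ### Identification of the limit with the double integral -/

section Limit

variable {J I₁ I₂ : ℕ → Finset ℕ} {gam eta₁ eta₂ c : ℝ}

/-- The recursions are solved by sine coefficients of powers of x(z), where r_i² = γη_i and r₁r₂q =
γc. -/
theorem tendsto_state_of_nondegenerate (hg : 0 < gam) (he₁ : 0 ≤ eta₁) (he₂ : 0 ≤ eta₂)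
    (hm : Real.sqrt (eta₁ / gam) * Real.sqrt (eta₂ / gam) ≠ 0) {q : ℝ}
    (hq : c / gam = Real.sqrt (eta₁ / gam) * Real.sqrt (eta₂ / gam) * q) (h0 : 0 ≤ q) (h1 : q ≤ 1)
    (hJ₁ : ∀ L, I₁ L ⊆ J L) (hJ₂ : ∀ L, I₂ L ⊆ J L)
    (h₁ : Tendsto (fun L : ℕ => ((I₁ L).card : ℝ) / L) atTop (𝓝 eta₁))
    (h₂ : Tendsto (fun L : ℕ => ((I₂ L).card : ℝ) / L) atTop (𝓝 eta₂))
    (hc : Tendsto (fun L : ℕ => ((I₁ L ∩ I₂ L).card : ℝ) / L) atTop (𝓝 c)) (a b : ℕ) :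
    Tendsto (fun L : ℕ => state (J L) (gam * L)
      (fluctuation gam L (a + 1) (hJ₁ L) * fluctuation gam L (b + 1) (hJ₂ L))) atTop
      (𝓝 ((((a + 1 : ℕ) : ℝ) * (b + 1 : ℕ) / Real.pi * ∫ θ in (0 : ℝ)..Real.pi,
        ∫ φ in (0 : ℝ)..Real.pi, covIntegrand gam eta₁ eta₂ c (a + 1) (b + 1) θ φ : ℝ) : ℂ)) := by
  rw [integral_covIntegrand hm hq]
  have hr₁ : arcAmp gam eta₁ ≠ 0 :=
    neg_ne_zero.2 (mul_ne_zero hg.ne' (left_ne_zero_of_mul hm))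
  have hs₁ := arcAmp_sq hg he₁
  have hs₂ := arcAmp_sq hg he₂
  have hrc : arcAmp gam eta₁ * arcAmp gam eta₂ * q = gam * c := by
    have : c = gam * (Real.sqrt (eta₁ / gam) * Real.sqrt (eta₂ / gam) * q) := by
      rw [← hq]; field_simp
    rw [this, arcAmp, arcAmp]
    ring
  set r₁ := arcAmp gam eta₁
  set r₂ := arcAmp gam eta₂
  have hg0 := hg.ne'
  have hpi := Real.pi_ne_zero
  have hb1 : r₁ / gam * gam = r₁ := div_mul_cancel₀ _ hg0
  have hb2 : r₂ / gam * gam = r₂ := div_mul_cancel₀ _ hg0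
  have hk1 : c / r₁ * r₁ = c := div_mul_cancel₀ _ hr₁
  have hb3 : r₁ * (r₁ / gam) = eta₁ := by rw [mul_div_assoc', hs₁]; field_simp
  have hb4 : r₂ * (r₂ / gam) = eta₂ := by rw [mul_div_assoc', hs₂]; field_simp
  have hk2 : r₂ / gam * q = c / r₁ := by
    rw [eq_div_iff hr₁]
    have : r₂ / gam * q * r₁ = r₁ * r₂ * q / gam := by ring
    rw [this, hrc]; field_simp
  have hk3 : r₁ * (r₂ / gam) * q = c := by rw [mul_assoc, hk2, mul_comm, hk1]
  have key := tendsto_state_fluctuation_mul (gam := gam) hJ₁ hJ₂ h₁ h₂ hc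
    -- A letter of the first block carries r₁/γ, which turns the weights γ and η₁ into r₁. A letter
    -- of the second block carries c/r₁, so that its removal has weight c. The factor 2/π normalises
    -- ∫ sin² = π/2, and the mode i + j + 1 is one more than the number of letters.
    (lam := fun a i j => c * (c / r₁) ^ j * (r₁ / gam) ^ i * (2 / Real.pi) *
      weightCoeff gam r₁ a (i + j + 1))
    (fun i j => by
      simp only [weightCoeff_zero]
      by_cases h : i = 0 ∧ j = 0
      · obtain ⟨rfl, rfl⟩ := h
        simp only [add_zero, if_true, pow_zero, mul_one, and_self]
        field_simp
      · rw [if_neg h, if_neg (by omega), mul_zero])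
    (fun a i j => by
      have e : i + 1 + j + 1 = (i + j + 1) + 1 := by ring
      have e2 : i + 2 + j + 1 = (i + j + 1) + 2 := by ring
      rw [e, e2, weightCoeff_succ]
      set s1 := weightCoeff gam r₁ a (i + j + 1)
      set s2 := weightCoeff gam r₁ a (i + j + 1 + 2)
      rw [← hb3]
      simp only [pow_succ]
      linear_combination (-(c * (c / r₁) ^ j * (r₁ / gam) ^ i * (r₁ / gam) * (2 / Real.pi) * s2)) *
        hb1)
    (fun a j => by
      have e : 0 + (j + 1) + 1 = (j + 1) + 1 := by ring
      have e2 : 1 + (j + 1) + 1 = (j + 1) + 2 := by ring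
      have e3 : 0 + j + 1 = j + 1 := by ring
      rw [e, e2, e3, weightCoeff_succ]
      set s1 := weightCoeff gam r₁ a (j + 1)
      set s2 := weightCoeff gam r₁ a (j + 1 + 2)
      simp only [pow_succ, pow_zero, mul_one, one_mul]
      linear_combination (-(c * (c / r₁) ^ j * (c / r₁) * (2 / Real.pi) * s2)) * hb1 +
        (c * (c / r₁) ^ j * (2 / Real.pi) * s1) * hk1)
    (fun a => by
      have e := weightCoeff_succ gam r₁ a 0
      rw [weightCoeff_zero_right, add_zero] at e
      simp only [zero_add, add_zero, pow_zero, pow_one, mul_one, Nat.reduceAdd] at e ⊢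
      rw [e]
      linear_combination (-(c * (2 / Real.pi) * weightCoeff gam r₁ a 2)) * hb1)
    a b
    -- The same rescaling with r₂. The constant is forced at b = 0: there the kernel has eigenvalue
    -- πq^{m+1}/(m+1), whose denominator is that of the radial integration, and r₂q/γ = c/r₁.
    (the := fun b m => (r₂ / gam) ^ m * (2 * r₁ * r₂ / (gam * Real.pi ^ 2)) *
      kernelCoeff gam r₁ r₂ q a b (m + 1))
    (fun m => by
      have hm0 : (m : ℝ) + 1 ≠ 0 := by positivity
      rw [kernelCoeff_zero gam r₁ r₂ h0 h1]
      simp only [zero_add, pow_zero, mul_one]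
      rw [← hk2, mul_pow]
      have hk3' : c = r₁ * (r₂ / gam) * q := hk3.symm
      rw [hk3']
      field_simp
      try ring)
    (fun b m => by
      rw [kernelCoeff_succ gam r₁ r₂ h0 h1, ← hb4]
      simp only [pow_succ]
      set C := 2 * r₁ * r₂ / (gam * Real.pi ^ 2)
      have e2 : m + 1 + 2 = m + 2 + 1 := by ring
      rw [e2]
      linear_combination (-((r₂ / gam) ^ m * (r₂ / gam) * C *
        kernelCoeff gam r₁ r₂ q a b (m + 2 + 1))) * hb2)
    (fun b => by
      have e := kernelCoeff_succ gam r₁ r₂ h0 h1 a b 0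
      rw [kernelCoeff_zero_right, add_zero] at e
      simp only [zero_add, pow_zero, pow_one, one_mul, Nat.reduceAdd] at e ⊢
      set C := 2 * r₁ * r₂ / (gam * Real.pi ^ 2)
      rw [e]
      linear_combination (-(C * kernelCoeff gam r₁ r₂ q a b 2)) * hb2)
  have efin : ((a : ℝ) + 1) * (b + 1) * (gam * ((r₂ / gam) ^ 0 *
      (2 * r₁ * r₂ / (gam * Real.pi ^ 2)) * kernelCoeff gam r₁ r₂ q a b (0 + 1))) =
      ((a + 1 : ℕ) : ℝ) * (b + 1 : ℕ) / Real.pi *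
        (2 * r₁ * r₂ / Real.pi * kernelCoeff gam r₁ r₂ q a b 1) := by
    push_cast
    simp only [pow_zero, one_mul]
    field_simp
  rw [← efin]
  exact key

/-- For c = 0 the initial condition vanishes, so the zero sequences solve the recursions. -/
theorem tendsto_state_of_degenerate
    (hJ₁ : ∀ L, I₁ L ⊆ J L) (hJ₂ : ∀ L, I₂ L ⊆ J L)
    (h₁ : Tendsto (fun L : ℕ => ((I₁ L).card : ℝ) / L) atTop (𝓝 eta₁))
    (h₂ : Tendsto (fun L : ℕ => ((I₂ L).card : ℝ) / L) atTop (𝓝 eta₂))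
    (hc : Tendsto (fun L : ℕ => ((I₁ L ∩ I₂ L).card : ℝ) / L) atTop (𝓝 0)) (a b : ℕ) :
    Tendsto (fun L : ℕ => state (J L) (gam * L)
      (fluctuation gam L (a + 1) (hJ₁ L) * fluctuation gam L (b + 1) (hJ₂ L))) atTop (𝓝 0) := by
  have := tendsto_state_fluctuation_mul (gam := gam) hJ₁ hJ₂ h₁ h₂ hc (lam := fun _ _ _ => 0)
    (by simp) (by simp) (by simp) (by simp) a b (the := fun _ _ => 0) (by simp) (by simp) (by simp)
  simpa using this

end Limit

end UnitaryPlancherel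

open UnitaryPlancherel
theorem mainTheorem3 (gam : ℝ) (hgam : 0 < gam) (k l : ℕ) (hk : 1 ≤ k) (hl : 1 ≤ l)
    (I₁ I₂ : ℕ → Finset ℕ) (eta₁ eta₂ c : ℝ)
    (h₁ : Tendsto (fun L : ℕ => ((I₁ L).card : ℝ) / L) atTop (𝓝 eta₁))
    (h₂ : Tendsto (fun L : ℕ => ((I₂ L).card : ℝ) / L) atTop (𝓝 eta₂))
    (hc : Tendsto (fun L : ℕ => ((I₁ L ∩ I₂ L).card : ℝ) / L) atTop (𝓝 c)) :
    (∀ (n : ℕ) (I : Finset ℕ), 1 ≤ n → CorrespondsTo I (pElt n I) (shiftedPowerSum I.card n)) ∧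
    MeasureTheory.IntegrableOn (fun q : ℝ × ℝ => covIntegrand gam eta₁ eta₂ c k l q.1 q.2)
      (Set.Ioo 0 Real.pi ×ˢ Set.Ioo 0 Real.pi) ∧
    ∀ (J : ℕ → Finset ℕ) (hJ₁ : ∀ L, I₁ L ⊆ J L) (hJ₂ : ∀ L, I₂ L ⊆ J L),
      Tendsto (fun L : ℕ => state (J L) (gam * L)
          (fluctuation gam L k (hJ₁ L) * fluctuation gam L l (hJ₂ L))) atTop
        (𝓝 (((k : ℝ) * l / Real.pi * ∫ θ in (0 : ℝ)..Real.pi, ∫ φ in (0 : ℝ)..Real.pi,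
          covIntegrand gam eta₁ eta₂ c k l θ φ : ℝ) : ℂ)) := by
  obtain ⟨a, rfl⟩ : ∃ a, k = a + 1 := ⟨k - 1, by omega⟩
  obtain ⟨b, rfl⟩ : ∃ b, l = b + 1 := ⟨l - 1, by omega⟩
  refine ⟨fun n I _ => pElt_correspondsTo n I, ?_⟩
  have he₁ : 0 ≤ eta₁ := ge_of_tendsto' h₁ fun L => by positivity
  have he₂ : 0 ≤ eta₂ := ge_of_tendsto' h₂ fun L => by positivity
  have hc0 : 0 ≤ c := ge_of_tendsto' hc fun L => by positivity
  have hc₁ : c ≤ eta₁ := le_of_tendsto_of_tendsto' hc h₁ fun L =>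
    div_le_div_of_nonneg_right (by exact_mod_cast Finset.card_le_card Finset.inter_subset_left)
      L.cast_nonneg
  have hc₂ : c ≤ eta₂ := le_of_tendsto_of_tendsto' hc h₂ fun L =>
    div_le_div_of_nonneg_right (by exact_mod_cast Finset.card_le_card Finset.inter_subset_right)
      L.cast_nonneg
  -- If an arc degenerates, its differential dx is zero, and c ≤ min(η₁, η₂) forces c = 0.
  by_cases hm : Real.sqrt (eta₁ / gam) * Real.sqrt (eta₂ / gam) = 0
  · have hamp : arcAmp gam eta₁ * arcAmp gam eta₂ = 0 := by
      rw [arcAmp, arcAmp]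
      linear_combination gam * gam * hm
    have h0 : c = 0 := by
      rw [← Real.sqrt_mul (by positivity), Real.sqrt_eq_zero (by positivity), mul_eq_zero,
        div_eq_zero_iff, div_eq_zero_iff] at hm
      rcases hm with (h | h) | (h | h) <;> linarith
    subst h0
    simp only [covIntegrand_of_amp_eq_zero hamp]
    refine ⟨MeasureTheory.integrableOn_zero, fun J hJ₁ hJ₂ => ?_⟩
    simpa using tendsto_state_of_degenerate (gam := gam) hJ₁ hJ₂ h₁ h₂ hc a b
  · have hm0 : 0 < Real.sqrt (eta₁ / gam) * Real.sqrt (eta₂ / gam) :=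
      lt_of_le_of_ne (by positivity) (Ne.symm hm)
    have hq : c / gam = Real.sqrt (eta₁ / gam) * Real.sqrt (eta₂ / gam) *
        (c / gam / (Real.sqrt (eta₁ / gam) * Real.sqrt (eta₂ / gam))) :=
      (mul_div_cancel₀ _ hm).symm
    have hq0 : 0 ≤ c / gam / (Real.sqrt (eta₁ / gam) * Real.sqrt (eta₂ / gam)) := by positivity
    -- The inequality c² ≤ η₁η₂ follows from c ≤ η₁ and c ≤ η₂. The value q = 1 does occur, for
    -- example when I₁ = I₂.
    have hq1 : c / gam / (Real.sqrt (eta₁ / gam) * Real.sqrt (eta₂ / gam)) ≤ 1 := by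
      rw [div_le_one hm0, ← Real.sqrt_mul (by positivity)]
      refine Real.le_sqrt_of_sq_le ?_
      rw [sq]
      exact mul_le_mul (div_le_div_of_nonneg_right hc₁ hgam.le)
        (div_le_div_of_nonneg_right hc₂ hgam.le) (by positivity) (by positivity)
    exact ⟨integrableOn_covIntegrand hm hq hq0 hq1 a b, fun J hJ₁ hJ₂ =>
      tendsto_state_of_nondegenerate hgam he₁ he₂ hm hq hq0 hq1 hJ₁ hJ₂ h₁ h₂ hc a b⟩
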